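/- Let $M$ be a von Neumann algebra with a fixed tracial state $\varphi$. For a finite tuple $X=(x_1,\dots,x_n)$ of selfadjoint elements of $M$, $m,k\in\mathbb N$ and $\gamma>0$, let $\Gamma(X;m,k,\gamma)$ be the set of all $n$-tuples $(A_1,\dots,A_n)$ of selfadjoint complex $k\times k$ matrices such that $$|\mathrm{tr}_k(A_{i_1}\cdots A_{i_p})-\varphi(x_{i_1}\cdots x_{i_p})|<\gamma\qquad\text{for all }1\le p\le m,\ 1\le i_1,\dots,i_p\le n,$$ where $\mathrm{tr}_k$ is the normalized trace. Let $\mathrm{vol}$ be Lebesgue measure on the space of $n$-tuples of selfadjoint $k\times k$ matrices, with respect to the Euclidean norm $|(A_1,\dots,A_n)|_2=\big(\sum_{i=1}^n \mathrm{tr}_k(A_i^2)\big)^{1/2}$, and define the (microstates) free entropy of $X$ in $[-\infty,\infty]$ by $$\chi(X;m,\gamma)=\limsup_{k\to\infty}\big[k^{-2}\log \mathrm{vol}(\Gamma(X;m,k,\gamma))+n\log k\big],\qquad \chi(X)=\inf\{\chi(X;m,\gamma):m\in\mathbb N,\ \gamma>0\}.$$ **Corollary 2.4.** Let $F,G$ be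 finite tuples of selfadjoint elements of $M$ and let $a=a^*\in M$ satisfy $\chi(a)>-\infty$. Then $$\chi(F\cup G\cup\{a\})\le\chi(F\cup\{a\})+\chi(G\cup\{a\})-\chi(a),$$ where $\cup$ denotes concatenation of tuples. -/

import Mathlib

open scoped ENNReal ComplexOrder

namespace FreeEntropy

/-- `φ` is a tracial state on the unital C⋆-algebra `M`: a positive unital linear functional with
`φ (x y) = φ (y x)`. -/
structure IsTracialState {M : Type*} [CStarAlgebra M] (φ : M →ₗ[ℂ] ℂ) : Prop where
  map_one : φ 1 = 1
  nonneg : ∀ x : M, 0 ≤ φ (star x * x)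
  tracial : ∀ x y : M, φ (x * y) = φ (y * x)

/-- The normalized trace `tr_k` on `k × k` matrices. -/
noncomputable def ntr {k : ℕ} (A : Matrix (Fin k) (Fin k) ℂ) : ℂ := (k : ℂ)⁻¹ * A.trace

/-- The monomial `x_{w 0} x_{w 1} ⋯ x_{w (p-1)}`, the factors being taken in this order. -/
def monomial {R ι : Type*} [Monoid R] (x : ι → R) {p : ℕ} (w : Fin p → ι) : R :=
  (List.ofFn fun j => x (w j)).prod

/-- The microstate space `Γ(x; m, k, γ)`: the tuples of selfadjoint `k × k` matrices whose
mixed moments of order at most `m` are `γ`-close to those of the tuple `x`. -/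
def microstates {M ι : Type*} [CStarAlgebra M] (φ : M →ₗ[ℂ] ℂ) (x : ι → M) (m k : ℕ) (γ : ℝ) :
    Set (ι → Matrix (Fin k) (Fin k) ℂ) :=
  {A | (∀ i, (A i).IsHermitian) ∧
    ∀ p : ℕ, 1 ≤ p → p ≤ m → ∀ w : Fin p → ι, ‖ntr (monomial A w) - φ (monomial x w)‖ < γ}

/-- Orthonormal real coordinates on the space of selfadjoint `k × k` matrices, for the Euclidean
norm `|A|₂ = tr_k(A²)^{1/2}`. The matrix with coordinates `c` has diagonal entries `√k c_{ii}`
and entries `√(k/2) (c_{ij} + √-1 c_{ji})` for `i < j`. -/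
noncomputable def hermOfCoord {k : ℕ} (c : Fin k → Fin k → ℝ) : Matrix (Fin k) (Fin k) ℂ :=
  Matrix.of fun i j =>
    if i = j then ((√(k : ℝ) * c i i : ℝ) : ℂ)
    else if i < j then ⟨√((k : ℝ) / 2) * c i j, √((k : ℝ) / 2) * c j i⟩
    else ⟨√((k : ℝ) / 2) * c j i, -(√((k : ℝ) / 2) * c i j)⟩

theorem hermOfCoord_isHermitian {k : ℕ} (c : Fin k → Fin k → ℝ) :
    (hermOfCoord c).IsHermitian := by
  ext i j
  rcases lt_trichotomy i j with h | h | h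
  · simp [hermOfCoord, h, h.ne, h.ne', h.not_gt, Complex.ext_iff]
  · subst h
    simp [hermOfCoord]
  · simp [hermOfCoord, h, h.ne, h.ne', h.not_gt, Complex.ext_iff]

theorem hermOfCoord_add {k : ℕ} (c d : Fin k → Fin k → ℝ) :
    hermOfCoord (c + d) = hermOfCoord c + hermOfCoord d := by
  ext i j
  simp only [hermOfCoord, Matrix.of_apply, Matrix.add_apply, Pi.add_apply]
  split_ifs <;> simp [Complex.ext_iff] <;> (try constructor) <;> ring

theorem hermOfCoord_smul {k : ℕ} (r : ℝ) (c : Fin k → Fin k → ℝ) :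
    hermOfCoord (r • c) = r • hermOfCoord c := by
  ext i j
  simp only [hermOfCoord, Matrix.of_apply, Matrix.smul_apply, Pi.smul_apply, smul_eq_mul]
  split_ifs <;> simp [Complex.ext_iff] <;> (try constructor) <;> ring

/-- The coordinates are isometric: `tr_k(A²)` is the sum of the squares of the coordinates. -/
theorem ntr_hermOfCoord_sq {k : ℕ} (c : Fin k → Fin k → ℝ) :
    ntr (hermOfCoord c * hermOfCoord c) = ((∑ i, ∑ j, c i j ^ 2 : ℝ) : ℂ) := by
  rcases Nat.eq_zero_or_pos k with rfl | hk
  · simp [ntr]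
  have hk' : (0 : ℝ) < k := by exact_mod_cast hk
  have h1 : √(k : ℝ) ^ 2 = k := Real.sq_sqrt hk'.le
  have h2 : √((k : ℝ) / 2) ^ 2 = k / 2 := Real.sq_sqrt (by positivity)
  have key : ∀ i j, hermOfCoord c i j * hermOfCoord c j i =
      (((k : ℝ) / 2 * (c i j ^ 2 + c j i ^ 2) : ℝ) : ℂ) := by
    intro i j
    rcases lt_trichotomy i j with h | h | h
    · simp only [hermOfCoord, Matrix.of_apply, h, h.ne, h.ne', h.not_gt, if_true, if_false]
      apply Complex.ext
      · simp only [Complex.mul_re, Complex.ofReal_re]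
        linear_combination (c i j ^ 2 + c j i ^ 2) * h2
      · simp only [Complex.mul_im, Complex.ofReal_im]; ring
    · subst h
      simp only [hermOfCoord, Matrix.of_apply, if_true]
      rw [← Complex.ofReal_mul]
      congr 1
      linear_combination (c i i ^ 2) * h1
    · simp only [hermOfCoord, Matrix.of_apply, h, h.ne, h.ne', h.not_gt, if_true, if_false]
      apply Complex.ext
      · simp only [Complex.mul_re, Complex.ofReal_re]
        linear_combination (c i j ^ 2 + c j i ^ 2) * h2
      · simp only [Complex.mul_im, Complex.ofReal_im]; ring
  have hs : ∑ i, ∑ j, ((k : ℝ) / 2 * (c i j ^ 2 + c j i ^ 2)) = k * ∑ i, ∑ j, c i j ^ 2 := by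
    have : ∑ i, ∑ j, c j i ^ 2 = ∑ i, ∑ j, c i j ^ 2 := Finset.sum_comm
    simp only [← Finset.mul_sum, Finset.sum_add_distrib]
    rw [this]; ring
  have ht : (hermOfCoord c * hermOfCoord c).trace = ((k * ∑ i, ∑ j, c i j ^ 2 : ℝ) : ℂ) := by
    simp only [Matrix.trace, Matrix.diag_apply, Matrix.mul_apply, key]
    rw [← hs]
    push_cast
    rfl
  rw [ntr, ht]
  have : (k : ℂ) ≠ 0 := by exact_mod_cast hk.ne'
  push_cast
  field_simp

/-- Every selfadjoint matrix has coordinates. -/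
theorem exists_hermOfCoord_eq {k : ℕ} {A : Matrix (Fin k) (Fin k) ℂ} (hA : A.IsHermitian) :
    ∃ c : Fin k → Fin k → ℝ, hermOfCoord c = A := by
  rcases Nat.eq_zero_or_pos k with rfl | hk
  · exact ⟨0, by ext i; exact i.elim0⟩
  have hk' : (0 : ℝ) < k := by exact_mod_cast hk
  have h1 : √(k : ℝ) ≠ 0 := by positivity
  have h2 : √((k : ℝ) / 2) ≠ 0 := by positivity
  refine ⟨fun i j => if i = j then (A i i).re / √(k : ℝ)
    else if i < j then (A i j).re / √((k : ℝ) / 2) else (A j i).im / √((k : ℝ) / 2), ?_⟩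
  ext i j
  have hs : A i j = star (A j i) := (hA.apply i j).symm
  rcases lt_trichotomy i j with h | h | h
  · simp only [hermOfCoord, Matrix.of_apply, h, h.ne, h.ne', h.not_gt, if_true, if_false]
    rw [mul_div_cancel₀ _ h2, mul_div_cancel₀ _ h2]
  · subst h
    have him : (A i i).im = 0 := by
      have := congrArg Complex.im hs
      simp at this
      linarith
    simp only [hermOfCoord, Matrix.of_apply, if_true]
    rw [mul_div_cancel₀ _ h1]
    exact Complex.ext (by simp) (by simp [him])
  · simp only [hermOfCoord, Matrix.of_apply, h, h.ne, h.ne', h.not_gt, if_true, if_false]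
    rw [mul_div_cancel₀ _ h2, mul_div_cancel₀ _ h2, hs]
    exact Complex.ext (by simp) (by simp)

/-- Lebesgue measure of a set of tuples of selfadjoint `k × k` matrices, with respect to the
Euclidean norm `|(A_i)|₂ = (∑ i, tr_k(A_i²))^{1/2}`: the Lebesgue measure of the set in
orthonormal coordinates. -/
noncomputable def vol {ι : Type*} [Fintype ι] {k : ℕ}
    (S : Set (ι → Matrix (Fin k) (Fin k) ℂ)) : ℝ≥0∞ :=
  MeasureTheory.volume {c : ι → Fin k → Fin k → ℝ | (fun i => hermOfCoord (c i)) ∈ S}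

/-- `χ(x; m, γ) = limsup_k [k⁻² log vol Γ(x; m, k, γ) + n log k]`, with `n` the length of the
tuple `x` and values in `[-∞, ∞]` (so `log 0 = -∞` and `log ∞ = ∞`). -/
noncomputable def chiAux {M ι : Type*} [CStarAlgebra M] [Fintype ι] (φ : M →ₗ[ℂ] ℂ) (x : ι → M)
    (m : ℕ) (γ : ℝ) : EReal :=
  Filter.limsup (fun k : ℕ =>
    ((((k : ℝ) ^ 2)⁻¹ : ℝ) : EReal) * ENNReal.log (vol (microstates φ x m k γ)) +
      (((Fintype.card ι : ℝ) * Real.log k : ℝ) : EReal)) Filter.atTop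

/-- The microstates free entropy `χ(x) = inf {χ(x; m, γ) : m ∈ ℕ, γ > 0}` of a finite tuple `x`
of selfadjoint elements. -/
noncomputable def chi {M ι : Type*} [CStarAlgebra M] [Fintype ι] (φ : M →ₗ[ℂ] ℂ) (x : ι → M) :
    EReal :=
  ⨅ (m : ℕ) (γ : ℝ) (_ : 0 < γ), chiAux φ x m γ

/-- The one-element tuple `{a}`. -/
def single {M : Type*} (a : M) : Unit → M := fun _ => a

end FreeEntropy

namespace FreeEntropy

open Matrix

/-! ### Hölder-type bounds for traces of words in selfadjoint matrices. -/

section Trace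

variable {k : ℕ}

/-! Write Γ(·) for the microstate spaces at size k. The central fact is that a single selfadjoint
element has essentially one microstate up to unitary conjugation. If A and A' both have moments near
those of a, their increasingly ordered eigenvalues are close in mean square
(`exists_momentsNear_avg_sq_sub_le`), so some conjugate UA'U* is close to A in the normalized
Hilbert–Schmidt norm. A chessboard Hölder inequality controls mixed moments without any cutoff on
operator norms, so A may be replaced by UA'U* in every joint microstate (B, A), with one U for all
B, at the cost of weaker parameters (`exists_exchange`). Lebesgue measure being unitarily invariant,
the fibres of Γ(F ∪ a) over the microstates of a have comparable volumes (`exists_fiberVol_le`). A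
fibre of Γ(F ∪ G ∪ a) lies in the product of the fibres for F and G, and Tonelli's theorem yields
vol Γ(a) · vol Γ(F ∪ G ∪ a) ≤ vol Γ'(F ∪ a) · vol Γ'(G ∪ a), where Γ' has the weaker parameters
(`exists_vol_mul_vol_le`).

To pass to entropies one must divide by vol Γ(a) for all large k, while χ(a) is a limit superior and
only controls infinitely many k. For one variable the two agree
(`eventually_le_vol_microstates_single`). By the Weyl integration formula (`lintegral_hermU`), vol
Γ(a) is a constant times the integral of the squared Vandermonde product over admissible spectra. A
large volume at some size K produces a spectrum of large logarithmic energy. A random subfamily of k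
of its K points has on average the same normalized energy, with moments that deviate by O(k^{-1/2});
fattening a good subfamily to a small box gives a large volume at size k.

The Weyl formula is proved by induction on the size: bordering a diagonal matrix with spectrum x
gives a spectrum y interlacing x, the border is an explicit function of y with a Vandermonde
quotient as Jacobian (`lintegral_border_eq`), and the integral over x is a determinant
(`lintegral_box_vprod`). Stirling's formula gives the growth of the constant
(`tendsto_log_specConst`).

A Gaussian estimate shows that the entropies are below ∞ (`chi_lt_top`), so that with χ(a) > -∞ the
subtraction is harmless. -/

theorem ntr_add (A B : Matrix (Fin k) (Fin k) ℂ) : ntr (A + B) = ntr A + ntr B := by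
  simp [ntr, mul_add]

theorem ntr_mul_comm (A B : Matrix (Fin k) (Fin k) ℂ) : ntr (A * B) = ntr (B * A) := by
  simp [ntr, Matrix.trace_mul_comm A B]

theorem ntr_one (hk : 0 < k) : ntr (1 : Matrix (Fin k) (Fin k) ℂ) = 1 := by
  have : (k : ℂ) ≠ 0 := by exact_mod_cast hk.ne'
  simp [ntr, this]

theorem trace_mul_conjTranspose_self (A : Matrix (Fin k) (Fin k) ℂ) :
    (A * Aᴴ).trace = ((∑ p : Fin k × Fin k, ‖A p.1 p.2‖ ^ 2 : ℝ) : ℂ) := by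
  rw [Fintype.sum_prod_type]
  push_cast
  simp [Matrix.trace, Matrix.mul_apply, Complex.mul_conj, Complex.normSq_eq_norm_sq]

/-- The Cauchy–Schwarz inequality for the normalized trace. -/
theorem norm_ntr_mul_sq_le (A B : Matrix (Fin k) (Fin k) ℂ) :
    ‖ntr (A * B)‖ ^ 2 ≤ ‖ntr (A * Aᴴ)‖ * ‖ntr (Bᴴ * B)‖ := by
  have h1 : ‖(A * Aᴴ).trace‖ = ∑ p : Fin k × Fin k, ‖A p.1 p.2‖ ^ 2 := by
    rw [trace_mul_conjTranspose_self, Complex.norm_real, Real.norm_of_nonneg (by positivity)]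
  have h2 : ‖(Bᴴ * B).trace‖ = ∑ p : Fin k × Fin k, ‖B p.2 p.1‖ ^ 2 := by
    have := trace_mul_conjTranspose_self Bᴴ
    rw [conjTranspose_conjTranspose] at this
    rw [this, Complex.norm_real, Real.norm_of_nonneg (by positivity)]
    simp
  have h3 : ‖(A * B).trace‖ ≤ ∑ p : Fin k × Fin k, ‖A p.1 p.2‖ * ‖B p.2 p.1‖ := by
    have : (A * B).trace = ∑ p : Fin k × Fin k, A p.1 p.2 * B p.2 p.1 := by
      rw [Fintype.sum_prod_type]; simp [Matrix.trace, Matrix.mul_apply]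
    rw [this]
    exact (norm_sum_le _ _).trans (by simp)
  have h4 := Finset.sum_mul_sq_le_sq_mul_sq Finset.univ (fun p : Fin k × Fin k => ‖A p.1 p.2‖)
    (fun p => ‖B p.2 p.1‖)
  simp only [ntr, norm_mul]
  rw [h1, h2]
  have h5 : ‖(A * B).trace‖ ^ 2 ≤
      (∑ p : Fin k × Fin k, ‖A p.1 p.2‖ ^ 2) * ∑ p : Fin k × Fin k, ‖B p.2 p.1‖ ^ 2 :=
    (pow_le_pow_left₀ (norm_nonneg _) h3 2).trans h4
  calc (‖(k : ℂ)⁻¹‖ * ‖(A * B).trace‖) ^ 2 = ‖(k : ℂ)⁻¹‖ ^ 2 * ‖(A * B).trace‖ ^ 2 := by ring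
    _ ≤ ‖(k : ℂ)⁻¹‖ ^ 2 * _ := mul_le_mul_of_nonneg_left h5 (by positivity)
    _ = _ := by ring

theorem conjTranspose_prod_map {ι : Type*} {Z : ι → Matrix (Fin k) (Fin k) ℂ}
    (hZ : ∀ i, (Z i).IsHermitian) (w : List ι) :
    ((w.map Z).prod)ᴴ = ((w.reverse).map Z).prod := by
  rw [Matrix.conjTranspose_list_prod, List.map_reverse, List.map_map]
  congr 2
  apply List.map_congr_left
  intro i _
  exact hZ i

/-- A chessboard form of the Hölder inequality: the trace of a word of length `2 ^ s` in
selfadjoint letters is bounded by the traces of the `2 ^ s`-th powers of the letters. -/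
theorem norm_ntr_prod_map_le_of_length_eq {ι : Type*} [Finite ι]
    {Z : ι → Matrix (Fin k) (Fin k) ℂ} (hZ : ∀ i, (Z i).IsHermitian) {s : ℕ} {B : ℝ}
    (hB : ∀ i, ‖ntr (Z i ^ 2 ^ s)‖ ≤ B) (w : List ι) (hw : w.length = 2 ^ s) :
    ‖ntr (w.map Z).prod‖ ≤ B := by
  have hfin : {w : List ι | w.length = 2 ^ s}.Finite := List.finite_length_eq ι (2 ^ s)
  -- Take a word of maximal modulus of trace. Cauchy–Schwarz turns a maximal word beginning with 2^j
  -- equal letters into one beginning with 2^(j+1) equal letters, until only the power of one letter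
  -- remains.
  obtain ⟨w₀, hw₀, hmax⟩ := Set.exists_max_image _ (fun w : List ι => ‖ntr (w.map Z).prod‖)
    hfin ⟨w, hw⟩
  refine (hmax w hw).trans ?_
  set N := ‖ntr (w₀.map Z).prod‖ with hN
  have hmax' : ∀ u v : List ι, (u ++ v).length = 2 ^ s →
      ‖ntr ((u.map Z).prod * (v.map Z).prod)‖ ≤ N := by
    intro u v huv
    have := hmax (u ++ v) huv
    simpa using this
  have key : ∀ j ≤ s, ∃ (x : ι) (v : List ι), (List.replicate (2 ^ j) x ++ v).length = 2 ^ s ∧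
      N ≤ ‖ntr ((List.replicate (2 ^ j) x ++ v).map Z).prod‖ := by
    intro j
    induction j with
    | zero =>
      intro _
      cases hc : w₀ with
      | nil => rw [hc] at hw₀; simp at hw₀; exact absurd hw₀.symm (by positivity)
      | cons x v =>
        refine ⟨x, v, ?_, ?_⟩
        · rw [← hw₀, hc]; simp
        · rw [hN, hc]; simp
    | succ j ih =>
      intro hj
      obtain ⟨x, v, hl, hle⟩ := ih (by omega)
      obtain ⟨t, rfl⟩ : ∃ t, s = t + 1 := ⟨s - 1, by omega⟩
      have hjt : 2 ^ j ≤ 2 ^ t := Nat.pow_le_pow_right (by norm_num) (by omega)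
      set v₁ := v.take (2 ^ t) with hv₁
      set v₂ := v.drop (2 ^ t) with hv₂
      have hv : v = v₁ ++ v₂ := (List.take_append_drop _ _).symm
      simp only [List.length_append, List.length_replicate] at hl
      rw [pow_succ] at hl
      have hl₁ : v₁.length = 2 ^ t := by rw [hv₁, List.length_take]; omega
      have hl₂ : v₂.length = 2 ^ t - 2 ^ j := by rw [hv₂, List.length_drop]; omega
      -- The cyclic word is cut into halves P and Q of length 2^t. In PP* two blocks of x meet and
      -- merge, and Q*Q is a word of length 2^s, so its trace is at most N; Cauchy–Schwarz then
      -- forces the trace of PP* to be at least N.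
      set P := (v₂.map Z).prod * Z x ^ 2 ^ j with hP
      set Q := (v₁.map Z).prod with hQ
      have e1 : ntr ((List.replicate (2 ^ j) x ++ v).map Z).prod = ntr (P * Q) := by
        rw [hv, hP, mul_assoc, ntr_mul_comm ((v₂.map Z).prod)]
        simp [hQ, mul_assoc]
      have hPP : P * Pᴴ = (v₂.map Z).prod * Z x ^ 2 ^ (j + 1) * (v₂.reverse.map Z).prod := by
        rw [hP, conjTranspose_mul, conjTranspose_prod_map hZ, conjTranspose_pow, (hZ x).eq,
          pow_succ 2 j, mul_two, pow_add]
        simp [mul_assoc]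
      refine ⟨x, v₂.reverse ++ v₂, ?_, ?_⟩
      · simp only [List.length_append, List.length_replicate, List.length_reverse, hl₂, pow_succ]
        omega
      have e2 : ntr ((List.replicate (2 ^ (j + 1)) x ++ (v₂.reverse ++ v₂)).map Z).prod =
          ntr (P * Pᴴ) := by
        rw [hPP, mul_assoc, ntr_mul_comm ((v₂.map Z).prod)]
        simp [mul_assoc]
      have hQQ : ‖ntr (Qᴴ * Q)‖ ≤ N := by
        rw [hQ, conjTranspose_prod_map hZ]
        apply hmax'
        simp [hl₁, pow_succ]; omega
      rw [e2]
      rw [e1] at hle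
      have hcs := norm_ntr_mul_sq_le P Q
      have hN0 : 0 ≤ N := norm_nonneg _
      by_contra hcon
      push Not at hcon
      have hNpos : 0 < N := lt_of_le_of_lt (norm_nonneg _) hcon
      have : N ^ 2 ≤ ‖ntr (P * Pᴴ)‖ * N := by
        calc N ^ 2 ≤ ‖ntr (P * Q)‖ ^ 2 := pow_le_pow_left₀ hN0 hle 2
          _ ≤ _ := hcs
          _ ≤ _ := mul_le_mul_of_nonneg_left hQQ (norm_nonneg _)
      nlinarith
  obtain ⟨x, v, hl, hle⟩ := key s le_rfl
  have hv : v = [] := by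
    simp only [List.length_append, List.length_replicate] at hl
    exact List.length_eq_zero_iff.mp (by omega)
  refine hle.trans ?_
  rw [hv]
  simpa using hB x

/-- Words of length at most `2 ^ s`. -/
theorem norm_ntr_prod_map_le {ι : Type*} [Finite ι] (hk : 0 < k)
    {Z : ι → Matrix (Fin k) (Fin k) ℂ} (hZ : ∀ i, (Z i).IsHermitian) {s : ℕ} {B : ℝ}
    (hB1 : 1 ≤ B) (hB : ∀ i, ‖ntr (Z i ^ 2 ^ s)‖ ≤ B) (w : List ι) (hw : w.length ≤ 2 ^ s) :
    ‖ntr (w.map Z).prod‖ ≤ B := by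
  -- Short words are padded with the identity as an extra letter; this is where 1 ≤ B enters.
  let Z' : Option ι → Matrix (Fin k) (Fin k) ℂ := fun o => o.elim 1 Z
  have := norm_ntr_prod_map_le_of_length_eq (Z := Z') (s := s) (B := B)
    (by rintro (_ | i); exacts [Matrix.isHermitian_one, hZ i])
    (by rintro (_ | i); exacts [by simpa [Z', ntr_one hk] using hB1, hB i])
    (w.map some ++ List.replicate (2 ^ s - w.length) none) (by simp; omega)
  simpa [Z', Function.comp_def] using this

/-- Replacing the letters of a word by nearby ones changes its trace little. -/
theorem norm_ntr_prod_map_sub_le {ι : Type*} [Finite ι] (hk : 0 < k)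
    {X Y : ι → Matrix (Fin k) (Fin k) ℂ} (hX : ∀ i, (X i).IsHermitian)
    (hY : ∀ i, (Y i).IsHermitian) {s : ℕ} {B ε : ℝ} (hB1 : 1 ≤ B) (hε : 0 ≤ ε)
    (hBX : ∀ i, ‖ntr (X i ^ 2 ^ s)‖ ≤ B) (hBY : ∀ i, ‖ntr (Y i ^ 2 ^ s)‖ ≤ B)
    (hXY : ∀ i, ‖ntr ((X i - Y i) * (X i - Y i))‖ ≤ ε ^ 2) (w : List ι)
    (hw : 2 * w.length ≤ 2 ^ s) :
    ‖ntr (w.map X).prod - ntr (w.map Y).prod‖ ≤ w.length * (ε * B) := by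
  -- Telescoping from the left: u holds the letters already replaced by those of Y.
  have key : ∀ (w u : List ι), 2 * (u.length + w.length) ≤ 2 ^ s →
      ‖ntr ((u.map Y).prod * (w.map X).prod) - ntr ((u.map Y).prod * (w.map Y).prod)‖ ≤
        w.length * (ε * B) := by
    intro w
    induction w with
    | nil => intro u _; simp
    | cons x v ih =>
      intro u hl
      have h1 := ih (u ++ [x]) (by simp at hl ⊢; omega)
      have hxy := hXY x
      set D := X x - Y x with hD
      have hDH : Dᴴ = D := by rw [hD, conjTranspose_sub, (hX x).eq, (hY x).eq]
      set W := (v.map X).prod * (u.map Y).prod with hW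
      -- W*W is a word in the union of both alphabets, twice as long as W; hence the factor 2 in the
      -- length condition.
      have hWW : ‖ntr (Wᴴ * W)‖ ≤ B := by
        have := norm_ntr_prod_map_le (Z := Sum.elim X Y) hk
          (by rintro (i | i); exacts [hX i, hY i]) hB1
          (by rintro (i | i); exacts [hBX i, hBY i])
          ((u.reverse.map Sum.inr ++ v.reverse.map Sum.inl) ++
            (v.map Sum.inl ++ u.map Sum.inr)) (s := s) (by simp at hl ⊢; omega)
        rw [hW, conjTranspose_mul, conjTranspose_prod_map hX, conjTranspose_prod_map hY]
        simpa [Function.comp_def, mul_assoc] using this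
      have h2 : ‖ntr (D * W)‖ ≤ ε * B := by
        have hcs := norm_ntr_mul_sq_le D W
        rw [hDH] at hcs
        apply abs_le_of_sq_le_sq' _ (by positivity) |>.2
        calc ‖ntr (D * W)‖ ^ 2 ≤ _ := hcs
          _ ≤ ε ^ 2 * B := mul_le_mul hxy hWW (norm_nonneg _) (by positivity)
          _ ≤ (ε * B) ^ 2 := by rw [mul_pow]; gcongr; nlinarith
      have h3 : ntr ((u.map Y).prod * ((x :: v).map X).prod) =
          ntr (D * W) + ntr (((u ++ [x]).map Y).prod * (v.map X).prod) := by
        have : (u.map Y).prod * ((x :: v).map X).prod =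
            (u.map Y).prod * (D * (v.map X).prod) +
              ((u ++ [x]).map Y).prod * (v.map X).prod := by
          simp only [List.map_cons, List.prod_cons, List.map_append, List.prod_append, hD,
            List.map_nil, List.prod_nil]
          noncomm_ring
        rw [this, ntr_add, ntr_mul_comm, hW, mul_assoc]
      have h4 : (u.map Y).prod * ((x :: v).map Y).prod =
          ((u ++ [x]).map Y).prod * (v.map Y).prod := by
        simp [mul_assoc]
      rw [h3, h4, add_sub_assoc]
      refine (norm_add_le _ _).trans ?_
      simp only [List.length_cons, Nat.cast_add, Nat.cast_one]
      linarith
  simpa using key w [] (by simpa using hw)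

theorem monomial_eq_prod_map {R ι : Type*} [Monoid R] (x : ι → R) {p : ℕ} (w : Fin p → ι) :
    monomial x w = ((List.ofFn w).map x).prod := by
  simp [monomial, List.map_ofFn, Function.comp_def]

end Trace

end FreeEntropy

/-! ### Unitary conjugation in coordinates and its invariance of Lebesgue measure. -/

namespace FreeEntropy

open Matrix MeasureTheory

/-- An injective linear map preserving a nonempty bounded open set preserves Haar measure. -/
theorem measurePreserving_of_preimage_eq {E : Type*} [NormedAddCommGroup E] [NormedSpace ℝ E]
    [FiniteDimensional ℝ E] [MeasurableSpace E] [BorelSpace E] (μ : Measure E)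
    [μ.IsAddHaarMeasure] (L : E →ₗ[ℝ] E) (hL : Function.Injective L) {B : Set E}
    (hBo : IsOpen B) (hne : B.Nonempty) (hb : Bornology.IsBounded B) (hLB : L ⁻¹' B = B) :
    MeasurePreserving L μ μ := by
  have hdet : LinearMap.det L ≠ 0 := by
    have := (LinearEquiv.ofInjectiveEndo L hL).isUnit_det'
    exact this.ne_zero
  have h := Measure.addHaar_preimage_linearMap μ hdet B
  rw [hLB] at h
  have h0 : μ B ≠ 0 := (hBo.measure_pos μ hne).ne'
  have ht : μ B ≠ ⊤ := hb.measure_lt_top.ne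
  -- Comparing B with its preimage forces |det L| = 1, because the volume of B is neither 0 nor
  -- infinite.
  have h1 : ENNReal.ofReal |(LinearMap.det L)⁻¹| = 1 := by
    rw [mul_comm] at h
    exact (ENNReal.mul_right_inj h0 ht).1 (by rw [mul_one]; exact h.symm)
  refine ⟨L.continuous_of_finiteDimensional.measurable, ?_⟩
  rw [Measure.map_linearMap_addHaar_eq_smul_addHaar μ hdet, h1, one_smul]

section Coordinates

variable {k : ℕ}

/-- `hermOfCoord` as a linear map. -/
noncomputable def hermLin (k : ℕ) : (Fin k → Fin k → ℝ) →ₗ[ℝ] Matrix (Fin k) (Fin k) ℂ where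
  toFun := hermOfCoord
  map_add' := hermOfCoord_add
  map_smul' := hermOfCoord_smul

theorem sum_sq_eq_zero_iff {c : Fin k → Fin k → ℝ} : ∑ i, ∑ j, c i j ^ 2 = 0 ↔ c = 0 := by
  constructor
  · intro h
    ext i j
    have h1 := (Finset.sum_eq_zero_iff_of_nonneg (fun i _ =>
      Finset.sum_nonneg (fun j _ => sq_nonneg (c i j)))).1 h i (Finset.mem_univ _)
    have h2 := (Finset.sum_eq_zero_iff_of_nonneg (fun j _ => sq_nonneg (c i j))).1 h1 j
      (Finset.mem_univ _)
    simpa using h2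
  · rintro rfl; simp

theorem hermOfCoord_injective : Function.Injective (hermOfCoord (k := k)) := by
  intro c d h
  have h0 : hermOfCoord (c - d) = 0 := by
    have : hermLin k (c - d) = hermLin k c - hermLin k d := map_sub _ _ _
    rw [show hermLin k (c - d) = hermOfCoord (c - d) from rfl] at this
    rw [this]
    exact sub_eq_zero.2 h
  have h1 := ntr_hermOfCoord_sq (c - d)
  rw [h0] at h1
  simp only [ntr, mul_zero, trace_zero] at h1
  have h2 : ∑ i, ∑ j, (c - d) i j ^ 2 = 0 := by exact_mod_cast h1.symm
  exact sub_eq_zero.1 (sum_sq_eq_zero_iff.1 h2)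

theorem continuous_hermOfCoord : Continuous (hermOfCoord (k := k)) :=
  (hermLin k).continuous_of_finiteDimensional

theorem isHermitian_conj {A U : Matrix (Fin k) (Fin k) ℂ} (hA : A.IsHermitian) :
    (U * A * Uᴴ).IsHermitian := by
  simpa [mul_assoc] using isHermitian_mul_mul_conjTranspose U hA

/-- Conjugation by a matrix, in coordinates. -/
theorem exists_conjCoord (U : Matrix (Fin k) (Fin k) ℂ) :
    ∃ L : (Fin k → Fin k → ℝ) →ₗ[ℝ] (Fin k → Fin k → ℝ),
      ∀ c, hermOfCoord (L c) = U * hermOfCoord c * Uᴴ := by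
  choose g hg using fun c : Fin k → Fin k → ℝ =>
    exists_hermOfCoord_eq (isHermitian_conj (U := U) (hermOfCoord_isHermitian c))
  refine ⟨⟨⟨g, fun c d => hermOfCoord_injective ?_⟩, fun r c => hermOfCoord_injective ?_⟩, hg⟩
  · rw [hermOfCoord_add, hg, hg, hg, hermOfCoord_add]; noncomm_ring
  · simp only [RingHom.id_apply]
    rw [hermOfCoord_smul, hg, hg, hermOfCoord_smul]
    simp

theorem isOpen_sum_sq_lt_one : IsOpen {c : Fin k → Fin k → ℝ | ∑ i, ∑ j, c i j ^ 2 < 1} :=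
  isOpen_lt (by fun_prop) continuous_const

theorem isBounded_sum_sq_lt (R : ℝ) :
    Bornology.IsBounded {c : Fin k → Fin k → ℝ | ∑ i, ∑ j, c i j ^ 2 < R} := by
  rw [Metric.isBounded_iff_subset_closedBall 0]
  refine ⟨R + 1, fun c hc => ?_⟩
  have hR : 0 ≤ R := by
    refine le_trans ?_ (le_of_lt hc)
    exact Finset.sum_nonneg fun i _ => Finset.sum_nonneg fun j _ => sq_nonneg _
  rw [mem_closedBall_zero_iff, pi_norm_le_iff_of_nonneg (by positivity)]
  intro i
  rw [pi_norm_le_iff_of_nonneg (by positivity)]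
  intro j
  have h1 : c i j ^ 2 ≤ ∑ j, c i j ^ 2 :=
    Finset.single_le_sum (f := fun j => c i j ^ 2) (fun j _ => sq_nonneg _) (Finset.mem_univ j)
  have h2 : ∑ j, c i j ^ 2 ≤ ∑ i, ∑ j, c i j ^ 2 :=
    Finset.single_le_sum (f := fun i => ∑ j, c i j ^ 2)
      (fun i _ => Finset.sum_nonneg fun j _ => sq_nonneg _) (Finset.mem_univ i)
  have h3 : c i j ^ 2 < R := (h1.trans h2).trans_lt hc
  rw [Real.norm_eq_abs, abs_le]
  constructor <;> nlinarith

/-- Conjugation preserves tr(A²), which is the sum of squares of the coordinates, hence it preserves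
the open Euclidean unit ball. -/
theorem measurePreserving_conjCoord {U : Matrix (Fin k) (Fin k) ℂ} (hU : U * Uᴴ = 1)
    {L : (Fin k → Fin k → ℝ) →ₗ[ℝ] (Fin k → Fin k → ℝ)}
    (hL : ∀ c, hermOfCoord (L c) = U * hermOfCoord c * Uᴴ) : MeasurePreserving L := by
  have hU' : Uᴴ * U = 1 := mul_eq_one_comm.1 hU
  have hsum : ∀ c, ∑ i, ∑ j, (L c) i j ^ 2 = ∑ i, ∑ j, c i j ^ 2 := by
    intro c
    have h1 := ntr_hermOfCoord_sq (L c)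
    rw [hL, show U * hermOfCoord c * Uᴴ * (U * hermOfCoord c * Uᴴ) =
      U * hermOfCoord c * (Uᴴ * U) * hermOfCoord c * Uᴴ by simp only [mul_assoc], hU', mul_one,
      mul_assoc, mul_assoc, ntr_mul_comm, mul_assoc, mul_assoc, hU', mul_one,
      ntr_hermOfCoord_sq] at h1
    exact_mod_cast h1.symm
  refine measurePreserving_of_preimage_eq volume L ?_
    (B := {c : Fin k → Fin k → ℝ | ∑ i, ∑ j, c i j ^ 2 < 1}) isOpen_sum_sq_lt_one
    ⟨0, by simp⟩ (isBounded_sum_sq_lt 1) ?_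
  · rw [← LinearMap.ker_eq_bot, LinearMap.ker_eq_bot']
    intro c hc
    have := hsum c
    rw [hc] at this
    exact sum_sq_eq_zero_iff.1 (by simpa using this.symm)
  · ext c
    simp only [Set.mem_preimage, Set.mem_ofPred_eq, hsum]

end Coordinates

/-! ### Diagonalization with ordered eigenvalues, and conjugation of words. -/

section Diagonal

variable {k : ℕ}

/-- The diagonal matrix with the given real entries. -/
noncomputable def diagMat (l : Fin k → ℝ) : Matrix (Fin k) (Fin k) ℂ :=
  diagonal fun i => (l i : ℂ)

theorem diagMat_isHermitian (l : Fin k → ℝ) : (diagMat l).IsHermitian := by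
  simp [diagMat, Matrix.IsHermitian, diagonal_conjTranspose, Pi.star_def]

theorem diagMat_pow (l : Fin k → ℝ) (p : ℕ) : diagMat l ^ p = diagMat fun i => l i ^ p := by
  simp [diagMat, diagonal_pow, Pi.pow_def]

theorem ntr_diagMat (l : Fin k → ℝ) : ntr (diagMat l) = (((k : ℝ)⁻¹ * ∑ i, l i : ℝ) : ℂ) := by
  simp [ntr, diagMat, trace_diagonal]

/-- Reordering the diagonal entries is a unitary conjugation. -/
theorem exists_unitary_diagMat_comp (l : Fin k → ℝ) (σ : Equiv.Perm (Fin k)) :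
    ∃ U : Matrix (Fin k) (Fin k) ℂ, U * Uᴴ = 1 ∧ U * diagMat (l ∘ σ) * Uᴴ = diagMat l := by
  refine ⟨(1 : Matrix (Fin k) (Fin k) ℂ).submatrix id σ, ?_, ?_⟩
  · rw [conjTranspose_submatrix, conjTranspose_one, submatrix_mul_equiv]; simp
  · have : diagMat (l ∘ σ) = (diagMat l).submatrix σ σ := by
      ext i j; simp [diagMat, diagonal_apply, σ.injective.eq_iff]
    rw [this, conjTranspose_submatrix, conjTranspose_one, submatrix_mul_equiv,
      submatrix_mul_equiv]
    simp

theorem exists_unitary_diagMat {A : Matrix (Fin k) (Fin k) ℂ} (hA : A.IsHermitian) :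
    ∃ U : Matrix (Fin k) (Fin k) ℂ, U * Uᴴ = 1 ∧ A = U * diagMat hA.eigenvalues * Uᴴ := by
  refine ⟨hA.eigenvectorUnitary, mem_unitaryGroup_iff.1 hA.eigenvectorUnitary.2, ?_⟩
  conv_lhs => rw [hA.spectral_theorem]
  rfl

theorem mul_conjTranspose_mul_eq_one {U V : Matrix (Fin k) (Fin k) ℂ} (hU : U * Uᴴ = 1)
    (hV : V * Vᴴ = 1) : (U * V) * (U * V)ᴴ = 1 := by
  rw [conjTranspose_mul, mul_assoc, ← mul_assoc V, hV, one_mul, hU]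

/-- The spectral theorem with increasing eigenvalues. -/
theorem exists_unitary_monotone {A : Matrix (Fin k) (Fin k) ℂ} (hA : A.IsHermitian) :
    ∃ (U : Matrix (Fin k) (Fin k) ℂ) (l : Fin k → ℝ), U * Uᴴ = 1 ∧ Monotone l ∧
      A = U * diagMat l * Uᴴ := by
  obtain ⟨U, hU, hUA⟩ := exists_unitary_diagMat hA
  obtain ⟨V, hV, hVA⟩ := exists_unitary_diagMat_comp hA.eigenvalues (Tuple.sort hA.eigenvalues)
  refine ⟨U * V, hA.eigenvalues ∘ Tuple.sort hA.eigenvalues, mul_conjTranspose_mul_eq_one hU hV,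
    Tuple.monotone_sort _, ?_⟩
  rw [conjTranspose_mul]
  conv_lhs => rw [hUA, ← hVA]
  simp only [mul_assoc]

/-- A selfadjoint matrix is unitarily conjugate to the diagonal of the roots of its
characteristic polynomial. -/
theorem exists_unitary_of_charpoly_eq {A : Matrix (Fin k) (Fin k) ℂ} (hA : A.IsHermitian)
    {l : Fin k → ℝ} (hl : A.charpoly = ∏ i, (Polynomial.X - Polynomial.C (l i : ℂ))) :
    ∃ U : Matrix (Fin k) (Fin k) ℂ, U * Uᴴ = 1 ∧ A = U * diagMat l * Uᴴ := by
  obtain ⟨U, hU, hUA⟩ := exists_unitary_diagMat hA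
  have hB := diagMat_isHermitian l
  have hcp : A.charpoly = (diagMat l).charpoly := by
    rw [hl, diagMat, charpoly_diagonal]
  have heq := (IsHermitian.eigenvalues_eq_eigenvalues_iff hA hB).2 hcp
  obtain ⟨V, hV, hVB⟩ := exists_unitary_diagMat hB
  rw [← heq] at hVB
  have hV' : Vᴴ * V = 1 := mul_eq_one_comm.1 hV
  refine ⟨U * Vᴴ, mul_conjTranspose_mul_eq_one hU (by simpa using hV'), ?_⟩
  conv_lhs => rw [hUA]
  rw [hVB]
  simp only [conjTranspose_mul, conjTranspose_conjTranspose, mul_assoc]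
  rw [← mul_assoc Vᴴ V, hV', one_mul, ← mul_assoc Vᴴ V, hV', one_mul]

theorem conj_pow {U A : Matrix (Fin k) (Fin k) ℂ} (hU : U * Uᴴ = 1) (p : ℕ) :
    (U * A * Uᴴ) ^ p = U * A ^ p * Uᴴ := by
  have hU' : Uᴴ * U = 1 := mul_eq_one_comm.1 hU
  induction p with
  | zero => simp [hU]
  | succ p ih =>
    rw [pow_succ, ih, pow_succ]
    calc U * A ^ p * Uᴴ * (U * A * Uᴴ) = U * A ^ p * (Uᴴ * U) * A * Uᴴ := by
          simp only [mul_assoc]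
      _ = _ := by rw [hU']; simp only [mul_assoc, mul_one]

theorem ntr_conj {U : Matrix (Fin k) (Fin k) ℂ} (hU : U * Uᴴ = 1)
    (A : Matrix (Fin k) (Fin k) ℂ) : ntr (U * A * Uᴴ) = ntr A := by
  have hU' : Uᴴ * U = 1 := mul_eq_one_comm.1 hU
  rw [mul_assoc, ntr_mul_comm, mul_assoc, hU', mul_one]

theorem prod_map_conj {ι : Type*} {U : Matrix (Fin k) (Fin k) ℂ} (hU : U * Uᴴ = 1)
    (A : ι → Matrix (Fin k) (Fin k) ℂ) (w : List ι) :
    (w.map fun i => U * A i * Uᴴ).prod = U * (w.map A).prod * Uᴴ := by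
  have hU' : Uᴴ * U = 1 := mul_eq_one_comm.1 hU
  induction w with
  | nil => simp [hU]
  | cons x v ih =>
    simp only [List.map_cons, List.prod_cons, ih]
    calc U * A x * Uᴴ * (U * (v.map A).prod * Uᴴ) = U * A x * (Uᴴ * U) * (v.map A).prod * Uᴴ := by
          simp only [mul_assoc]
      _ = _ := by rw [hU']; simp only [mul_assoc, mul_one]

end Diagonal

/-! ### Unitary invariance, monotonicity and openness of microstate spaces. -/

section Microstates

variable {M ι : Type*} [CStarAlgebra M] {φ : M →ₗ[ℂ] ℂ} {x : ι → M} {m k : ℕ} {γ : ℝ}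

theorem conj_mem_microstates {A : ι → Matrix (Fin k) (Fin k) ℂ} (hA : A ∈ microstates φ x m k γ)
    {U : Matrix (Fin k) (Fin k) ℂ} (hU : U * Uᴴ = 1) :
    (fun i => U * A i * Uᴴ) ∈ microstates φ x m k γ := by
  refine ⟨fun i => isHermitian_conj (hA.1 i), fun p hp1 hp w => ?_⟩
  rw [monomial_eq_prod_map, prod_map_conj hU, ntr_conj hU, ← monomial_eq_prod_map]
  exact hA.2 p hp1 hp w

theorem conj_mem_microstates_iff {A : ι → Matrix (Fin k) (Fin k) ℂ}
    {U : Matrix (Fin k) (Fin k) ℂ} (hU : U * Uᴴ = 1) :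
    (fun i => U * A i * Uᴴ) ∈ microstates φ x m k γ ↔ A ∈ microstates φ x m k γ := by
  refine ⟨fun h => ?_, fun h => conj_mem_microstates h hU⟩
  have hU' : Uᴴ * U = 1 := mul_eq_one_comm.1 hU
  have := conj_mem_microstates h (U := Uᴴ) (by simpa using hU')
  convert this using 2 with i
  simp only [conjTranspose_conjTranspose]
  calc A i = (Uᴴ * U) * A i * (Uᴴ * U) := by rw [hU', mul_one, one_mul]
    _ = _ := by simp only [mul_assoc]

theorem microstates_mono {m' : ℕ} {γ' : ℝ} (hm : m' ≤ m) (hγ : γ ≤ γ') :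
    microstates φ x m k γ ⊆ microstates φ x m' k γ' := fun _ hA =>
  ⟨hA.1, fun p hp1 hp w => (hA.2 p hp1 (hp.trans hm) w).trans_le hγ⟩

/-- There are finitely many words of length at most m, each giving an open condition, and
selfadjointness is automatic in coordinates. Openness supplies the measurability needed for
Tonelli's theorem. -/
theorem isOpen_coord_microstates [Finite ι] :
    IsOpen {c : ι → Fin k → Fin k → ℝ | (fun i => hermOfCoord (c i)) ∈ microstates φ x m k γ} := by
  have : {c : ι → Fin k → Fin k → ℝ | (fun i => hermOfCoord (c i)) ∈ microstates φ x m k γ} =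
      ⋂ p : Fin (m + 1), ⋂ w : Fin p → ι, {c | 1 ≤ (p : ℕ) →
        ‖ntr (monomial (fun i => hermOfCoord (c i)) w) - φ (monomial x w)‖ < γ} := by
    ext c
    simp only [microstates, Set.mem_ofPred_eq, Set.mem_iInter]
    constructor
    · rintro ⟨-, h⟩ p w hp
      exact h p hp (by omega) w
    · intro h
      exact ⟨fun i => hermOfCoord_isHermitian _, fun p hp1 hp w => h ⟨p, by omega⟩ w hp1⟩
  rw [this]
  refine isOpen_iInter_of_finite fun p => isOpen_iInter_of_finite fun w => ?_
  by_cases hp : 1 ≤ (p : ℕ)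
  · simp only [hp, forall_true_left]
    refine isOpen_lt ?_ continuous_const
    refine (Continuous.sub ?_ continuous_const).norm
    unfold ntr
    refine continuous_const.mul (Continuous.matrix_trace ?_)
    have : ∀ l : List ι, Continuous fun c : ι → Fin k → Fin k → ℝ =>
        (l.map fun i => hermOfCoord (c i)).prod := by
      intro l
      induction l with
      | nil => simpa using continuous_const
      | cons i l ih =>
        simp only [List.map_cons, List.prod_cons]
        exact (continuous_hermOfCoord.comp (continuous_apply i)).mul ih
    simpa only [monomial_eq_prod_map] using this (List.ofFn w)
  · simp [hp]

end Microstates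

end FreeEntropy

namespace FreeEntropy

/-! ### Ordered real families with nearby moments are close in mean square. -/

section Moments

variable {k : ℕ}

/-- The `p`-th moment of the empirical distribution of a finite family of reals. -/
noncomputable def empMoment (l : Fin k → ℝ) (p : ℕ) : ℝ := (k : ℝ)⁻¹ * ∑ i, l i ^ p

/-- The moments of order `1, …, m` of `l` are `γ`-close to the numbers `M p`. -/
def MomentsNear (M : ℕ → ℝ) (m : ℕ) (γ : ℝ) (l : Fin k → ℝ) : Prop :=
  ∀ p, 1 ≤ p → p ≤ m → |empMoment l p - M p| < γ

theorem MomentsNear.mono {M : ℕ → ℝ} {m m' : ℕ} {γ γ' : ℝ} {l : Fin k → ℝ}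
    (h : MomentsNear M m γ l) (hm : m' ≤ m) (hγ : γ ≤ γ') : MomentsNear M m' γ' l :=
  fun p h1 hp => (h p h1 (hp.trans hm)).trans_le hγ

theorem avg_le_avg {f g : Fin k → ℝ} (h : ∀ i, f i ≤ g i) :
    (k : ℝ)⁻¹ * ∑ i, f i ≤ (k : ℝ)⁻¹ * ∑ i, g i :=
  mul_le_mul_of_nonneg_left (Finset.sum_le_sum fun i _ => h i) (by positivity)

theorem avg_const (hk : 0 < k) (c : ℝ) : (k : ℝ)⁻¹ * ∑ _i : Fin k, c = c := by
  have : (k : ℝ) ≠ 0 := by exact_mod_cast hk.ne'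
  simp [this]

theorem avg_add (f g : Fin k → ℝ) : (k : ℝ)⁻¹ * ∑ i, (f i + g i) =
    (k : ℝ)⁻¹ * ∑ i, f i + (k : ℝ)⁻¹ * ∑ i, g i := by
  rw [Finset.sum_add_distrib, mul_add]

theorem avg_const_mul (c : ℝ) (f : Fin k → ℝ) :
    (k : ℝ)⁻¹ * ∑ i, (c * f i) = c * ((k : ℝ)⁻¹ * ∑ i, f i) := by
  rw [← Finset.mul_sum]; ring

theorem abs_eval_le_of_one_le (P : Polynomial ℝ) {x : ℝ} (hx : 1 ≤ |x|) :
    |P.eval x| ≤ (∑ j ∈ Finset.range (P.natDegree + 1), |P.coeff j|) * |x| ^ P.natDegree := by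
  rw [Polynomial.eval_eq_sum_range, Finset.sum_mul]
  refine (Finset.abs_sum_le_sum_abs _ _).trans (Finset.sum_le_sum fun j hj => ?_)
  rw [abs_mul, abs_pow]
  exact mul_le_mul_of_nonneg_left
    (pow_le_pow_right₀ hx (by simp at hj; omega)) (abs_nonneg _)

/-- Families with nearby moments have nearby averages of a bounded continuous function, uniformly
in the size of the families. -/
theorem exists_momentsNear_avg_sub_le {M : ℕ → ℝ} {ρ : ℝ} (hρ : 0 ≤ ρ)
    (hM : ∀ N, M (2 * N) ≤ ρ ^ (2 * N)) {ψ : ℝ → ℝ} (hψ : Continuous ψ) (hψ1 : ∀ x, |ψ x| ≤ 1)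
    {τ : ℝ} (hτ : 0 < τ) :
    ∃ (m : ℕ) (γ : ℝ), 0 < γ ∧ ∀ (k : ℕ), 0 < k → ∀ α β : Fin k → ℝ, MomentsNear M m γ α →
      MomentsNear M m γ β →
        (k : ℝ)⁻¹ * ∑ i, ψ (α i) - (k : ℝ)⁻¹ * ∑ i, ψ (β i) ≤ τ := by
  set R := ρ + 1 with hR
  have hR1 : 1 ≤ R := by linarith
  have hR0 : 0 < R := by linarith
  -- Weierstrass approximation on [-R, R]. Since R exceeds ρ, high even moments will control what
  -- happens outside.
  obtain ⟨P, hP⟩ := exists_polynomial_near_of_continuousOn (-R) R ψ hψ.continuousOn (τ / 8)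
    (by positivity)
  set d := P.natDegree with hd
  set S := ∑ j ∈ Finset.range (d + 1), |P.coeff j| with hS
  have hS0 : 0 ≤ S := Finset.sum_nonneg fun _ _ => abs_nonneg _
  have hRd : 1 ≤ R ^ d := one_le_pow₀ hR1
  -- This number plays two roles: tolerance for the moments, and bound for the tail factor
  -- (ρ/R)^(2N).
  set γ := τ / (8 * ((S + 1) * R ^ d)) with hγ
  have hγ0 : 0 < γ := by positivity
  have hq : (ρ / R) ^ 2 < 1 := by
    have : ρ / R < 1 := by rw [div_lt_one hR0]; linarith
    have h0 : 0 ≤ ρ / R := by positivity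
    nlinarith
  obtain ⟨N₀, hN₀⟩ := exists_pow_lt_of_lt_one hγ0 hq
  set N := N₀ + d with hN
  have hqN : (ρ / R) ^ (2 * N) ≤ γ := by
    rw [pow_mul, hN, pow_add]
    have h1 : ((ρ / R) ^ 2) ^ d ≤ 1 := pow_le_one₀ (by positivity) hq.le
    have h2 : 0 ≤ ((ρ / R) ^ 2) ^ N₀ := by positivity
    nlinarith
  -- Outside [-R, R] both P and ψ are dominated by a multiple of |x|^d, hence of x^(2N) because 2N ≥
  -- d; the summand d in N guarantees this.
  have hpt : ∀ x, |P.eval x - ψ x| ≤ τ / 8 + (S + 1) * R ^ d / R ^ (2 * N) * x ^ (2 * N) := by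
    intro x
    have hxn : 0 ≤ x ^ (2 * N) := by rw [pow_mul]; positivity
    by_cases hx : |x| ≤ R
    · have h1 := hP x (abs_le.1 hx)
      have : 0 ≤ (S + 1) * R ^ d / R ^ (2 * N) * x ^ (2 * N) := by positivity
      linarith
    · push Not at hx
      have hx1 : 1 ≤ |x| := hR1.trans hx.le
      have h1 := abs_eval_le_of_one_le P hx1
      have h2 : |P.eval x - ψ x| ≤ (S + 1) * |x| ^ d := by
        refine (abs_sub _ _).trans ?_
        have h3 := hψ1 x
        have h4 : 1 ≤ |x| ^ d := one_le_pow₀ hx1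
        rw [add_mul, one_mul]
        linarith
      have h3 : |x| ^ d ≤ R ^ d / R ^ (2 * N) * x ^ (2 * N) := by
        have h5 : x ^ (2 * N) = |x| ^ d * |x| ^ (2 * N - d) := by
          rw [← pow_add, show d + (2 * N - d) = 2 * N by omega, pow_mul, pow_mul, sq_abs]
        have h6 : R ^ (2 * N) = R ^ d * R ^ (2 * N - d) := by
          rw [← pow_add, show d + (2 * N - d) = 2 * N by omega]
        have h7 : R ^ (2 * N - d) ≤ |x| ^ (2 * N - d) := pow_le_pow_left₀ hR0.le hx.le _
        rw [h5, h6, div_mul_eq_mul_div, le_div_iff₀ (by positivity)]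
        have h8 : 0 ≤ |x| ^ d * R ^ d := by positivity
        nlinarith
      have h9 : (S + 1) * |x| ^ d ≤ (S + 1) * (R ^ d / R ^ (2 * N) * x ^ (2 * N)) :=
        mul_le_mul_of_nonneg_left h3 (by positivity)
      have h10 : (S + 1) * (R ^ d / R ^ (2 * N) * x ^ (2 * N)) =
        (S + 1) * R ^ d / R ^ (2 * N) * x ^ (2 * N) := by ring
      linarith
  have hSγ : (S + 1) * R ^ d * γ = τ / 8 := by
    rw [hγ]; field_simp
  have happrox : ∀ (k : ℕ), 0 < k → ∀ α : Fin k → ℝ, MomentsNear M (2 * N + 1) γ α →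
      |(k : ℝ)⁻¹ * ∑ i, P.eval (α i) - (k : ℝ)⁻¹ * ∑ i, ψ (α i)| ≤ 3 * (τ / 8) := by
    intro k hk α hα
    rw [← mul_sub, ← Finset.sum_sub_distrib, abs_mul, abs_of_nonneg (by positivity : (0:ℝ) ≤ (k:ℝ)⁻¹)]
    have h1 : (k : ℝ)⁻¹ * |∑ i, (P.eval (α i) - ψ (α i))| ≤
        (k : ℝ)⁻¹ * ∑ i, (τ / 8 + (S + 1) * R ^ d / R ^ (2 * N) * α i ^ (2 * N)) :=
      mul_le_mul_of_nonneg_left ((Finset.abs_sum_le_sum_abs _ _).trans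
        (Finset.sum_le_sum fun i _ => hpt _)) (by positivity)
    rw [avg_add, avg_const hk, avg_const_mul] at h1
    refine h1.trans ?_
    have h2 : empMoment α (2 * N) ≤ ρ ^ (2 * N) + γ := by
      rcases Nat.eq_zero_or_pos N with h0 | h0
      · simp only [empMoment, h0, mul_zero, pow_zero]
        rw [avg_const hk]; linarith
      · have := (abs_lt.1 (hα (2 * N) (by omega) (by omega))).2
        have := hM N
        linarith
    have h3 : (S + 1) * R ^ d / R ^ (2 * N) * empMoment α (2 * N) ≤
        (S + 1) * R ^ d / R ^ (2 * N) * (ρ ^ (2 * N) + γ) :=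
      mul_le_mul_of_nonneg_left h2 (by positivity)
    have h4 : (S + 1) * R ^ d / R ^ (2 * N) * (ρ ^ (2 * N) + γ) =
        (S + 1) * R ^ d * ((ρ / R) ^ (2 * N)) + (S + 1) * R ^ d * (γ / R ^ (2 * N)) := by
      rw [div_pow]; field_simp
    have h5 : γ / R ^ (2 * N) ≤ γ := div_le_self hγ0.le (one_le_pow₀ hR1)
    have h6 : (S + 1) * R ^ d * ((ρ / R) ^ (2 * N)) ≤ τ / 8 :=
      hSγ ▸ mul_le_mul_of_nonneg_left hqN (by positivity)
    have h7 : (S + 1) * R ^ d * (γ / R ^ (2 * N)) ≤ τ / 8 :=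
      hSγ ▸ mul_le_mul_of_nonneg_left h5 (by positivity)
    change τ / 8 + (S + 1) * R ^ d / R ^ (2 * N) * empMoment α (2 * N) ≤ _
    linarith
  refine ⟨2 * N + 1, γ, hγ0, fun k hk α β hα hβ => ?_⟩
  have hpoly : ∀ α : Fin k → ℝ, (k : ℝ)⁻¹ * ∑ i, P.eval (α i) =
      ∑ j ∈ Finset.range (d + 1), P.coeff j * empMoment α j := by
    intro α
    simp only [Polynomial.eval_eq_sum_range, empMoment]
    rw [Finset.sum_comm, Finset.mul_sum]
    refine Finset.sum_congr rfl fun j _ => ?_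
    rw [avg_const_mul]
  have hPP : (k : ℝ)⁻¹ * ∑ i, P.eval (α i) - (k : ℝ)⁻¹ * ∑ i, P.eval (β i) ≤ S * (2 * γ) := by
    rw [hpoly, hpoly, ← Finset.sum_sub_distrib, hS, Finset.sum_mul]
    refine Finset.sum_le_sum fun j hj => ?_
    rw [← mul_sub]
    refine (le_abs_self _).trans ?_
    rw [abs_mul]
    refine mul_le_mul_of_nonneg_left ?_ (abs_nonneg _)
    rcases Nat.eq_zero_or_pos j with h0 | h0
    · simp [h0, empMoment]; positivity
    · have hjm : j ≤ 2 * N + 1 := by simp at hj; omega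
      have h1 := abs_lt.1 (hα j h0 hjm)
      have h2 := abs_lt.1 (hβ j h0 hjm)
      rw [abs_le]; constructor <;> linarith
  have hSγ' : S * γ ≤ τ / 8 := by
    rw [← hSγ]
    refine mul_le_mul_of_nonneg_right ?_ hγ0.le
    nlinarith
  have h1 := abs_le.1 (happrox k hk α hα)
  have h2 := abs_le.1 (happrox k hk β hβ)
  linarith [h1.1, h2.2]

/-- For increasing families, the number of indices where a threshold interval separates the two
families is controlled by averages of a cutoff function. -/
theorem card_separated_le {α β : Fin k → ℝ} (hα : Monotone α) (hβ : Monotone β) {s t : ℝ}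
    {ψ : ℝ → ℝ} (h0 : ∀ x, 0 ≤ ψ x) (h1 : ∀ x, ψ x ≤ 1) (hs : ∀ x ≤ s, ψ x = 1)
    (ht : ∀ x, t ≤ x → ψ x = 0) {τ : ℝ} (hτ : 0 ≤ τ)
    (h : (k : ℝ)⁻¹ * ∑ i, ψ (α i) - (k : ℝ)⁻¹ * ∑ i, ψ (β i) ≤ τ) :
    (k : ℝ)⁻¹ * ∑ i, (if α i ≤ s ∧ t ≤ β i then (1 : ℝ) else 0) ≤ τ := by
  -- One separated index i₀ makes all terms ψ(α i) - ψ(β i) nonnegative: the first value is 1 for i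
  -- ≤ i₀, the second is 0 for i ≥ i₀. At separated indices the term equals 1.
  by_cases hne : ∃ i₀, α i₀ ≤ s ∧ t ≤ β i₀
  · obtain ⟨i₀, hi₁, hi₂⟩ := hne
    refine le_trans ?_ h
    rw [← mul_sub, ← Finset.sum_sub_distrib]
    refine avg_le_avg fun i => ?_
    split_ifs with hi
    · rw [hs _ hi.1, ht _ hi.2]; norm_num
    · rcases le_total i i₀ with hle | hle
      · rw [hs _ ((hα hle).trans hi₁)]; linarith [h1 (β i)]
      · rw [ht _ (hi₂.trans (hβ hle))]; linarith [h0 (α i)]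
  · push Not at hne
    rw [Finset.sum_eq_zero, mul_zero]
    · exact hτ
    · intro i _
      rw [if_neg]
      rintro ⟨h1, h2⟩
      exact absurd h2 (not_le.2 (hne i h1))

theorem exists_momentsNear_separated_le {M : ℕ → ℝ} {ρ : ℝ} (hρ : 0 ≤ ρ)
    (hM : ∀ N, M (2 * N) ≤ ρ ^ (2 * N)) {s t : ℝ} (hst : s < t) {τ : ℝ} (hτ : 0 < τ) :
    ∃ (m : ℕ) (γ : ℝ), 0 < γ ∧ ∀ (k : ℕ), 0 < k → ∀ α β : Fin k → ℝ, Monotone α → Monotone β →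
      MomentsNear M m γ α → MomentsNear M m γ β →
        (k : ℝ)⁻¹ * ∑ i, (if α i ≤ s ∧ t ≤ β i then (1 : ℝ) else 0) ≤ τ := by
  -- The piecewise linear cutoff, equal to 1 up to s and to 0 from t on.
  set ψ : ℝ → ℝ := fun x => max 0 (min 1 ((t - x) / (t - s))) with hψ
  have h0 : ∀ x, 0 ≤ ψ x := fun x => le_max_left _ _
  have h1 : ∀ x, ψ x ≤ 1 := fun x => max_le zero_le_one (min_le_left _ _)
  have hts : 0 < t - s := by linarith
  obtain ⟨m, γ, hγ, H⟩ := exists_momentsNear_avg_sub_le hρ hM (ψ := ψ) (by fun_prop)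
    (fun x => by rw [abs_of_nonneg (h0 x)]; exact h1 x) hτ
  refine ⟨m, γ, hγ, fun k hk α β hα hβ hα' hβ' =>
    card_separated_le hα hβ h0 h1 ?_ ?_ hτ.le (H k hk α β hα' hβ')⟩
  · intro x hx
    have : 1 ≤ (t - x) / (t - s) := by rw [le_div_iff₀ hts]; linarith
    simp [hψ, this]
  · intro x hx
    have : (t - x) / (t - s) ≤ 0 := div_nonpos_of_nonpos_of_nonneg (by linarith) hts.le
    simp [hψ]
    right; exact this

theorem exists_momentsNear_grid_le {M : ℕ → ℝ} {ρ : ℝ} (hρ : 0 ≤ ρ)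
    (hM : ∀ N, M (2 * N) ≤ ρ ^ (2 * N)) (a : ℝ) {η : ℝ} (hη : 0 < η) {τ : ℝ} (hτ : 0 < τ)
    (L : ℕ) :
    ∃ (m : ℕ) (γ : ℝ), 0 < γ ∧ ∀ (k : ℕ), 0 < k → ∀ α β : Fin k → ℝ, Monotone α → Monotone β →
      MomentsNear M m γ α → MomentsNear M m γ β →
        (k : ℝ)⁻¹ * ∑ i, ∑ n ∈ Finset.range L,
          (if α i ≤ a + n * η ∧ a + (n + 1) * η ≤ β i then (1 : ℝ) else 0) ≤ L * τ := by
  induction L with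
  | zero => exact ⟨0, 1, one_pos, by simp⟩
  | succ L ih =>
    obtain ⟨m₁, γ₁, hγ₁, H₁⟩ := ih
    obtain ⟨m₂, γ₂, hγ₂, H₂⟩ := exists_momentsNear_separated_le hρ hM
      (s := a + L * η) (t := a + (L + 1) * η) (by nlinarith) hτ
    refine ⟨max m₁ m₂, min γ₁ γ₂, lt_min hγ₁ hγ₂, fun k hk α β hα hβ hα' hβ' => ?_⟩
    have e1 := H₁ k hk α β hα hβ (hα'.mono (le_max_left _ _) (min_le_left _ _))
      (hβ'.mono (le_max_left _ _) (min_le_left _ _))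
    have e2 := H₂ k hk α β hα hβ (hα'.mono (le_max_right _ _) (min_le_right _ _))
      (hβ'.mono (le_max_right _ _) (min_le_right _ _))
    simp only [Finset.sum_range_succ]
    rw [avg_add]
    push_cast
    linarith

/-- A gap of length 2η contains a full cell of the grid of mesh η; the first grid point not below x
starts such a cell. -/
theorem exists_grid_separates {a η : ℝ} (hη : 0 < η) {L : ℕ} {x y : ℝ} (hx : a ≤ x)
    (hxL : x < a + L * η) (hxy : x + 2 * η ≤ y) :
    (1 : ℝ) ≤ ∑ n ∈ Finset.range (L + 1),
      (if x ≤ a + n * η ∧ a + (n + 1) * η ≤ y then (1 : ℝ) else 0) := by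
  set n := ⌈(x - a) / η⌉₊ with hn
  have h1 : (x - a) / η ≤ n := Nat.le_ceil _
  have h2 : (n : ℝ) < (x - a) / η + 1 := Nat.ceil_lt_add_one (div_nonneg (by linarith) hη.le)
  rw [div_le_iff₀ hη] at h1
  have h2' : (n : ℝ) * η < x - a + η := by
    have := mul_lt_mul_of_pos_right h2 hη
    rwa [add_mul, div_mul_cancel₀ _ hη.ne', one_mul] at this
  have hnL : n < L + 1 := by
    have h3 : (n : ℝ) * η < (L + 1) * η := by linarith
    have := lt_of_mul_lt_mul_right h3 hη.le
    exact_mod_cast this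
  have h4 : (if x ≤ a + n * η ∧ a + (n + 1) * η ≤ y then (1 : ℝ) else 0) = 1 :=
    if_pos ⟨by linarith, by linarith⟩
  refine h4.symm.le.trans ?_
  exact Finset.single_le_sum (f := fun n : ℕ =>
    (if x ≤ a + n * η ∧ a + (n + 1) * η ≤ y then (1 : ℝ) else 0))
    (fun i _ => by positivity) (Finset.mem_range.2 hnL)

set_option maxHeartbeats 800000 in
/-- Increasing families with nearby moments are close in mean square. -/
theorem exists_momentsNear_avg_sq_sub_le {M : ℕ → ℝ} {ρ : ℝ} (hρ : 0 ≤ ρ)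
    (hM : ∀ N, M (2 * N) ≤ ρ ^ (2 * N)) {ε : ℝ} (hε : 0 < ε) :
    ∃ (m : ℕ) (γ : ℝ), 0 < γ ∧ ∀ (k : ℕ), 0 < k → ∀ α β : Fin k → ℝ, Monotone α → Monotone β →
      MomentsNear M m γ α → MomentsNear M m γ β →
        (k : ℝ)⁻¹ * ∑ i, (α i - β i) ^ 2 ≤ ε := by
  -- θ is the weight in z ≤ θz² + θ⁻¹ for z = (α i - β i)². It makes the fourth moment terms at most
  -- ε/8 each; R and τ then make each of the four remaining error terms at most ε/16, and η makes
  -- the close pairs cost ε/4.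
  set θ := ε / (4 * (16 * (ρ ^ 4 + 1))) with hθ
  have hθ0 : 0 < θ := by positivity
  set η := √ε / 4 with hη
  have hη0 : 0 < η := by positivity
  have hη2 : 4 * η ^ 2 = ε / 4 := by rw [hη, div_pow, Real.sq_sqrt hε.le]; ring
  set R := √(16 * (ρ ^ 2 + 1) / (θ * ε)) with hR
  have hR0 : 0 < R := by positivity
  have hR2 : R ^ 2 = 16 * (ρ ^ 2 + 1) / (θ * ε) := Real.sq_sqrt (by positivity)
  obtain ⟨L, hL⟩ := exists_nat_gt (2 * R / η)
  have hL' : R < -R + L * η := by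
    rw [div_lt_iff₀ hη0] at hL; linarith
  set τ := θ * ε / (16 * (L + 1)) with hτ
  have hτ0 : 0 < τ := by positivity
  obtain ⟨m, γ, hγ, H⟩ := exists_momentsNear_grid_le hρ hM (-R) hη0 hτ0 (L + 1)
  clear_value τ R η θ
  refine ⟨max m 4, min γ 1, lt_min hγ one_pos, fun k hk α β hα hβ hα' hβ' => ?_⟩
  have e1 := H k hk α β hα hβ (hα'.mono (le_max_left _ _) (min_le_left _ _))
      (hβ'.mono (le_max_left _ _) (min_le_left _ _))
  have e2 := H k hk β α hβ hα (hβ'.mono (le_max_left _ _) (min_le_left _ _))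
      (hα'.mono (le_max_left _ _) (min_le_left _ _))
  have hmom : ∀ (l : Fin k → ℝ), MomentsNear M (max m 4) (min γ 1) l →
      empMoment l 2 ≤ ρ ^ 2 + 1 ∧ empMoment l 4 ≤ ρ ^ 4 + 1 := by
    intro l hl
    have h2 := (abs_lt.1 (hl 2 (by norm_num) (le_trans (by norm_num) (le_max_right _ _)))).2
    have h4 := (abs_lt.1 (hl 4 (by norm_num) (le_max_right _ _))).2
    have := min_le_right γ 1
    have m2 := hM 1
    have m4 := hM 2
    norm_num at m2 m4
    constructor <;> linarith
  obtain ⟨a2, a4⟩ := hmom α hα'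
  obtain ⟨b2, b4⟩ := hmom β hβ'
  set c₁ : Fin k → ℝ := fun i => ∑ n ∈ Finset.range (L + 1),
    (if α i ≤ -R + n * η ∧ -R + (n + 1) * η ≤ β i then (1 : ℝ) else 0) with hc₁
  set c₂ : Fin k → ℝ := fun i => ∑ n ∈ Finset.range (L + 1),
    (if β i ≤ -R + n * η ∧ -R + (n + 1) * η ≤ α i then (1 : ℝ) else 0) with hc₂
  have hc₁0 : ∀ i, 0 ≤ c₁ i := fun i => Finset.sum_nonneg fun _ _ => by positivity
  have hc₂0 : ∀ i, 0 ≤ c₂ i := fun i => Finset.sum_nonneg fun _ _ => by positivity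
  -- If α i and β i differ by more than 2η, then either one of them lies outside [-R, R], or a grid
  -- cell separates them. The sum D below is therefore at least 1 at every such index.
  have hpt : ∀ i, (α i - β i) ^ 2 ≤ 4 * η ^ 2 + ((8 * θ) * α i ^ 4 + ((8 * θ) * β i ^ 4 +
      (θ⁻¹ * c₁ i + (θ⁻¹ * c₂ i + ((θ⁻¹ / R ^ 2) * α i ^ 2 + (θ⁻¹ / R ^ 2) * β i ^ 2))))) := by
    intro i
    set D : ℝ := c₁ i + c₂ i + α i ^ 2 / R ^ 2 + β i ^ 2 / R ^ 2 with hD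
    have hD0 : 0 ≤ D := by have := hc₁0 i; have := hc₂0 i; positivity
    have hq : (α i - β i) ^ 4 ≤ 8 * (α i ^ 4 + β i ^ 4) := by
      nlinarith [sq_nonneg (α i ^ 2 - β i ^ 2), sq_nonneg (α i + β i), sq_nonneg (α i - β i),
        sq_nonneg ((α i + β i) ^ 2), mul_nonneg (sq_nonneg (α i + β i)) (sq_nonneg (α i - β i))]
    have goal' : (α i - β i) ^ 2 ≤ 4 * η ^ 2 + θ * (8 * (α i ^ 4 + β i ^ 4)) + θ⁻¹ * D := by
      by_cases hclose : |α i - β i| ≤ 2 * η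
      · have h1 : (α i - β i) ^ 2 ≤ (2 * η) ^ 2 := by
          rw [← sq_abs]; exact pow_le_pow_left₀ (abs_nonneg _) hclose 2
        have : 0 ≤ θ * (8 * (α i ^ 4 + β i ^ 4)) := by positivity
        have : 0 ≤ θ⁻¹ * D := by positivity
        nlinarith
      · push Not at hclose
        have hD1 : 1 ≤ D := by
          have n1 := hc₁0 i
          have n2 := hc₂0 i
          have n3 : 0 ≤ α i ^ 2 / R ^ 2 := by positivity
          have n4 : 0 ≤ β i ^ 2 / R ^ 2 := by positivity
          by_cases hαR : R < |α i|
          · have : 1 ≤ α i ^ 2 / R ^ 2 := by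
              rw [le_div_iff₀ (by positivity), one_mul, ← sq_abs (α i)]
              exact pow_le_pow_left₀ hR0.le hαR.le 2
            linarith
          by_cases hβR : R < |β i|
          · have : 1 ≤ β i ^ 2 / R ^ 2 := by
              rw [le_div_iff₀ (by positivity), one_mul, ← sq_abs (β i)]
              exact pow_le_pow_left₀ hR0.le hβR.le 2
            linarith
          push Not at hαR hβR
          rw [abs_le] at hαR hβR
          rcases lt_abs.1 hclose with h | h
          · have : 1 ≤ c₂ i := exists_grid_separates hη0 hβR.1 (by linarith) (by linarith)
            linarith
          · have : 1 ≤ c₁ i := exists_grid_separates hη0 hαR.1 (by linarith) (by linarith)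
            linarith
        have h1 : (α i - β i) ^ 2 ≤ θ * (α i - β i) ^ 4 + θ⁻¹ := by
          set z := (α i - β i) ^ 2 with hz
          have h4 : (α i - β i) ^ 4 = z ^ 2 := by rw [hz]; ring
          rw [h4]
          have h5 : θ * θ⁻¹ = 1 := mul_inv_cancel₀ hθ0.ne'
          have hi0 : 0 < θ⁻¹ := by positivity
          have h6 : θ * z ^ 2 + θ⁻¹ - z = θ⁻¹ * ((θ * z - 1/2) ^ 2 + 3 / 4) := by
            field_simp; ring
          have : 0 ≤ θ⁻¹ * ((θ * z - 1/2) ^ 2 + 3 / 4) := by positivity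
          linarith
        have h2 : θ⁻¹ ≤ θ⁻¹ * D := le_mul_of_one_le_right (by positivity) hD1
        have h3 := mul_le_mul_of_nonneg_left hq hθ0.le
        have : 0 ≤ η ^ 2 := by positivity
        linarith
    refine goal'.trans (le_of_eq ?_)
    rw [hD]; ring
  have hsum := avg_le_avg hpt
  rw [avg_add, avg_const hk, avg_add, avg_const_mul, avg_add, avg_const_mul, avg_add,
    avg_const_mul, avg_add, avg_const_mul, avg_add, avg_const_mul, avg_const_mul] at hsum
  refine hsum.trans ?_
  change 4 * η ^ 2 + (8 * θ * empMoment α 4 + (8 * θ * empMoment β 4 + (_ + (_ +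
    (θ⁻¹ / R ^ 2 * empMoment α 2 + θ⁻¹ / R ^ 2 * empMoment β 2))))) ≤ ε
  have f1 : 8 * θ * empMoment α 4 ≤ ε / 8 := by
    have := mul_le_mul_of_nonneg_left a4 (by positivity : 0 ≤ 8 * θ)
    have h : 8 * θ * (ρ ^ 4 + 1) = ε / 8 := by rw [hθ]; field_simp; norm_num
    linarith
  have f2 : 8 * θ * empMoment β 4 ≤ ε / 8 := by
    have := mul_le_mul_of_nonneg_left b4 (by positivity : 0 ≤ 8 * θ)
    have h : 8 * θ * (ρ ^ 4 + 1) = ε / 8 := by rw [hθ]; field_simp; norm_num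
    linarith
  have hτ' : θ⁻¹ * (((L + 1 : ℕ) : ℝ) * τ) = ε / 16 := by
    rw [hτ]; push_cast; field_simp
  have f3 := mul_le_mul_of_nonneg_left e1 (by positivity : 0 ≤ θ⁻¹)
  have f4 := mul_le_mul_of_nonneg_left e2 (by positivity : 0 ≤ θ⁻¹)
  rw [hτ'] at f3 f4
  have hRR : θ⁻¹ / R ^ 2 * (ρ ^ 2 + 1) = ε / 16 := by
    have h1 : ρ ^ 2 + 1 ≠ 0 := by positivity
    rw [hR2]
    generalize ρ ^ 2 + 1 = q at h1
    field_simp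
  have f5 := mul_le_mul_of_nonneg_left a2 (by positivity : 0 ≤ θ⁻¹ / R ^ 2)
  have f6 := mul_le_mul_of_nonneg_left b2 (by positivity : 0 ≤ θ⁻¹ / R ^ 2)
  rw [hRR] at f5 f6
  linarith

end Moments

end FreeEntropy

namespace FreeEntropy

open Matrix MeasureTheory

/-! ### Moments of a selfadjoint element under a tracial state. -/

section State

variable {M : Type*} [CStarAlgebra M] {φ : M →ₗ[ℂ] ℂ}

/-- Polarization: φ is real on (1+x)*(1+x), on 1 and on x*x, and the difference is 2φ(x). -/
theorem IsTracialState.im_eq_zero (hφ : IsTracialState φ) {x : M} (hx : IsSelfAdjoint x) :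
    (φ x).im = 0 := by
  have h1 := (Complex.le_def.1 (hφ.nonneg (1 + x))).2
  have h2 := (Complex.le_def.1 (hφ.nonneg x)).2
  have h3 := (Complex.le_def.1 (hφ.nonneg 1)).2
  have e : star (1 + x) * (1 + x) = star 1 * 1 + (2 : ℂ) • x + star x * x := by
    rw [star_add, hx.star_eq, star_one, two_smul]
    noncomm_ring
  rw [e, map_add, map_add, map_smul] at h1
  simp only [Complex.zero_im, Complex.add_im, smul_eq_mul, Complex.mul_im] at h1 h2 h3
  norm_num at h1 h3
  linarith

/-- In the spectral order ‖b‖² - b*b is positive, hence of the form y*y, where φ is nonnegative. -/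
theorem IsTracialState.re_star_mul_self_le (hφ : IsTracialState φ) (b : M) :
    (φ (star b * b)).re ≤ ‖b‖ ^ 2 := by
  let _ := CStarAlgebra.spectralOrder M
  have := CStarAlgebra.spectralOrderedRing M
  have h1 : star b * b ≤ algebraMap ℝ M (‖b‖ ^ 2) := CStarAlgebra.star_mul_le_algebraMap_norm_sq
  obtain ⟨y, hy⟩ := CStarAlgebra.nonneg_iff_eq_star_mul_self.1 (sub_nonneg.2 h1)
  have h2 := (Complex.le_def.1 (hφ.nonneg y)).1
  rw [← hy, map_sub] at h2
  have h3 : φ (algebraMap ℝ M (‖b‖ ^ 2)) = ((‖b‖ ^ 2 : ℝ) : ℂ) := by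
    rw [Algebra.algebraMap_eq_smul_one, ← Complex.coe_smul, map_smul, hφ.map_one]
    simp
  rw [h3, Complex.sub_re, Complex.ofReal_re, Complex.zero_re] at h2
  linarith

/-- The moments of a selfadjoint element. -/
noncomputable def moment (φ : M →ₗ[ℂ] ℂ) (a : M) (p : ℕ) : ℝ := (φ (a ^ p)).re

theorem IsTracialState.moment_le (hφ : IsTracialState φ) {a : M} (ha : IsSelfAdjoint a) (N : ℕ) :
    moment φ a (2 * N) ≤ ‖a‖ ^ (2 * N) := by
  have h1 := hφ.re_star_mul_self_le (a ^ N)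
  rw [(ha.pow N).star_eq, ← pow_add, ← two_mul] at h1
  refine h1.trans ?_
  rw [mul_comm 2 N, pow_mul]
  rcases Nat.eq_zero_or_pos N with h0 | h0
  · have : ‖(1 : M)‖ ≤ 1 := by
      rcases subsingleton_or_nontrivial M with h | h
      · simp [Subsingleton.elim (1 : M) 0]
      · simp
    simp only [h0, pow_zero]
    nlinarith [norm_nonneg (1 : M)]
  · exact pow_le_pow_left₀ (norm_nonneg _) (norm_pow_le' a h0) 2

theorem IsTracialState.ofReal_moment (hφ : IsTracialState φ) {a : M} (ha : IsSelfAdjoint a)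
    (p : ℕ) : φ (a ^ p) = (moment φ a p : ℂ) :=
  Complex.ext rfl (by simpa using hφ.im_eq_zero (ha.pow p))

end State

/-! ### Exchanging the microstates of a single variable. -/

section SingleVariable

variable {M : Type*} [CStarAlgebra M] {φ : M →ₗ[ℂ] ℂ} {a : M} {m k : ℕ} {γ : ℝ}

theorem monomial_const {R ι : Type*} [Monoid R] (x : R) {p : ℕ} (w : Fin p → ι) :
    monomial (fun _ => x) w = x ^ p := by
  simp [monomial]

theorem monomial_single {p : ℕ} (w : Fin p → Unit) : monomial (single a) w = a ^ p :=
  monomial_const a w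

theorem const_mem_microstates_single {A : Matrix (Fin k) (Fin k) ℂ} :
    (fun _ : Unit => A) ∈ microstates φ (single a) m k γ ↔
      A.IsHermitian ∧ ∀ p, 1 ≤ p → p ≤ m → ‖ntr (A ^ p) - φ (a ^ p)‖ < γ := by
  simp only [microstates, Set.mem_ofPred_eq, monomial_const, monomial_single, forall_const]

theorem ntr_diagMat_pow (l : Fin k → ℝ) (p : ℕ) : ntr (diagMat l ^ p) = (empMoment l p : ℂ) := by
  rw [diagMat_pow, ntr_diagMat, empMoment]

theorem diagMat_mem_microstates_single (hφ : IsTracialState φ) (ha : IsSelfAdjoint a)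
    {l : Fin k → ℝ} :
    (fun _ : Unit => diagMat l) ∈ microstates φ (single a) m k γ ↔
      MomentsNear (moment φ a) m γ l := by
  rw [const_mem_microstates_single]
  simp only [diagMat_isHermitian, true_and, ntr_diagMat_pow, hφ.ofReal_moment ha,
    ← Complex.ofReal_sub, Complex.norm_real, Real.norm_eq_abs, MomentsNear]

theorem microstates_elim_inr {ι : Type*} {x : ι → M} {B : ι → Matrix (Fin k) (Fin k) ℂ}
    {A : Matrix (Fin k) (Fin k) ℂ}
    (h : Sum.elim B (fun _ => A) ∈ microstates φ (Sum.elim x (single a)) m k γ) :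
    (fun _ : Unit => A) ∈ microstates φ (single a) m k γ := by
  refine ⟨fun i => h.1 (Sum.inr i), fun p h1 hp w => ?_⟩
  exact h.2 p h1 hp (Sum.inr ∘ w)

/-- Microstates of a single variable can be exchanged for one another up to a unitary
conjugation, also in joint microstates. -/
theorem exists_exchange {ι : Type*} [Fintype ι] (hφ : IsTracialState φ) (ha : IsSelfAdjoint a)
    (x : ι → M) (m' : ℕ) {γ' : ℝ} (hγ' : 0 < γ') :
    ∃ (m : ℕ) (γ : ℝ), 0 < γ ∧ ∀ (k : ℕ), 0 < k → ∀ A A' : Matrix (Fin k) (Fin k) ℂ,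
      (fun _ : Unit => A) ∈ microstates φ (single a) m k γ →
      (fun _ : Unit => A') ∈ microstates φ (single a) m k γ →
      ∃ U : Matrix (Fin k) (Fin k) ℂ, U * Uᴴ = 1 ∧ ∀ B : ι → Matrix (Fin k) (Fin k) ℂ,
        Sum.elim B (fun _ => A) ∈ microstates φ (Sum.elim x (single a)) m k γ →
        Sum.elim B (fun _ => U * A' * Uᴴ) ∈ microstates φ (Sum.elim x (single a)) m' k γ' := by
  set s := 2 * m' with hs
  have hs' : 2 * m' ≤ 2 ^ s := hs ▸ Nat.lt_two_pow_self.le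
  -- A bound, valid for every microstate with tolerance at most 1, of the traces of the 2^s-th
  -- powers of the letters. It replaces a bound on operator norms, and is the reason why m is taken
  -- at least 2^s.
  set B₀ : ℝ := 2 + ∑ i : ι ⊕ Unit, ‖φ (Sum.elim x (single a) i ^ 2 ^ s)‖ with hB₀
  have hB₀1 : 2 ≤ B₀ := by
    rw [hB₀]; have : 0 ≤ ∑ i : ι ⊕ Unit, ‖φ (Sum.elim x (single a) i ^ 2 ^ s)‖ := by positivity
    linarith
  have hB₀i : ∀ i, ‖φ (Sum.elim x (single a) i ^ 2 ^ s)‖ + 1 ≤ B₀ := by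
    intro i
    have := Finset.single_le_sum (f := fun i => ‖φ (Sum.elim x (single a) i ^ 2 ^ s)‖)
      (fun i _ => norm_nonneg _) (Finset.mem_univ i)
    linarith
  set ε : ℝ := γ' / (2 * (m' + 1) * B₀) with hε
  have hε0 : 0 < ε := by positivity
  have hεγ : m' * (ε * B₀) ≤ γ' / 2 := by
    have : (m' + 1) * (ε * B₀) = γ' / 2 := by rw [hε]; field_simp
    nlinarith [mul_pos hε0 (by linarith : 0 < B₀)]
  obtain ⟨m₀, γ₀, hγ₀, H⟩ := exists_momentsNear_avg_sq_sub_le (norm_nonneg a) (hφ.moment_le ha)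
    (pow_pos hε0 2)
  refine ⟨max m₀ (max m' (2 ^ s)), min γ₀ (min (γ' / 2) 1), by positivity, ?_⟩
  set m := max m₀ (max m' (2 ^ s)) with hm
  set γ := min γ₀ (min (γ' / 2) 1) with hγ
  have hγ1 : γ ≤ 1 := (min_le_right _ _).trans (min_le_right _ _)
  have hγ2 : γ ≤ γ' / 2 := (min_le_right _ _).trans (min_le_left _ _)
  have hms : 2 ^ s ≤ m := (le_max_right _ _).trans (le_max_right _ _)
  have hmm' : m' ≤ m := (le_max_left _ _).trans (le_max_right _ _)
  intro k hk A A' hA hA'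
  have hAH : A.IsHermitian := hA.1 ()
  have hAH' : A'.IsHermitian := hA'.1 ()
  obtain ⟨V, α, hV, hα, hVA⟩ := exists_unitary_monotone hAH
  obtain ⟨V', α', hV', hα', hVA'⟩ := exists_unitary_monotone hAH'
  have hVV' : V'ᴴ * V' = 1 := mul_eq_one_comm.1 hV'
  have hnear : ∀ (C W : Matrix (Fin k) (Fin k) ℂ) (l : Fin k → ℝ), W * Wᴴ = 1 →
      C = W * diagMat l * Wᴴ → (fun _ : Unit => C) ∈ microstates φ (single a) m k γ →
      MomentsNear (moment φ a) m₀ γ₀ l := by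
    intro C W l hW hCW hC
    rw [hCW] at hC
    have := (diagMat_mem_microstates_single hφ ha).1
      ((conj_mem_microstates_iff (A := fun _ : Unit => diagMat l) hW).1 hC)
    exact this.mono (le_max_left _ _) (min_le_left _ _)
  have hclose := H k hk α α' hα hα' (hnear A V α hV hVA hA) (hnear A' V' α' hV' hVA' hA')
  -- This unitary carries the ordered eigenbasis of A' to that of A, so that the conjugate of A'
  -- differs from A by V diag(α - α') V*. It depends on A and A' only, not on B.
  refine ⟨V * V'ᴴ, mul_conjTranspose_mul_eq_one hV (by simpa using hVV'), fun B hB => ?_⟩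
  set A'' := V * V'ᴴ * A' * (V * V'ᴴ)ᴴ with hA''
  have hA''V : A'' = V * diagMat α' * Vᴴ := by
    rw [hA'', hVA', conjTranspose_mul, conjTranspose_conjTranspose]
    calc V * V'ᴴ * (V' * diagMat α' * V'ᴴ) * (V' * Vᴴ)
        = V * (V'ᴴ * V') * diagMat α' * (V'ᴴ * V') * Vᴴ := by simp only [mul_assoc]
      _ = _ := by rw [hVV', mul_one, mul_one]
  have hX : ∀ i, (Sum.elim B (fun _ : Unit => A) i).IsHermitian := hB.1
  have hAH'' : A''.IsHermitian := by rw [hA''V]; exact isHermitian_conj (diagMat_isHermitian _)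
  have hY : ∀ i, (Sum.elim B (fun _ : Unit => A'') i).IsHermitian := by
    rintro (i | i)
    · exact hX (Sum.inl i)
    · exact hAH''
  have h2s : 1 ≤ 2 ^ s := Nat.one_le_two_pow
  have hBX : ∀ i, ‖ntr (Sum.elim B (fun _ : Unit => A) i ^ 2 ^ s)‖ ≤ B₀ := by
    intro i
    have h1 := hB.2 (2 ^ s) h2s hms (fun _ => i)
    have e1 : monomial (Sum.elim B (fun _ : Unit => A)) (fun _ : Fin (2 ^ s) => i) =
      Sum.elim B (fun _ : Unit => A) i ^ 2 ^ s := by simp [monomial]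
    have e2 : monomial (Sum.elim x (single a)) (fun _ : Fin (2 ^ s) => i) =
      Sum.elim x (single a) i ^ 2 ^ s := by simp [monomial]
    rw [e1, e2] at h1
    have h2 := norm_le_norm_add_norm_sub' (ntr (Sum.elim B (fun _ : Unit => A) i ^ 2 ^ s))
      (φ (Sum.elim x (single a) i ^ 2 ^ s))
    have := hB₀i i
    linarith
  have hA''pow : ∀ p, ntr (A'' ^ p) = ntr (A' ^ p) := by
    intro p
    rw [hA''V, hVA', conj_pow hV, conj_pow hV', ntr_conj hV, ntr_conj hV']
  have hBY : ∀ i, ‖ntr (Sum.elim B (fun _ : Unit => A'') i ^ 2 ^ s)‖ ≤ B₀ := by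
    rintro (i | i)
    · exact hBX (Sum.inl i)
    · have h1 := (const_mem_microstates_single.1 hA').2 (2 ^ s) h2s hms
      have h2 := norm_le_norm_add_norm_sub' (ntr (A' ^ 2 ^ s)) (φ (a ^ 2 ^ s))
      have h3 : ‖φ (a ^ 2 ^ s)‖ + 1 ≤ B₀ := hB₀i (Sum.inr ())
      simp only [Sum.elim_inr, hA''pow]
      linarith
  have hXY : ∀ i, ‖ntr ((Sum.elim B (fun _ : Unit => A) i - Sum.elim B (fun _ : Unit => A'') i) *
      (Sum.elim B (fun _ : Unit => A) i - Sum.elim B (fun _ : Unit => A'') i))‖ ≤ ε ^ 2 := by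
    rintro (i | i)
    · simp [ntr]; positivity
    · simp only [Sum.elim_inr]
      have e1 : A - A'' = V * diagMat (fun i => α i - α' i) * Vᴴ := by
        rw [hA''V]
        conv_lhs => rw [hVA]
        have : diagMat (fun i => α i - α' i) = diagMat α - diagMat α' := by
          simp [diagMat, diagonal_sub]
        rw [this]; noncomm_ring
      rw [← pow_two, e1, conj_pow hV, ntr_conj hV, ntr_diagMat_pow, Complex.norm_real,
        Real.norm_of_nonneg]
      · exact hclose
      · unfold empMoment; positivity
  refine ⟨hY, fun p hp1 hp w => ?_⟩
  have h1 := norm_ntr_prod_map_sub_le hk hX hY (by linarith : 1 ≤ B₀) hε0.le hBX hBY hXY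
    (List.ofFn w) (by simp; omega)
  rw [← monomial_eq_prod_map, ← monomial_eq_prod_map, List.length_ofFn] at h1
  have h2 := hB.2 p hp1 (hp.trans hmm') w
  have h3 : (p : ℝ) * (ε * B₀) ≤ m' * (ε * B₀) :=
    mul_le_mul_of_nonneg_right (by exact_mod_cast hp) (by positivity)
  rw [norm_sub_rev] at h1
  have h4 := norm_sub_le_norm_sub_add_norm_sub (ntr (monomial (Sum.elim B (fun _ => A'')) w))
    (ntr (monomial (Sum.elim B (fun _ => A)) w)) (φ (monomial (Sum.elim x (single a)) w))
  linarith

end SingleVariable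

/-! ### Fibre volumes over the microstates of a, and the volume inequality. -/

section Fibers

variable {M : Type*} [CStarAlgebra M] {φ : M →ₗ[ℂ] ℂ} {a : M} {k : ℕ}

/-- The volume of the set of tuples which together with the matrix with coordinates `c` form a
joint microstate. -/
noncomputable def fiberVol {ι : Type*} [Fintype ι] (φ : M →ₗ[ℂ] ℂ) (x : ι → M) (a : M)
    (m : ℕ) (γ : ℝ) (c : Fin k → Fin k → ℝ) : ℝ≥0∞ :=
  vol {B : ι → Matrix (Fin k) (Fin k) ℂ |
    Sum.elim B (fun _ => hermOfCoord c) ∈ microstates φ (Sum.elim x (single a)) m k γ}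

/-- Tonelli's theorem, with the last matrix as outer variable. -/
theorem vol_eq_lintegral {ι : Type*} [Fintype ι] (S : Set (ι ⊕ Unit → Matrix (Fin k) (Fin k) ℂ))
    (hS : MeasurableSet {c : ι ⊕ Unit → Fin k → Fin k → ℝ | (fun i => hermOfCoord (c i)) ∈ S}) :
    vol S = ∫⁻ c : Fin k → Fin k → ℝ,
      vol {B : ι → Matrix (Fin k) (Fin k) ℂ | Sum.elim B (fun _ => hermOfCoord c) ∈ S} := by
  have e1 := volume_measurePreserving_sumPiEquivProdPi_symm
    (fun _ : ι ⊕ Unit => Fin k → Fin k → ℝ)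
  have e2 := (MeasurePreserving.id (volume : Measure (ι → Fin k → Fin k → ℝ))).prod
    (volume_preserving_funUnique Unit (Fin k → Fin k → ℝ)).symm
  have e3 := e1.comp e2
  rw [vol, ← e3.measure_preimage hS.nullMeasurableSet]
  rw [Measure.prod_apply_symm (e3.measurable hS)]
  refine lintegral_congr fun c => ?_
  rw [vol]
  congr 1
  ext b
  simp only [Set.mem_preimage, Set.mem_ofPred_eq]
  refine iff_of_eq (congrArg (· ∈ S) ?_)
  funext i
  rcases i with i | i <;> rfl

theorem vol_microstates_elim {ι : Type*} [Fintype ι] (x : ι → M) (m : ℕ) (γ : ℝ) :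
    vol (microstates φ (Sum.elim x (single a)) m k γ) =
      ∫⁻ c : Fin k → Fin k → ℝ, fiberVol φ x a m γ c :=
  vol_eq_lintegral _ isOpen_coord_microstates.measurableSet

/-- Coordinates of the microstates of a single variable. -/
def singleCoord (φ : M →ₗ[ℂ] ℂ) (a : M) (m k : ℕ) (γ : ℝ) : Set (Fin k → Fin k → ℝ) :=
  {c | (fun _ : Unit => hermOfCoord c) ∈ microstates φ (single a) m k γ}

theorem vol_microstates_single (m : ℕ) (γ : ℝ) :
    vol (microstates φ (single a) m k γ) = volume (singleCoord φ a m k γ) := by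
  rw [vol, ← (volume_preserving_funUnique Unit (Fin k → Fin k → ℝ)).measure_preimage_equiv]
  rfl

theorem measurableSet_singleCoord (m : ℕ) (γ : ℝ) :
    MeasurableSet (singleCoord φ a m k γ) := by
  have h : Continuous fun (c : Fin k → Fin k → ℝ) (_ : Unit) => c := by fun_prop
  exact (isOpen_coord_microstates.preimage h).measurableSet

theorem mem_singleCoord_of_fiberVol_ne_zero {ι : Type*} [Fintype ι] {x : ι → M} {m : ℕ} {γ : ℝ}
    {c : Fin k → Fin k → ℝ} (h : fiberVol φ x a m γ c ≠ 0) : c ∈ singleCoord φ a m k γ := by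
  by_contra hc
  apply h
  rw [fiberVol, vol, ← nonpos_iff_eq_zero]
  refine (measure_mono ?_).trans_eq measure_empty
  intro b hb
  exact hc (microstates_elim_inr hb)

theorem vol_conj {ι : Type*} [Fintype ι] (S : Set (ι → Matrix (Fin k) (Fin k) ℂ))
    (hS : MeasurableSet {c : ι → Fin k → Fin k → ℝ | (fun i => hermOfCoord (c i)) ∈ S})
    {U : Matrix (Fin k) (Fin k) ℂ} (hU : U * Uᴴ = 1) :
    vol {B | (fun i => U * B i * Uᴴ) ∈ S} = vol S := by
  obtain ⟨L, hL⟩ := exists_conjCoord U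
  have h1 := measurePreserving_conjCoord hU hL
  have h2 := volume_preserving_pi (fun _ : ι => h1)
  rw [vol, vol, ← h2.measure_preimage hS.nullMeasurableSet]
  congr 1
  ext c
  simp only [Set.mem_preimage, Set.mem_ofPred_eq, hL]

/-- The fibre volumes over different microstates of `a` are comparable. -/
theorem exists_fiberVol_le {ι : Type*} [Fintype ι] (hφ : IsTracialState φ) (ha : IsSelfAdjoint a)
    (x : ι → M) (m' : ℕ) {γ' : ℝ} (hγ' : 0 < γ') :
    ∃ (m : ℕ) (γ : ℝ), 0 < γ ∧ ∀ (k : ℕ), 0 < k → ∀ c ∈ singleCoord φ a m k γ,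
      ∀ c' ∈ singleCoord φ a m k γ, fiberVol φ x a m γ c ≤ fiberVol φ x a m' γ' c' := by
  obtain ⟨m, γ, hγ, H⟩ := exists_exchange hφ ha x m' hγ'
  refine ⟨m, γ, hγ, fun k hk c hc c' hc' => ?_⟩
  obtain ⟨U, hU, hB⟩ := H k hk (hermOfCoord c) (hermOfCoord c') hc hc'
  have hU' : Uᴴ * U = 1 := mul_eq_one_comm.1 hU
  calc fiberVol φ x a m γ c
      ≤ vol {B : ι → Matrix (Fin k) (Fin k) ℂ | Sum.elim B (fun _ => U * hermOfCoord c' * Uᴴ) ∈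
          microstates φ (Sum.elim x (single a)) m' k γ'} := measure_mono fun b hb => hB _ hb
    -- Conjugating the whole joint microstate by U* moves the unitary from the last matrix to B,
    -- where it does not affect the volume.
    _ = vol {B : ι → Matrix (Fin k) (Fin k) ℂ | (fun i => Uᴴ * B i * Uᴴᴴ) ∈
          {B : ι → Matrix (Fin k) (Fin k) ℂ | Sum.elim B (fun _ => hermOfCoord c') ∈
          microstates φ (Sum.elim x (single a)) m' k γ'}} := by
        congr 1
        ext B
        simp only [Set.mem_ofPred_eq]
        rw [← conj_mem_microstates_iff (A := Sum.elim (fun i => Uᴴ * B i * Uᴴᴴ) _) hU]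
        refine iff_of_eq (congrArg (· ∈ _) ?_)
        funext i
        rcases i with i | i
        · simp only [Sum.elim_inl, conjTranspose_conjTranspose]
          calc B i = (U * Uᴴ) * B i * (U * Uᴴ) := by rw [hU, mul_one, one_mul]
            _ = _ := by simp only [mul_assoc]
        · rfl
    _ = fiberVol φ x a m' γ' c' := by
        refine vol_conj _ ?_ (by simpa using hU')
        have h : Continuous fun b : ι → Fin k → Fin k → ℝ =>
            (Sum.elim b (fun _ => c') : ι ⊕ Unit → Fin k → Fin k → ℝ) := by
          refine continuous_pi fun i => ?_
          rcases i with i | i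
          · exact continuous_apply i
          · exact continuous_const
        have h2 := (isOpen_coord_microstates (φ := φ) (x := Sum.elim x (single a)) (m := m')
          (k := k) (γ := γ')).preimage h
        convert h2.measurableSet using 1
        ext b
        simp only [Set.mem_preimage, Set.mem_ofPred_eq]
        refine iff_of_eq (congrArg (· ∈ _) ?_)
        funext i
        rcases i with i | i <;> rfl

theorem fiberVol_mono {ι : Type*} [Fintype ι] {x : ι → M} {m m' : ℕ} {γ γ' : ℝ} (hm : m' ≤ m)
    (hγ : γ ≤ γ') (c : Fin k → Fin k → ℝ) : fiberVol φ x a m γ c ≤ fiberVol φ x a m' γ' c :=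
  measure_mono fun _ hb => microstates_mono hm hγ hb

theorem singleCoord_mono {m m' : ℕ} {γ γ' : ℝ} (hm : m' ≤ m) (hγ : γ ≤ γ') :
    singleCoord φ a m k γ ⊆ singleCoord φ a m' k γ' := fun _ hc => microstates_mono hm hγ hc

/-- Words in one half of the variables and a are among the words in all of them, so the joint fibre
is contained in the product of the two fibres. -/
theorem fiberVol_elim_le {ι κ : Type*} [Fintype ι] [Fintype κ] (x : ι → M) (y : κ → M)
    (m : ℕ) (γ : ℝ) (c : Fin k → Fin k → ℝ) :
    fiberVol φ (Sum.elim x y) a m γ c ≤ fiberVol φ x a m γ c * fiberVol φ y a m γ c := by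
  have e1 := volume_measurePreserving_sumPiEquivProdPi (fun _ : ι ⊕ κ => Fin k → Fin k → ℝ)
  simp only [fiberVol, vol]
  rw [← Measure.prod_prod, ← Measure.volume_eq_prod, ← e1.measure_preimage_equiv]
  refine measure_mono fun b hb => ⟨?_, ?_⟩
  · refine ⟨?_, fun p h1 hp w => ?_⟩
    · rintro (i | i)
      exacts [hb.1 (Sum.inl (Sum.inl i)), hb.1 (Sum.inr i)]
    · have := hb.2 p h1 hp (fun j => Sum.map Sum.inl id (w j))
      convert this using 5
      all_goals
        simp only [monomial]
        congr 2
        funext j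
        rcases w j with i | i <;> rfl
  · refine ⟨?_, fun p h1 hp w => ?_⟩
    · rintro (i | i)
      exacts [hb.1 (Sum.inl (Sum.inr i)), hb.1 (Sum.inr i)]
    · have := hb.2 p h1 hp (fun j => Sum.map Sum.inr id (w j))
      convert this using 5
      all_goals
        simp only [monomial]
        congr 2
        funext j
        rcases w j with i | i <;> rfl

/-- Obtained by integrating the constant lower bound for the fibres over the microstates of a. -/
theorem volume_mul_fiberVol_le {ι : Type*} [Fintype ι] {x : ι → M} {m m' : ℕ} {γ γ' : ℝ}
    {c : Fin k → Fin k → ℝ}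
    (h : ∀ c' ∈ singleCoord φ a m k γ, fiberVol φ x a m γ c ≤ fiberVol φ x a m' γ' c') :
    volume (singleCoord φ a m k γ) * fiberVol φ x a m γ c ≤
      vol (microstates φ (Sum.elim x (single a)) m' k γ') := by
  rw [vol_microstates_elim, mul_comm, ← setLIntegral_const]
  exact (setLIntegral_mono' (measurableSet_singleCoord m γ) h).trans (setLIntegral_le_lintegral _ _)

/-- The volume form of the subadditivity of free entropy. -/
theorem exists_vol_mul_vol_le {ι κ : Type*} [Fintype ι] [Fintype κ] (hφ : IsTracialState φ)
    (ha : IsSelfAdjoint a) (x : ι → M) (y : κ → M) (m' : ℕ) {γ' : ℝ} (hγ' : 0 < γ') :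
    ∃ (m : ℕ) (γ : ℝ), 0 < γ ∧ 2 ≤ m ∧ γ ≤ 1 ∧ ∀ (k : ℕ), 0 < k →
      vol (microstates φ (single a) m k γ) ≠ 0 → vol (microstates φ (single a) m k γ) ≠ ⊤ →
      vol (microstates φ (single a) m k γ) *
          vol (microstates φ (Sum.elim (Sum.elim x y) (single a)) m k γ) ≤
        vol (microstates φ (Sum.elim x (single a)) m' k γ') *
          vol (microstates φ (Sum.elim y (single a)) m' k γ') := by
  obtain ⟨m₁, γ₁, hγ₁, H₁⟩ := exists_fiberVol_le hφ ha x m' hγ'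
  obtain ⟨m₂, γ₂, hγ₂, H₂⟩ := exists_fiberVol_le hφ ha y m' hγ'
  refine ⟨max (max m₁ m₂) 2, min (min γ₁ γ₂) 1, lt_min (lt_min hγ₁ hγ₂) one_pos,
    le_max_right _ _, min_le_right _ _, fun k hk h0 ht => ?_⟩
  set m := max (max m₁ m₂) 2
  set γ := min (min γ₁ γ₂) 1
  have hm₁ : m₁ ≤ m := (le_max_left _ _).trans (le_max_left _ _)
  have hm₂ : m₂ ≤ m := (le_max_right _ _).trans (le_max_left _ _)
  have hγγ₁ : γ ≤ γ₁ := (min_le_left _ _).trans (min_le_left _ _)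
  have hγγ₂ : γ ≤ γ₂ := (min_le_left _ _).trans (min_le_right _ _)
  set D := singleCoord φ a m k γ with hD
  rw [vol_microstates_single] at h0 ht ⊢
  have hD₁ : D ⊆ singleCoord φ a m₁ k γ₁ := singleCoord_mono hm₁ hγγ₁
  have hD₂ : D ⊆ singleCoord φ a m₂ k γ₂ := singleCoord_mono hm₂ hγγ₂
  have k₁ : ∀ c ∈ D, volume D * fiberVol φ x a m γ c ≤
      vol (microstates φ (Sum.elim x (single a)) m' k γ') := fun c hc =>
    volume_mul_fiberVol_le fun c' hc' =>
      (fiberVol_mono hm₁ hγγ₁ c).trans (H₁ k hk c (hD₁ hc) c' (hD₁ hc'))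
  have k₂ : ∀ c ∈ D, volume D * fiberVol φ y a m γ c ≤
      vol (microstates φ (Sum.elim y (single a)) m' k γ') := fun c hc =>
    volume_mul_fiberVol_le fun c' hc' =>
      (fiberVol_mono hm₂ hγγ₂ c).trans
        (H₂ k hk c (hD₂ hc) c' (hD₂ hc'))
  set VX := vol (microstates φ (Sum.elim x (single a)) m' k γ')
  set VY := vol (microstates φ (Sum.elim y (single a)) m' k γ')
  -- The factor |D| is used once for each of the two fibres. Integration over D gives it back once
  -- on the right, and one factor cancels since 0 < |D| < ∞.
  have hbound : ∀ c, volume D * (volume D * fiberVol φ (Sum.elim x y) a m γ c) ≤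
      D.indicator (fun _ => VX * VY) c := by
    intro c
    by_cases hc : c ∈ D
    · rw [Set.indicator_of_mem hc]
      calc volume D * (volume D * fiberVol φ (Sum.elim x y) a m γ c)
          ≤ volume D * (volume D * (fiberVol φ x a m γ c * fiberVol φ y a m γ c)) := by
            gcongr; exact fiberVol_elim_le x y m γ c
        _ = (volume D * fiberVol φ x a m γ c) * (volume D * fiberVol φ y a m γ c) := by ring
        _ ≤ VX * VY := mul_le_mul' (k₁ c hc) (k₂ c hc)
    · have : fiberVol φ (Sum.elim x y) a m γ c = 0 := by
        by_contra h
        exact hc (mem_singleCoord_of_fiberVol_ne_zero h)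
      simp [this]
  have hint := lintegral_mono (μ := volume) hbound
  rw [lintegral_const_mul' _ _ ht, lintegral_const_mul' _ _ ht, ← vol_microstates_elim,
    lintegral_indicator (measurableSet_singleCoord m γ), setLIntegral_const, mul_comm (VX * VY)]
    at hint
  exact (ENNReal.mul_le_mul_iff_right h0 ht).1 hint

end Fibers

end FreeEntropy

namespace FreeEntropy

open Matrix MeasureTheory

/-! ### Vandermonde determinants and the integral over an interlacing box. -/

section Vandermonde

/-- The Vandermonde product `∏_{i < j} (l j - l i)`. -/
def vprod {n : ℕ} (l : Fin n → ℝ) : ℝ := ∏ i, ∏ j ∈ Finset.Ioi i, (l j - l i)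

theorem vprod_eq_det {n : ℕ} (l : Fin n → ℝ) : vprod l = (vandermonde l).det :=
  (det_vandermonde l).symm

theorem vprod_pos {n : ℕ} {l : Fin n → ℝ} (hl : StrictMono l) : 0 < vprod l :=
  Finset.prod_pos fun _ _ => Finset.prod_pos fun _ hj =>
    sub_pos.2 (hl (Finset.mem_Ioi.1 hj))

theorem continuous_vprod {n : ℕ} : Continuous (vprod (n := n)) := by
  unfold vprod; fun_prop

/-- The derivative at the node `x i` of `∏ j, (X - x j)`. -/
def nodeProd {n : ℕ} (x : Fin n → ℝ) (i : Fin n) : ℝ := ∏ j ∈ Finset.univ.erase i, (x i - x j)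

theorem univ_erase_eq {n : ℕ} (i : Fin n) :
    Finset.univ.erase i = Finset.Iio i ∪ Finset.Ioi i := by
  ext j; simp [lt_or_lt_iff_ne]

/-- Every pair of nodes contributes its difference twice, with opposite signs. -/
theorem abs_prod_nodeProd {n : ℕ} (x : Fin n → ℝ) : |∏ i, nodeProd x i| = |vprod x| ^ 2 := by
  have h1 : ∏ i, nodeProd x i =
      (∏ i, ∏ j ∈ Finset.Iio i, (x i - x j)) * ∏ i, ∏ j ∈ Finset.Ioi i, (x i - x j) := by
    rw [← Finset.prod_mul_distrib]
    refine Finset.prod_congr rfl fun i _ => ?_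
    rw [nodeProd, univ_erase_eq, Finset.prod_union]
    exact Finset.disjoint_left.2 fun j h1 h2 =>
      lt_asymm (Finset.mem_Iio.1 h1) (Finset.mem_Ioi.1 h2)
  have h2 : ∏ i, ∏ j ∈ Finset.Iio i, (x i - x j) = vprod x := by
    rw [vprod, Finset.prod_comm' (t' := Finset.univ) (s' := fun j => Finset.Ioi j)]
    simp
  have h3 : |∏ i, ∏ j ∈ Finset.Ioi i, (x i - x j)| = |vprod x| := by
    rw [vprod, Finset.abs_prod, Finset.abs_prod]
    refine Finset.prod_congr rfl fun i _ => ?_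
    rw [Finset.abs_prod, Finset.abs_prod]
    exact Finset.prod_congr rfl fun j _ => abs_sub_comm _ _
  rw [h1, h2, abs_mul, h3, sq]

theorem neg_one_pow_mul_nodeProd_pos {n : ℕ} {x : Fin n → ℝ} (hx : StrictMono x) (i : Fin n) :
    0 < (-1) ^ (n - 1 - i : ℕ) * nodeProd x i := by
  rw [nodeProd, univ_erase_eq, Finset.prod_union]
  · have h1 : 0 < ∏ j ∈ Finset.Iio i, (x i - x j) :=
      Finset.prod_pos fun j hj => sub_pos.2 (hx (Finset.mem_Iio.1 hj))
    have h2 : 0 < (-1) ^ (n - 1 - i : ℕ) * ∏ j ∈ Finset.Ioi i, (x i - x j) := by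
      rw [← Fin.card_Ioi, ← Finset.prod_const, ← Finset.prod_mul_distrib]
      exact Finset.prod_pos fun j hj => by
        have := hx (Finset.mem_Ioi.1 hj); linarith
    have := mul_pos h1 h2
    linarith
  · exact Finset.disjoint_left.2 fun j h1 h2 =>
      lt_asymm (Finset.mem_Iio.1 h1) (Finset.mem_Ioi.1 h2)

/-- The matrix of coefficients of the polynomials `∏_{l ≠ j} (X - y l)`. -/
noncomputable def coeffMat {n : ℕ} (y : Fin (n + 1) → ℝ) : Matrix (Fin (n + 1)) (Fin (n + 1)) ℝ :=
  of fun m j => (∏ l ∈ Finset.univ.erase j, (Polynomial.X - Polynomial.C (y l))).coeff m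

theorem natDegree_prod_erase {n : ℕ} (y : Fin (n + 1) → ℝ) (j : Fin (n + 1)) :
    (∏ l ∈ Finset.univ.erase j, (Polynomial.X - Polynomial.C (y l))).natDegree = n := by
  rw [Polynomial.natDegree_prod_of_monic _ _ fun l _ => Polynomial.monic_X_sub_C _]
  simp

theorem sum_pow_mul_coeffMat {n : ℕ} (y : Fin (n + 1) → ℝ) (x : ℝ) (j : Fin (n + 1)) :
    ∑ m : Fin (n + 1), x ^ (m : ℕ) * coeffMat y m j =
      ∏ l ∈ Finset.univ.erase j, (x - y l) := by
  have h := Polynomial.eval_eq_sum_range' (p := ∏ l ∈ Finset.univ.erase j,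
    (Polynomial.X - Polynomial.C (y l))) (n := n + 1) (by rw [natDegree_prod_erase]; omega) x
  rw [Polynomial.eval_prod] at h
  simp only [Polynomial.eval_sub, Polynomial.eval_X, Polynomial.eval_C] at h
  rw [h, Finset.sum_range]
  exact Finset.sum_congr rfl fun m _ => by rw [coeffMat, of_apply, mul_comm]

/-- Multiplying by the Vandermonde matrix evaluates the polynomials at the nodes y, which gives the
diagonal matrix of node products with determinant ±`vprod y`²; one factor cancels. -/
theorem abs_det_coeffMat {n : ℕ} {y : Fin (n + 1) → ℝ} (hy : vprod y ≠ 0) :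
    |(coeffMat y).det| = |vprod y| := by
  have h : vandermonde y * coeffMat y = diagonal (nodeProd y) := by
    ext i j
    rw [mul_apply]
    simp only [vandermonde_apply, sum_pow_mul_coeffMat, diagonal_apply]
    split_ifs with hij
    · rw [hij, nodeProd]
    · exact Finset.prod_eq_zero (Finset.mem_erase.2 ⟨hij, Finset.mem_univ i⟩) (sub_self _)
  have h2 := congrArg (fun A => |A.det|) h
  simp only [det_mul, det_diagonal, abs_mul, abs_prod_nodeProd, ← vprod_eq_det] at h2
  have : |vprod y| ≠ 0 := abs_ne_zero.2 hy
  rw [sq] at h2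
  exact mul_left_cancel₀ this h2

/-- The Jacobian of the passage from the spectrum of a bordered matrix to the border. -/
noncomputable def borderJac {n : ℕ} (x : Fin n → ℝ) (y : Fin (n + 1) → ℝ) :
    Matrix (Fin (n + 1)) (Fin (n + 1)) ℝ :=
  of fun i j => Fin.cases 1
    (fun i => (nodeProd x i)⁻¹ * ∏ l ∈ Finset.univ.erase j, (x i - y l)) i

/-- All rows are linear functionals of the coefficients of ∏_{l ≠ j} (X - y l): the leading
coefficient, and the normalized values at the x i. So the matrix factors through `coeffMat y`, and
the other factor reduces to the Vandermonde matrix of x with rows divided by the node products. -/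
theorem abs_det_borderJac {n : ℕ} {x : Fin n → ℝ} {y : Fin (n + 1) → ℝ} (hx : vprod x ≠ 0)
    (hy : vprod y ≠ 0) : |(borderJac x y).det| = |vprod y| / |vprod x| := by
  set B : Matrix (Fin (n + 1)) (Fin (n + 1)) ℝ := of fun i m =>
    Fin.cases (if m = Fin.last n then 1 else 0) (fun i => (nodeProd x i)⁻¹ * x i ^ (m : ℕ)) i
    with hB
  have h1 : borderJac x y = B * coeffMat y := by
    ext i j
    rw [mul_apply]
    refine Fin.cases ?_ (fun i => ?_) i
    · simp only [hB, borderJac, of_apply, Fin.cases_zero, ite_mul, one_mul, zero_mul,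
        Finset.sum_ite_eq', Finset.mem_univ, if_true, coeffMat, Fin.val_last]
      have hm : (∏ l ∈ Finset.univ.erase j, (Polynomial.X - Polynomial.C (y l))).Monic :=
        Polynomial.monic_prod_of_monic _ _ fun l _ => Polynomial.monic_X_sub_C _
      have := hm.coeff_natDegree
      rw [natDegree_prod_erase] at this
      exact this.symm
    · simp only [hB, borderJac, of_apply, Fin.cases_succ, mul_assoc]
      rw [← Finset.mul_sum, sum_pow_mul_coeffMat]
  have h2 : |B.det| = |vprod x|⁻¹ := by
    rw [det_succ_row_zero, Finset.sum_eq_single (Fin.last n)]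
    · have h3 : B.submatrix Fin.succ (Fin.last n).succAbove =
          of fun i j => (nodeProd x i)⁻¹ * vandermonde x i j := by
        ext i j
        simp [hB, vandermonde_apply]
      rw [h3, det_mul_column, ← vprod_eq_det]
      simp only [hB, of_apply, Fin.cases_zero, if_true]
      have h4 := abs_prod_nodeProd x
      have hx' : |vprod x| ≠ 0 := abs_ne_zero.2 hx
      rw [abs_mul, abs_mul, abs_mul, Finset.prod_inv_distrib, abs_inv, h4, abs_pow, abs_neg,
        abs_one, one_pow, one_mul, one_mul]
      field_simp
    · intro j _ hj
      simp [hB, hj]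
    · simp
  rw [h1, det_mul, abs_mul, h2, abs_det_coeffMat hy]
  ring

/-- Subtract consecutive rows of the Vandermonde matrix and expand along the first column. The
entries that remain are, up to the factor j + 1, integrals of powers over the intervals between
neighbouring nodes. -/
theorem vprod_succ_eq_det {n : ℕ} (y : Fin (n + 1) → ℝ) :
    vprod y = (of fun i j : Fin n => y i.succ ^ (j + 1 : ℕ) - y i.castSucc ^ (j + 1 : ℕ)).det := by
  set B : Matrix (Fin (n + 1)) (Fin (n + 1)) ℝ := of fun i m =>
    Fin.cases (y 0 ^ (m : ℕ)) (fun i => y i.succ ^ (m : ℕ) - y i.castSucc ^ (m : ℕ)) i with hB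
  have h1 : (vandermonde y).det = B.det :=
    det_eq_of_forall_row_eq_smul_add_pred (fun _ => 1) (fun j => by simp [hB, vandermonde_apply])
      (fun i j => by simp [hB, vandermonde_apply])
  rw [vprod_eq_det, h1, det_succ_column_zero, Finset.sum_eq_single 0]
  · simp only [Fin.val_zero, pow_zero, one_mul, hB, of_apply, Fin.cases_zero]
    congr 1
  · intro i _ hi
    obtain ⟨i, rfl⟩ := Fin.exists_succ_eq.2 hi
    simp [hB]
  · simp

/-- The integral of the Vandermonde product over the interlacing box. -/
theorem lintegral_box_vprod {n : ℕ} {y : Fin (n + 1) → ℝ} (hy : StrictMono y) :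
    ∫⁻ x in Set.univ.pi fun i : Fin n => Set.Ioo (y i.castSucc) (y i.succ),
      ENNReal.ofReal (vprod x) = ENNReal.ofReal (vprod y / n.factorial) := by
  set I : Fin n → Set ℝ := fun i => Set.Ioo (y i.castSucc) (y i.succ) with hI
  have hint1 : ∀ (i : Fin n) (m : ℕ), Integrable (fun t : ℝ => t ^ m) (volume.restrict (I i)) := by
    intro i m
    have : IntegrableOn (fun t : ℝ => t ^ m) (Set.Icc (y i.castSucc) (y i.succ)) :=
      (by fun_prop : Continuous fun t : ℝ => t ^ m).continuousOn.integrableOn_Icc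
    exact this.mono_set Set.Ioo_subset_Icc_self
  have hval : ∀ (i : Fin n) (m : ℕ), ∫ t in I i, t ^ m =
      (y i.succ ^ (m + 1) - y i.castSucc ^ (m + 1)) / (m + 1) := by
    intro i m
    have hle : y i.castSucc ≤ y i.succ := (hy (Fin.castSucc_lt_succ)).le
    rw [← integral_Ioc_eq_integral_Ioo, ← intervalIntegral.integral_of_le hle, integral_pow]
  -- After expanding the determinant, each term is a product of powers of single variables. The
  -- denominators multiply to n! for every permutation, so the sum is again a determinant.
  have hdet : ∀ x : Fin n → ℝ, vprod x =
      ∑ σ : Equiv.Perm (Fin n), (Equiv.Perm.sign σ : ℝ) * ∏ i, x i ^ (σ i : ℕ) := by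
    intro x
    rw [vprod_eq_det, ← det_transpose, det_apply']
    simp [vandermonde_apply]
  have hintσ : ∀ σ : Equiv.Perm (Fin n), Integrable
      (fun x : Fin n → ℝ => (Equiv.Perm.sign σ : ℝ) * ∏ i, x i ^ (σ i : ℕ))
      (Measure.pi fun i => volume.restrict (I i)) := fun σ =>
    (Integrable.fintype_prod (f := fun i t => t ^ (σ i : ℕ)) fun i => hint1 i _).const_mul _
  have hint : Integrable (vprod (n := n)) (Measure.pi fun i => volume.restrict (I i)) := by
    have : vprod (n := n) = fun x =>
      ∑ σ : Equiv.Perm (Fin n), (Equiv.Perm.sign σ : ℝ) * ∏ i, x i ^ (σ i : ℕ) := funext hdet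
    rw [this]
    exact integrable_finsetSum _ fun σ _ => hintσ σ
  have hres : (volume : Measure (Fin n → ℝ)).restrict (Set.univ.pi I) =
      Measure.pi fun i => volume.restrict (I i) := by
    rw [volume_pi, Measure.restrict_pi_pi]
  rw [hres, ← ofReal_integral_eq_lintegral_ofReal hint]
  · congr 1
    simp only [hdet]
    rw [integral_finsetSum _ fun σ _ => hintσ σ]
    simp only [integral_const_mul]
    have : ∀ σ : Equiv.Perm (Fin n), ∫ x : Fin n → ℝ, ∏ i, x i ^ (σ i : ℕ)
        ∂(Measure.pi fun i => volume.restrict (I i)) =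
        ∏ i, (y i.succ ^ ((σ i : ℕ) + 1) - y i.castSucc ^ ((σ i : ℕ) + 1)) / ((σ i : ℕ) + 1) := by
      intro σ
      rw [integral_fintype_prod_eq_prod (fun i t => t ^ (σ i : ℕ))]
      exact Finset.prod_congr rfl fun i _ => hval i _
    simp only [this, Finset.prod_div_distrib]
    have hfac : ∀ σ : Equiv.Perm (Fin n), ∏ i, (((σ i : ℕ) : ℝ) + 1) = n.factorial := by
      intro σ
      rw [Equiv.prod_comp σ (fun i : Fin n => ((i : ℕ) : ℝ) + 1),
        Fin.prod_univ_eq_prod_range (fun i : ℕ => (i : ℝ) + 1) n]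
      exact_mod_cast Finset.prod_range_add_one_eq_factorial n
    simp only [hfac, ← mul_div_assoc]
    rw [← Finset.sum_div, vprod_succ_eq_det, ← det_transpose, det_apply']
    simp
  · rw [← hres]
    refine (ae_restrict_mem (MeasurableSet.univ_pi fun i => measurableSet_Ioo)).mono fun x hx => ?_
    have hx' : StrictMono x := by
      intro i j hij
      have h1 := (hx i (Set.mem_univ i)).2
      have h2 := (hx j (Set.mem_univ j)).1
      have h3 : y i.succ ≤ y j.castSucc := hy.monotone (by
        rw [Fin.le_def]; simpa using hij)
      linarith
    exact (vprod_pos hx').le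

end Vandermonde

end FreeEntropy

namespace FreeEntropy

open Matrix MeasureTheory Polynomial

/-! ### Interlacing families and the secular polynomial. -/

section Interlacing

variable {n : ℕ}

/-- The families `x` and `y` interlace: `y 0 < x 0 < y 1 < ⋯ < x (n-1) < y n`. -/
def Interlace (x : Fin n → ℝ) (y : Fin (n + 1) → ℝ) : Prop :=
  ∀ i, y i.castSucc < x i ∧ x i < y i.succ

theorem Interlace.strictMono_right {x : Fin n → ℝ} {y : Fin (n + 1) → ℝ} (h : Interlace x y) :
    StrictMono y :=
  Fin.strictMono_iff_lt_succ.2 fun i => (h i).1.trans (h i).2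

theorem Interlace.strictMono_left {x : Fin n → ℝ} {y : Fin (n + 1) → ℝ} (h : Interlace x y) :
    StrictMono x := by
  intro i j hij
  have h3 : y i.succ ≤ y j.castSucc := h.strictMono_right.monotone (by
    rw [Fin.le_def]; simpa using hij)
  exact ((h i).2.trans_le h3).trans (h j).1

theorem Interlace.ne {x : Fin n → ℝ} {y : Fin (n + 1) → ℝ} (h : Interlace x y) (i : Fin n)
    (j : Fin (n + 1)) : y j ≠ x i := by
  rcases le_or_gt j i.castSucc with hj | hj
  · exact ((h.strictMono_right.monotone hj).trans_lt (h i).1).ne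
  · have : i.succ ≤ j := Fin.castSucc_lt_iff_succ_le.1 hj
    exact ((h i).2.trans_le (h.strictMono_right.monotone this)).ne'

/-- The monic polynomial with the given roots. -/
noncomputable def rootPoly (z : Fin n → ℝ) : ℝ[X] := ∏ l, (X - C (z l))

theorem rootPoly_monic (z : Fin n → ℝ) : (rootPoly z).Monic :=
  monic_prod_of_monic _ _ fun _ _ => monic_X_sub_C _

theorem natDegree_rootPoly (z : Fin n → ℝ) : (rootPoly z).natDegree = n := by
  rw [rootPoly, natDegree_prod_of_monic _ _ fun l _ => monic_X_sub_C _]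
  simp

theorem eval_rootPoly (z : Fin n → ℝ) (t : ℝ) : (rootPoly z).eval t = ∏ l, (t - z l) := by
  simp [rootPoly, eval_prod]

theorem coeff_rootPoly_succ (z : Fin (n + 1) → ℝ) : (rootPoly z).coeff n = -∑ l, z l := by
  have h := prod_X_sub_C_coeff_card_pred (R := ℝ) (Finset.univ : Finset (Fin (n + 1))) z (by simp)
  simpa [rootPoly] using h

theorem degree_rootPoly_sub_lt {y z : Fin (n + 1) → ℝ} (h : ∑ l, y l = ∑ l, z l) :
    (rootPoly y - rootPoly z).degree < n := by
  rw [degree_lt_iff_coeff_zero]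
  intro m hm
  rw [coeff_sub]
  rcases hm.eq_or_lt with rfl | hm
  · rw [coeff_rootPoly_succ, coeff_rootPoly_succ, h, sub_self]
  rcases (Nat.succ_le_of_lt hm).eq_or_lt with rfl | hm
  · have h1 := (rootPoly_monic y).coeff_natDegree
    have h2 := (rootPoly_monic z).coeff_natDegree
    rw [natDegree_rootPoly] at h1 h2
    rw [Nat.succ_eq_add_one, h1, h2, sub_self]
  · rw [coeff_eq_zero_of_natDegree_lt, coeff_eq_zero_of_natDegree_lt, sub_self] <;>
      rw [natDegree_rootPoly] <;> exact hm

/-- A monic polynomial of degree `n` with `n` distinct given roots. -/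
theorem eq_rootPoly {P : ℝ[X]} (hP : P.Monic) (hd : P.natDegree = n) {z : Fin n → ℝ}
    (hz : Function.Injective z) (hr : ∀ l, P.eval (z l) = 0) : P = rootPoly z := by
  refine eq_of_degree_sub_lt_of_eval_index_eq (s := Finset.univ) (v := z) hz.injOn ?_ ?_
  · have hdeg : P.degree = (rootPoly z).degree := by
      rw [degree_eq_natDegree hP.ne_zero, degree_eq_natDegree (rootPoly_monic z).ne_zero, hd,
        natDegree_rootPoly]
    have := degree_sub_lt_left hdeg hP.ne_zero
      (by rw [hP.leadingCoeff, (rootPoly_monic z).leadingCoeff])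
    rw [degree_eq_natDegree hP.ne_zero, hd] at this
    simpa using this
  · intro l _
    rw [hr, eval_rootPoly]
    exact (Finset.prod_eq_zero (Finset.mem_univ l) (sub_self _)).symm

theorem rootPoly_injOn {y z : Fin n → ℝ} (hy : StrictMono y) (hz : StrictMono z)
    (h : rootPoly y = rootPoly z) : y = z := by
  have key : ∀ w : Fin n → ℝ, Set.range w = {t | (rootPoly w).eval t = 0} := by
    intro w
    ext t
    simp only [Set.mem_range, Set.mem_ofPred_eq, eval_rootPoly, Finset.prod_eq_zero_iff,
      sub_eq_zero, Finset.mem_univ, true_and]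
    exact exists_congr fun _ => eq_comm
  refine (hy.range_inj hz).1 ?_
  rw [key, key, h]

/-- `(X - c) ∏ (X - x i) - ∑ w i ∏_{j ≠ i} (X - x j)`, the characteristic polynomial of a bordered
diagonal matrix. -/
noncomputable def secularPoly (x : Fin n → ℝ) (c : ℝ) (w : Fin n → ℝ) : ℝ[X] :=
  rootPoly (Fin.cons c x) - ∑ i, C (w i) * ∏ j ∈ Finset.univ.erase i, (X - C (x j))

theorem degree_sum_erase_lt (x w : Fin n → ℝ) :
    (∑ i, C (w i) * ∏ j ∈ Finset.univ.erase i, (X - C (x j))).degree < n := by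
  rw [← mem_degreeLT]
  refine Submodule.sum_mem _ fun i _ => ?_
  rw [mem_degreeLT]
  have h1 : (∏ j ∈ Finset.univ.erase i, (X - C (x j))).degree = ((n - 1 : ℕ) : WithBot ℕ) := by
    rw [degree_prod]; simp
  have hn : n - 1 < n := by have := i.2; omega
  refine (degree_mul_le _ _).trans_lt ((add_le_add_left degree_C_le _).trans_lt ?_)
  rw [zero_add, h1]
  exact_mod_cast hn

theorem eval_secularPoly (x : Fin n → ℝ) (c : ℝ) (w : Fin n → ℝ) (t : ℝ) :
    (secularPoly x c w).eval t =
      (t - c) * ∏ i, (t - x i) - ∑ i, w i * ∏ j ∈ Finset.univ.erase i, (t - x j) := by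
  simp [secularPoly, eval_rootPoly, Fin.prod_univ_succ, eval_finsetSum, eval_prod]

theorem eval_secularPoly_node (x : Fin n → ℝ) (c : ℝ) (w : Fin n → ℝ) (i : Fin n) :
    (secularPoly x c w).eval (x i) = -(w i * nodeProd x i) := by
  rw [eval_secularPoly, Finset.prod_eq_zero (Finset.mem_univ i) (sub_self _), mul_zero, zero_sub,
    Finset.sum_eq_single i]
  · rfl
  · intro j _ hj
    rw [Finset.prod_eq_zero (Finset.mem_erase.2 ⟨hj.symm, Finset.mem_univ i⟩) (sub_self _),
      mul_zero]
  · simp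

theorem degree_sum_erase_lt_rootPoly (x : Fin n → ℝ) (c : ℝ) (w : Fin n → ℝ) :
    (∑ i, C (w i) * ∏ j ∈ Finset.univ.erase i, (X - C (x j))).degree <
      (rootPoly (Fin.cons c x : Fin (n + 1) → ℝ)).degree := by
  rw [degree_eq_natDegree (rootPoly_monic _).ne_zero, natDegree_rootPoly]
  exact (degree_sum_erase_lt x w).trans (by exact_mod_cast Nat.lt_succ_self n)

theorem secularPoly_monic (x : Fin n → ℝ) (c : ℝ) (w : Fin n → ℝ) : (secularPoly x c w).Monic :=
  (rootPoly_monic _).sub_of_left (degree_sum_erase_lt_rootPoly x c w)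

theorem natDegree_secularPoly (x : Fin n → ℝ) (c : ℝ) (w : Fin n → ℝ) :
    (secularPoly x c w).natDegree = n + 1 := by
  rw [secularPoly, natDegree_eq_of_degree_eq
    (degree_sub_eq_left_of_degree_lt (degree_sum_erase_lt_rootPoly x c w)), natDegree_rootPoly]

theorem coeff_secularPoly (x : Fin n → ℝ) (c : ℝ) (w : Fin n → ℝ) :
    (secularPoly x c w).coeff n = -(c + ∑ i, x i) := by
  rw [secularPoly, coeff_sub, coeff_rootPoly_succ,
    coeff_eq_zero_of_degree_lt (degree_sum_erase_lt x w), sub_zero, Fin.sum_univ_succ]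
  simp

/-- The squared moduli of the border entries of a bordered matrix with spectra `x` and `y`. -/
noncomputable def borderWeight (x : Fin n → ℝ) (y : Fin (n + 1) → ℝ) (i : Fin n) : ℝ :=
  -(∏ l, (x i - y l)) / nodeProd x i

theorem nodeProd_ne_zero {x : Fin n → ℝ} (hx : Function.Injective x) (i : Fin n) :
    nodeProd x i ≠ 0 :=
  Finset.prod_ne_zero_iff.2 fun _ hj =>
    sub_ne_zero.2 fun h => (Finset.mem_erase.1 hj).1 (hx h).symm

/-- The corner entry is chosen to match the two top coefficients, so the difference has degree below
n; the weights are chosen to match the values at the n nodes x i. -/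
theorem rootPoly_eq_secularPoly {x : Fin n → ℝ} (hx : Function.Injective x)
    (y : Fin (n + 1) → ℝ) :
    rootPoly y = secularPoly x (∑ l, y l - ∑ i, x i) (borderWeight x y) := by
  refine eq_of_degree_sub_lt_of_eval_index_eq (s := Finset.univ) (v := x) hx.injOn ?_ ?_
  · rw [secularPoly, ← sub_add, Finset.card_univ, Fintype.card_fin, ← mem_degreeLT]
    refine Submodule.add_mem _ ?_ ?_ <;> rw [mem_degreeLT]
    · exact degree_rootPoly_sub_lt (by rw [Fin.sum_univ_succ (f := Fin.cons _ x)]; simp)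
    · exact degree_sum_erase_lt _ _
  · intro i _
    rw [eval_secularPoly_node, eval_rootPoly, borderWeight,
      div_mul_cancel₀ _ (nodeProd_ne_zero hx i), neg_neg]

/-- Exactly n - i of the y l lie above x i, so that many factors are negative. -/
theorem Interlace.neg_one_pow_mul_prod_pos {x : Fin n → ℝ} {y : Fin (n + 1) → ℝ}
    (h : Interlace x y) (i : Fin n) : 0 < (-1) ^ (n - i : ℕ) * ∏ l, (x i - y l) := by
  have hsplit : (Finset.univ : Finset (Fin (n + 1))) =
      Finset.Iic i.castSucc ∪ Finset.Ioi i.castSucc := by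
    ext l; simp [le_or_gt]
  rw [hsplit, Finset.prod_union]
  · have h1 : 0 < ∏ l ∈ Finset.Iic i.castSucc, (x i - y l) :=
      Finset.prod_pos fun l hl => sub_pos.2
        ((h.strictMono_right.monotone (Finset.mem_Iic.1 hl)).trans_lt (h i).1)
    have h2 : 0 < (-1) ^ (n - i : ℕ) * ∏ l ∈ Finset.Ioi i.castSucc, (x i - y l) := by
      have hc : (Finset.Ioi i.castSucc).card = n - i := by simp
      rw [← hc, ← Finset.prod_const, ← Finset.prod_mul_distrib]
      refine Finset.prod_pos fun l hl => ?_
      have := (h i).2.trans_le (h.strictMono_right.monotone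
        (Fin.castSucc_lt_iff_succ_le.1 (Finset.mem_Ioi.1 hl)))
      linarith
    have := mul_pos h1 h2
    linarith
  · exact Finset.disjoint_left.2 fun j h1 h2 =>
      not_lt.2 (Finset.mem_Iic.1 h1) (Finset.mem_Ioi.1 h2)

/-- The numerator product has one more negative factor than the node product; the minus sign in the
definition compensates for it. -/
theorem Interlace.borderWeight_pos {x : Fin n → ℝ} {y : Fin (n + 1) → ℝ} (h : Interlace x y)
    (i : Fin n) : 0 < borderWeight x y i := by
  have h1 := h.neg_one_pow_mul_prod_pos i
  have h2 := neg_one_pow_mul_nodeProd_pos h.strictMono_left i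
  have hs : (n - i : ℕ) = (n - 1 - i) + 1 := by have := i.2; omega
  rw [hs, pow_succ] at h1
  set s : ℝ := (-1) ^ (n - 1 - i : ℕ)
  have hs0 : s ≠ 0 := by rintro h0; rw [h0] at h2; simp at h2
  have : borderWeight x y i = (s * -1 * ∏ l, (x i - y l)) / (s * nodeProd x i) := by
    rw [borderWeight]
    have := nodeProd_ne_zero h.strictMono_left.injective i
    field_simp
  rw [this]
  exact div_pos h1 h2

/-- The spectrum `y` in terms of the border: existence of an interlacing family. -/
theorem exists_interlace_secularPoly {x : Fin n → ℝ} (hx : StrictMono x) (c : ℝ) {w : Fin n → ℝ}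
    (hw : ∀ i, 0 < w i) : ∃ y, Interlace x y ∧ secularPoly x c w = rootPoly y := by
  set R := secularPoly x c w with hR
  have hRm : R.Monic := secularPoly_monic x c w
  have hRd : R.natDegree = n + 1 := natDegree_secularPoly x c w
  obtain ⟨b, hb, hbx⟩ : ∃ b, 0 < R.eval b ∧ ∀ i, x i < b := by
    have h1 : Filter.Tendsto (fun t => R.eval t) Filter.atTop Filter.atTop :=
      tendsto_atTop_of_leadingCoeff_nonneg R
        (natDegree_pos_iff_degree_pos.1 (by omega)) (by rw [hRm.leadingCoeff]; exact zero_le_one)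
    exact ((h1.eventually_gt_atTop 0).and
      (Filter.eventually_all.2 fun i => Filter.eventually_gt_atTop (x i))).exists
  obtain ⟨a, ha, hax⟩ : ∃ a, 0 < (-1) ^ (n + 1) * R.eval a ∧ ∀ i, a < x i := by
    set R' := C ((-1) ^ (n + 1)) * R.comp (-X) with hR'
    have hlc : (R.comp (-X)).leadingCoeff = (-1) ^ (n + 1) := by
      rw [leadingCoeff_comp (by simp), hRm.leadingCoeff, hRd]; simp
    have hlc' : R'.leadingCoeff = 1 := by
      rw [hR', leadingCoeff_mul, leadingCoeff_C, hlc, ← mul_pow]; simp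
    have hd' : R'.natDegree = n + 1 := by
      rw [hR', natDegree_C_mul (by simp), natDegree_comp, hRd]; simp
    have h1 : Filter.Tendsto (fun t => R'.eval t) Filter.atTop Filter.atTop :=
      tendsto_atTop_of_leadingCoeff_nonneg R'
        (natDegree_pos_iff_degree_pos.1 (by omega)) (by rw [hlc']; exact zero_le_one)
    obtain ⟨t, ht, htx⟩ := ((h1.eventually_gt_atTop 0).and
      (Filter.eventually_all.2 fun i => Filter.eventually_gt_atTop (-x i))).exists
    refine ⟨-t, ?_, fun i => by linarith [htx i]⟩
    simpa [hR', eval_comp] using ht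
  -- The n + 1 intervals into which x cuts (a, b). The polynomial has opposite signs at the two ends
  -- of each, hence a root inside, and the degree leaves room for no others.
  set lo : Fin (n + 1) → ℝ := Fin.cons a x with hlo
  set hi : Fin (n + 1) → ℝ := Fin.snoc x b with hhi
  have hRx : ∀ i : Fin n, 0 < (-1) ^ (n - i : ℕ) * R.eval (x i) := by
    intro i
    rw [hR, eval_secularPoly_node]
    have h2 := neg_one_pow_mul_nodeProd_pos hx i
    have hs : (n - i : ℕ) = (n - 1 - i) + 1 := by have := i.2; omega
    rw [hs, pow_succ]
    have := mul_pos (hw i) h2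
    linarith
  have hlosign : ∀ j : Fin (n + 1), 0 < (-1) ^ (n + 1 - j : ℕ) * R.eval (lo j) := by
    intro j
    refine Fin.cases ?_ (fun i => ?_) j
    · simpa [hlo] using ha
    · have : (n + 1 - (i.succ : ℕ)) = n - i := by simp
      rw [this]
      simpa [hlo] using hRx i
  have hhisign : ∀ j : Fin (n + 1), 0 < (-1) ^ (n - j : ℕ) * R.eval (hi j) := by
    intro j
    refine Fin.lastCases ?_ (fun i => ?_) j
    · simpa [hhi] using hb
    · simpa [hhi] using hRx i
  have hlohi : ∀ j, lo j < hi j := by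
    intro j
    have hab : a < b := by
      rcases Nat.eq_zero_or_pos n with h0 | h0
      · subst h0
        by_contra hba
        push Not at hba
        have e : ∀ t, R.eval t = t - c := by intro t; rw [hR, eval_secularPoly]; simp
        rw [e] at ha hb
        simp at ha
        linarith
      · exact (hax ⟨0, h0⟩).trans (hbx ⟨0, h0⟩)
    refine Fin.cases ?_ (fun i => ?_) j
    · rcases Nat.eq_zero_or_pos n with h0 | h0
      · subst h0; simpa [hlo, hhi, Fin.snoc] using hab
      · have : hi 0 = x ⟨0, h0⟩ := by
          have : (0 : Fin (n + 1)) = Fin.castSucc ⟨0, h0⟩ := by ext; simp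
          rw [hhi, this, Fin.snoc_castSucc]
        rw [this]
        simpa [hlo] using hax _
    · have h1 : lo i.succ = x i := by simp [hlo]
      rw [h1]
      by_cases hi' : (i : ℕ) + 1 < n
      · have h2 : hi i.succ = x ⟨i + 1, hi'⟩ := by
          have : i.succ = Fin.castSucc ⟨i + 1, hi'⟩ := by ext; simp
          rw [hhi, this, Fin.snoc_castSucc]
        rw [h2]
        exact hx (by rw [Fin.lt_def]; simp)
      · have h2 : hi i.succ = b := by
          have : i.succ = Fin.last n := by ext; simp; omega
          rw [hhi, this, Fin.snoc_last]
        rw [h2]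
        exact hbx i
  have hroot : ∀ j, ∃ t, (lo j < t ∧ t < hi j) ∧ R.eval t = 0 := by
    intro j
    have h1 := hlosign j
    have h2 := hhisign j
    have hs : (n + 1 - j : ℕ) = (n - j) + 1 := by have := j.2; omega
    rw [hs, pow_succ] at h1
    set s : ℝ := (-1) ^ (n - j : ℕ)
    have hs0 : s ≠ 0 := by rintro h0; rw [h0] at h2; simp at h2
    have hc : ContinuousOn (fun t => s * R.eval t) (Set.Icc (lo j) (hi j)) := by fun_prop
    obtain ⟨t, ht, ht0⟩ := intermediate_value_Ioo (hlohi j).le hc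
      (show (0 : ℝ) ∈ Set.Ioo _ _ from ⟨by change s * R.eval (lo j) < 0; linarith, h2⟩)
    exact ⟨t, ht, (mul_eq_zero.1 ht0).resolve_left hs0⟩
  choose y hy hy0 using hroot
  have hint : Interlace x y := by
    intro i
    constructor
    · have := (hy i.castSucc).2; simpa [hhi] using this
    · have := (hy i.succ).1; simpa [hlo] using this
  exact ⟨y, hint, eq_rootPoly hRm hRd hint.strictMono_right.injective hy0⟩

end Interlacing

/-! ### Bordered diagonal matrices and the change of variables from border to spectrum. -/

section Border

variable {n : ℕ}

/-- The matrix `A` bordered by a corner entry `d` and a vector `v`. -/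
def bord (d : ℝ) (v : Fin n → ℂ) (A : Matrix (Fin n) (Fin n) ℂ) :
    Matrix (Fin (n + 1)) (Fin (n + 1)) ℂ :=
  of fun i j => Fin.cases (Fin.cases (d : ℂ) v j)
    (fun i => Fin.cases (star (v i)) (fun j => A i j) j) i

theorem bord_isHermitian (d : ℝ) (v : Fin n → ℂ) {A : Matrix (Fin n) (Fin n) ℂ}
    (hA : A.IsHermitian) : (bord d v A).IsHermitian := by
  ext i j
  refine Fin.cases ?_ (fun i => ?_) i <;> refine Fin.cases ?_ (fun j => ?_) j
  · simp [bord]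
  · simp [bord]
  · simp [bord]
  · simpa [bord] using hA.apply i j

/-- The vector with entries 1 and √(w i)/(y j - x i) is an eigenvector for y j; the eigenvalue
equation is the secular equation c + ∑ w i/(y j - x i) = y j. The y j are distinct, so they exhaust
the spectrum. -/
theorem exists_unitary_bord {x : Fin n → ℝ} {y : Fin (n + 1) → ℝ} (h : Interlace x y) :
    ∃ U : Matrix (Fin (n + 1)) (Fin (n + 1)) ℂ, U * Uᴴ = 1 ∧
      bord (∑ l, y l - ∑ i, x i) (fun i => ((√(borderWeight x y i) : ℝ) : ℂ)) (diagMat x) =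
        U * diagMat y * Uᴴ := by
  set c := ∑ l, y l - ∑ i, x i with hc
  set w := borderWeight x y with hw
  set A := bord c (fun i => ((√(w i) : ℝ) : ℂ)) (diagMat x) with hA
  refine exists_unitary_of_charpoly_eq (bord_isHermitian _ _ (diagMat_isHermitian _)) ?_
  have hxi := h.strictMono_left.injective
  have hyi := h.strictMono_right.injective
  have hsec : ∀ j, c + ∑ i, w i / (y j - x i) = y j := by
    intro j
    have h1 := congrArg (eval (y j)) (rootPoly_eq_secularPoly hxi y)
    rw [eval_rootPoly, Finset.prod_eq_zero (Finset.mem_univ j) (sub_self _),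
      eval_secularPoly] at h1
    have hne : ∀ i, y j - x i ≠ 0 := fun i => sub_ne_zero.2 (h.ne i j)
    have hQ : ∏ i, (y j - x i) ≠ 0 := Finset.prod_ne_zero_iff.2 fun i _ => hne i
    have h2 : ∀ i, w i * ∏ l ∈ Finset.univ.erase i, (y j - x l) =
        (∏ i, (y j - x i)) * (w i / (y j - x i)) := by
      intro i
      rw [← Finset.mul_prod_erase Finset.univ (fun l => y j - x l) (Finset.mem_univ i)]
      field_simp [hne i]
    rw [Finset.sum_congr rfl fun i _ => h2 i, ← Finset.mul_sum] at h1
    have h3 : (∏ i, (y j - x i)) * ((y j - c) - ∑ i, w i / (y j - x i)) = 0 := by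
      rw [mul_sub, mul_comm _ (y j - c)]; exact h1.symm
    have := (mul_eq_zero.1 h3).resolve_left hQ
    linarith
  have hroot : ∀ j, A.charpoly.eval (y j : ℂ) = 0 := by
    intro j
    have hne : ∀ i, (y j : ℂ) - x i ≠ 0 := fun i => by
      rw [← Complex.ofReal_sub]
      exact Complex.ofReal_ne_zero.2 (sub_ne_zero.2 (h.ne i j))
    rw [eval_charpoly, ← exists_mulVec_eq_zero_iff]
    refine ⟨Fin.cons 1 fun i => ((√(w i) : ℝ) : ℂ) / (y j - x i), ?_, ?_⟩
    · intro h0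
      have := congrFun h0 0
      simp at this
    · rw [sub_mulVec, sub_eq_zero]
      ext i
      rw [scalar_apply, mulVec_diagonal]
      refine Fin.cases ?_ (fun i => ?_) i
      · have h1 : (y j : ℂ) = c + ∑ i, (w i : ℂ) / (y j - x i) := by
          have := congrArg (fun t : ℝ => (t : ℂ)) (hsec j)
          push_cast at this
          exact this.symm
        simp only [mulVec, dotProduct, Fin.sum_univ_succ, hA, bord, of_apply, Fin.cases_zero,
          Fin.cases_succ, Fin.cons_zero, Fin.cons_succ, mul_one]
        conv_lhs => rw [h1]
        congr 1
        refine Finset.sum_congr rfl fun i _ => ?_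
        rw [mul_div_assoc', ← Complex.ofReal_mul,
          Real.mul_self_sqrt (h.borderWeight_pos i).le]
      · simp only [mulVec, dotProduct, Fin.sum_univ_succ, hA, bord, of_apply, Fin.cases_zero,
          Fin.cases_succ, Fin.cons_zero, Fin.cons_succ, mul_one, diagMat, diagonal_apply]
        simp only [ite_mul, zero_mul, Finset.sum_ite_eq, Finset.mem_univ, if_true]
        have := hne i
        simp only [RCLike.star_def, Complex.conj_ofReal]
        field_simp
        ring
  have hmon := A.charpoly_monic
  have hnd : A.charpoly.natDegree = n + 1 := by rw [charpoly_natDegree_eq_dim]; simp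
  set P : ℂ[X] := ∏ l, (X - C (y l : ℂ)) with hP
  have hPm : P.Monic := monic_prod_of_monic _ _ fun _ _ => monic_X_sub_C _
  have hPd : P.natDegree = n + 1 := by
    rw [hP, natDegree_prod_of_monic _ _ fun l _ => monic_X_sub_C _]
    simp
  refine eq_of_degree_sub_lt_of_eval_index_eq (s := Finset.univ) (v := fun j => (y j : ℂ))
    (Complex.ofReal_injective.comp hyi).injOn ?_ ?_
  · have hdeg : A.charpoly.degree = P.degree := by
      rw [degree_eq_natDegree hmon.ne_zero, degree_eq_natDegree hPm.ne_zero, hnd, hPd]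
    have := degree_sub_lt_left hdeg hmon.ne_zero (by rw [hmon.leadingCoeff, hPm.leadingCoeff])
    rw [degree_eq_natDegree hmon.ne_zero, hnd] at this
    simpa using this
  · intro l _
    rw [hroot, hP, eval_prod]
    exact (Finset.prod_eq_zero (Finset.mem_univ l) (by simp)).symm

/-- The border, in coordinates, of a bordered matrix as a function of its spectrum. -/
noncomputable def borderMap (x : Fin n → ℝ) (y : Fin (n + 1) → ℝ) : Fin (n + 1) → ℝ :=
  fun i => Fin.cases ((∑ l, y l - ∑ i, x i) / √2) (fun i => Real.pi * borderWeight x y i) i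

/-- The border determines the secular polynomial, whose ordered roots are y. -/
theorem borderMap_injOn {x : Fin n → ℝ} : Set.InjOn (borderMap x) {y | Interlace x y} := by
  intro y hy z hz hyz
  refine rootPoly_injOn hy.strictMono_right hz.strictMono_right ?_
  have hxi := hy.strictMono_left.injective
  have h0 : (∑ l, y l - ∑ i, x i) = ∑ l, z l - ∑ i, x i := by
    have h := congrFun hyz 0
    simp only [borderMap, Fin.cases_zero] at h
    have h2 : √(2 : ℝ) ≠ 0 := by positivity
    field_simp at h
    exact h
  have h1 : borderWeight x y = borderWeight x z := by
    funext i
    have h := congrFun hyz i.succ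
    simp only [borderMap, Fin.cases_succ] at h
    exact mul_left_cancel₀ Real.pi_ne_zero h
  rw [rootPoly_eq_secularPoly hxi, rootPoly_eq_secularPoly hxi z, h0, h1]

/-- Corner and weights can be prescribed freely as long as the weights are positive: the secular
polynomial they define has interlacing roots. -/
theorem borderMap_image {x : Fin n → ℝ} (hx : StrictMono x) :
    borderMap x '' {y | Interlace x y} = {t | ∀ i : Fin n, 0 < t i.succ} := by
  ext t
  constructor
  · rintro ⟨y, hy, rfl⟩ i
    simp only [borderMap, Fin.cases_succ]
    exact mul_pos Real.pi_pos (hy.borderWeight_pos i)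
  · intro ht
    obtain ⟨y, hy, hR⟩ := exists_interlace_secularPoly hx (√2 * t 0)
      (w := fun i => t i.succ / Real.pi) (fun i => div_pos (ht i) Real.pi_pos)
    refine ⟨y, hy, ?_⟩
    funext i
    refine Fin.cases ?_ (fun i => ?_) i
    · have h1 := congrArg (fun P => P.coeff n) hR
      simp only [coeff_secularPoly, coeff_rootPoly_succ] at h1
      simp only [borderMap, Fin.cases_zero]
      have h2 : √(2 : ℝ) ≠ 0 := by positivity
      rw [div_eq_iff h2]
      linarith
    · have h1 := congrArg (eval (x i)) hR
      rw [eval_secularPoly_node, eval_rootPoly] at h1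
      simp only [borderMap, Fin.cases_succ, borderWeight]
      rw [← h1, neg_neg, mul_div_cancel_right₀ _ (nodeProd_ne_zero hx.injective i),
        mul_div_cancel₀ _ Real.pi_ne_zero]

/-- The Jacobian matrix of `borderMap`. -/
noncomputable def borderMapJac (x : Fin n → ℝ) (y : Fin (n + 1) → ℝ) :
    Matrix (Fin (n + 1)) (Fin (n + 1)) ℝ :=
  of fun i j => (Fin.cases (√2)⁻¹ (fun _ => Real.pi) i : ℝ) * borderJac x y i j

theorem hasFDerivAt_borderMap (x : Fin n → ℝ) (y : Fin (n + 1) → ℝ) :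
    HasFDerivAt (borderMap x) (toLin' (borderMapJac x y)).toContinuousLinearMap y := by
  rw [hasFDerivAt_pi']
  intro i
  have hproj : ∀ l : Fin (n + 1), HasFDerivAt (fun y : Fin (n + 1) → ℝ => y l)
      (ContinuousLinearMap.proj (R := ℝ) (φ := fun _ : Fin (n + 1) => ℝ) l) y :=
    fun l => hasFDerivAt_apply l y
  refine Fin.cases ?_ (fun i => ?_) i
  · have hs : HasFDerivAt (fun y : Fin (n + 1) → ℝ => ∑ l, y l)
        (∑ l, ContinuousLinearMap.proj (R := ℝ) (φ := fun _ : Fin (n + 1) => ℝ) l) y :=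
      HasFDerivAt.fun_sum fun l _ => hproj l
    have h1 : HasFDerivAt (fun y : Fin (n + 1) → ℝ => (∑ l, y l - ∑ i, x i) * (√2)⁻¹)
        ((√2)⁻¹ • ∑ l, ContinuousLinearMap.proj (R := ℝ) (φ := fun _ : Fin (n + 1) => ℝ) l) y :=
      (hs.sub_const _).mul_const _
    have e : (fun y : Fin (n + 1) → ℝ => borderMap x y 0) =
        fun y => (∑ l, y l - ∑ i, x i) * (√2)⁻¹ := by
      funext y; simp [borderMap, div_eq_mul_inv]
    rw [e]
    refine h1.congr_fderiv ?_
    ext h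
    simp [borderMapJac, borderJac, mulVec, dotProduct, Finset.mul_sum]
  · have h1 : HasFDerivAt (fun y : Fin (n + 1) → ℝ => ∏ l, (x i - y l))
        (∑ l, (∏ j ∈ Finset.univ.erase l, (x i - y j)) •
          (-ContinuousLinearMap.proj (R := ℝ) (φ := fun _ : Fin (n + 1) => ℝ) l)) y :=
      HasFDerivAt.finsetProd fun l _ => (hproj l).const_sub _
    have h2 := h1.const_mul (-Real.pi * (nodeProd x i)⁻¹)
    have e : (fun y : Fin (n + 1) → ℝ => borderMap x y i.succ) =
        fun y => (-Real.pi * (nodeProd x i)⁻¹) * ∏ l, (x i - y l) := by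
      funext y; simp only [borderMap, Fin.cases_succ, borderWeight]; ring
    rw [e]
    refine h2.congr_fderiv ?_
    ext h
    simp only [borderMapJac, borderJac, toLin'_apply, ContinuousLinearMap.comp_apply,
      ContinuousLinearMap.proj_apply, LinearMap.coe_toContinuousLinearMap', mulVec, dotProduct,
      of_apply, Fin.cases_succ, _root_.smul_apply, _root_.sum_apply,
      _root_.neg_apply, smul_eq_mul, Finset.mul_sum]
    exact Finset.sum_congr rfl fun l _ => by ring

/-- The constants come from the coordinates: the corner entry is √2 times its coordinate, and the
entry v i is represented by π|v i|². -/
theorem abs_det_borderMapJac {x : Fin n → ℝ} {y : Fin (n + 1) → ℝ} (h : Interlace x y) :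
    |(borderMapJac x y).det| = Real.pi ^ n / √2 * (vprod y / vprod x) := by
  have hx := vprod_pos h.strictMono_left
  have hy := vprod_pos h.strictMono_right
  rw [borderMapJac, det_mul_column, abs_mul, abs_det_borderJac hx.ne' hy.ne', abs_of_pos hx,
    abs_of_pos hy, Fin.prod_univ_succ]
  simp only [Fin.cases_zero, Fin.cases_succ, Finset.prod_const, Finset.card_univ, Fintype.card_fin]
  rw [abs_of_pos (by positivity)]
  ring

theorem measurableSet_interlace_right (x : Fin n → ℝ) : MeasurableSet {y | Interlace x y} := by
  have : {y | Interlace x y} = ⋂ i, ({y | y i.castSucc < x i} ∩ {y | x i < y i.succ}) := by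
    ext y; simp [Interlace]
  rw [this]
  exact MeasurableSet.iInter fun i => (measurableSet_lt (measurable_pi_apply _)
    measurable_const).inter (measurableSet_lt measurable_const (measurable_pi_apply _))

/-- The change of variables from the border of a bordered matrix to its spectrum. -/
theorem lintegral_border_eq {x : Fin n → ℝ} (hx : StrictMono x)
    (g : (Fin (n + 1) → ℝ) → ℝ≥0∞) :
    ∫⁻ t in {t : Fin (n + 1) → ℝ | ∀ i : Fin n, 0 < t i.succ}, g t =
      ∫⁻ y in {y | Interlace x y},
        ENNReal.ofReal (Real.pi ^ n / √2 * (vprod y / vprod x)) * g (borderMap x y) := by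
  rw [← borderMap_image hx, lintegral_image_eq_lintegral_abs_det_fderiv_mul volume
    (measurableSet_interlace_right x) (fun y _ => (hasFDerivAt_borderMap x y).hasFDerivWithinAt)
    borderMap_injOn]
  refine setLIntegral_congr_fun (measurableSet_interlace_right x) fun y hy => ?_
  have : ((toLin' (borderMapJac x y)).toContinuousLinearMap).det = (borderMapJac x y).det := by
    rw [← LinearMap.det_toLin']; rfl
  simp only [this, abs_det_borderMapJac hy]

end Border

end FreeEntropy

namespace FreeEntropy

open Matrix MeasureTheory

/-! ### Lebesgue measure on bordered matrices. -/

section BorderCoordinates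

variable {n : ℕ}

/-- Hermitian matrices in coordinates which are orthonormal up to a factor not depending on the
size of the matrices. -/
noncomputable def hermU (c : Fin n → Fin n → ℝ) : Matrix (Fin n) (Fin n) ℂ :=
  of fun i j => if i = j then ((√2 * c i i : ℝ) : ℂ)
    else if i < j then ⟨c i j, c j i⟩ else ⟨c j i, -c i j⟩

theorem hermOfCoord_eq_smul (c : Fin n → Fin n → ℝ) :
    hermOfCoord c = √((n : ℝ) / 2) • hermU c := by
  ext i j
  simp only [hermOfCoord, hermU, of_apply, Matrix.smul_apply]
  have h : √(n : ℝ) = √((n : ℝ) / 2) * √2 := by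
    rw [← Real.sqrt_mul (by positivity)]; congr 1; ring
  split_ifs
  · rw [h]
    generalize √((n : ℝ) / 2) = s
    simp [mul_assoc]
  · simp [Complex.ext_iff]
  · simp [Complex.ext_iff]

/-- The coordinates of a bordered matrix. -/
def comb (p : (ℝ × (Fin n → ℂ)) × (Fin n → Fin n → ℝ)) : Fin (n + 1) → Fin (n + 1) → ℝ :=
  Fin.cons (Fin.cons p.1.1 fun j => (p.1.2 j).re) fun i => Fin.cons (p.1.2 i).im (p.2 i)

theorem hermU_comb (d : ℝ) (v : Fin n → ℂ) (c : Fin n → Fin n → ℝ) :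
    hermU (comb ((d, v), c)) = bord (√2 * d) v (hermU c) := by
  ext i j
  refine Fin.cases ?_ (fun i => ?_) i <;> refine Fin.cases ?_ (fun j => ?_) j
  · simp [hermU, comb, bord]
  · simp [hermU, comb, bord, (Fin.succ_ne_zero j).symm]
  · simp [hermU, comb, bord, Complex.ext_iff]
  · simp only [hermU, comb, bord, of_apply, Fin.cases_succ, Fin.succ_inj, Fin.succ_lt_succ_iff,
      Fin.cons_succ]

theorem measurePreserving_cons (α : Type*) [MeasureSpace α] [SigmaFinite (volume : Measure α)] :
    MeasurePreserving fun p : α × (Fin n → α) => (Fin.cons p.1 p.2 : Fin (n + 1) → α) := by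
  have h := (volume_preserving_piFinSuccAbove (fun _ : Fin (n + 1) => α) 0).symm
  convert h using 1
  funext p
  simp [MeasurableEquiv.piFinSuccAbove_symm_apply, Fin.insertNthEquiv, Fin.insertNth_zero']

/-- Only a regrouping of real coordinates, with each complex border entry split into its real and
imaginary parts. -/
theorem measurePreserving_comb : MeasurePreserving (comb (n := n)) := by
  have hcons := measurePreserving_cons (n := n) ℝ
  have hC : MeasurePreserving fun v : Fin n → ℂ =>
      ((fun j => (v j).re, fun j => (v j).im) : (Fin n → ℝ) × (Fin n → ℝ)) :=
    (volume_measurePreserving_arrowProdEquivProdArrow ℝ ℝ (Fin n)).comp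
      (volume_preserving_pi fun _ : Fin n => Complex.volume_preserving_equiv_real_prod)
  have hrows : MeasurePreserving fun q : (Fin n → ℝ) × (Fin n → Fin n → ℝ) =>
      fun i => (Fin.cons (q.1 i) (q.2 i) : Fin (n + 1) → ℝ) :=
    (volume_preserving_pi fun _ : Fin n => hcons).comp
      (volume_measurePreserving_arrowProdEquivProdArrow ℝ (Fin n → ℝ) (Fin n)).symm
  have hre : MeasurePreserving fun p : (ℝ × ((Fin n → ℝ) × (Fin n → ℝ))) × (Fin n → Fin n → ℝ) =>
      (((p.1.1, p.1.2.1), (p.1.2.2, p.2)) :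
        (ℝ × (Fin n → ℝ)) × ((Fin n → ℝ) × (Fin n → Fin n → ℝ))) :=
    volume_preserving_prodAssoc.comp
      (volume_preserving_prodAssoc.symm.prod (MeasurePreserving.id volume))
  exact (measurePreserving_cons (n := n) (Fin (n + 1) → ℝ)).comp ((hcons.prod hrows).comp
    (hre.comp (((MeasurePreserving.id volume).prod hC).prod (MeasurePreserving.id volume))))

/-- Conjugation by 1 ⊕ U acts separately on block and border, which allows diagonalizing the block
inside a unitarily invariant function. -/
theorem bord_conj (U : Matrix (Fin n) (Fin n) ℂ) (d : ℝ) (v : Fin n → ℂ)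
    (A : Matrix (Fin n) (Fin n) ℂ) :
    bord 1 0 U * bord d v A * (bord 1 0 U)ᴴ = bord d (v ᵥ* Uᴴ) (U * A * Uᴴ) := by
  ext i j
  refine Fin.cases ?_ (fun i => ?_) i <;> refine Fin.cases ?_ (fun j => ?_) j
  · simp [bord, mul_apply, Fin.sum_univ_succ]
  · simp [bord, mul_apply, Fin.sum_univ_succ, vecMul, dotProduct]
  · simp [bord, mul_apply, Fin.sum_univ_succ, vecMul, dotProduct, mul_comm]
  · simp [bord, mul_apply, Fin.sum_univ_succ]

theorem bord_one_zero_mul_conjTranspose {U : Matrix (Fin n) (Fin n) ℂ} (hU : U * Uᴴ = 1) :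
    bord 1 0 U * (bord 1 0 U)ᴴ = 1 := by
  have h := bord_conj U 1 0 1
  have h1 : bord 1 0 (1 : Matrix (Fin n) (Fin n) ℂ) = 1 := by
    ext i j
    refine Fin.cases ?_ (fun i => ?_) i <;> refine Fin.cases ?_ (fun j => ?_) j
    · simp [bord]
    · simp [bord, (Fin.succ_ne_zero j).symm]
    · simp [bord]
    · simp [bord, one_apply]
  rwa [h1, mul_one, mul_one, hU, zero_vecMul, h1] at h

theorem measurePreserving_vecMul {U : Matrix (Fin n) (Fin n) ℂ} (hU : U * Uᴴ = 1) :
    MeasurePreserving fun v : Fin n → ℂ => v ᵥ* U := by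
  have hsum : ∀ v : Fin n → ℂ, ∑ i, ‖(v ᵥ* U) i‖ ^ 2 = ∑ i, ‖v i‖ ^ 2 := by
    intro v
    have key : ∀ u : Fin n → ℂ, ((∑ i, ‖u i‖ ^ 2 : ℝ) : ℂ) = u ⬝ᵥ star u := by
      intro u
      simp [dotProduct, Complex.mul_conj, Complex.normSq_eq_norm_sq]
    have h : (v ᵥ* U) ⬝ᵥ star (v ᵥ* U) = v ⬝ᵥ star v := by
      rw [star_vecMul, ← dotProduct_mulVec, mulVec_mulVec, hU, one_mulVec]
    rw [← key, ← key] at h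
    exact_mod_cast h
  refine measurePreserving_of_preimage_eq volume ((vecMulLinear U).restrictScalars ℝ) ?_
    (B := {v : Fin n → ℂ | ∑ i, ‖v i‖ ^ 2 < 1}) (isOpen_lt (by fun_prop) continuous_const)
    ⟨0, by simp⟩ ?_ ?_
  · intro u v huv
    have h : u ᵥ* U = v ᵥ* U := huv
    have h2 := congrArg (fun w => w ᵥ* Uᴴ) h
    simpa [vecMul_vecMul, hU] using h2
  · rw [Metric.isBounded_iff_subset_closedBall 0]
    refine ⟨1, fun v hv => ?_⟩
    rw [mem_closedBall_zero_iff, pi_norm_le_iff_of_nonneg zero_le_one]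
    intro i
    have h1 : ‖v i‖ ^ 2 ≤ ∑ i, ‖v i‖ ^ 2 :=
      Finset.single_le_sum (f := fun i => ‖v i‖ ^ 2) (fun _ _ => sq_nonneg _) (Finset.mem_univ i)
    have h2 : ‖v i‖ ^ 2 < 1 := h1.trans_lt hv
    nlinarith [norm_nonneg (v i)]
  · ext v
    simp only [LinearMap.coe_restrictScalars, vecMulLinear_apply, Set.mem_preimage,
      Set.mem_ofPred_eq, hsum]

/-- The area in the plane in terms of the squared modulus. -/
theorem measurePreserving_pi_mul_norm_sq :
    MeasurePreserving (fun z : ℂ => Real.pi * ‖z‖ ^ 2) volume (volume.restrict (Set.Ioi 0)) := by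
  have hm : Measurable fun z : ℂ => Real.pi * ‖z‖ ^ 2 := by fun_prop
  refine ⟨hm, ?_⟩
  -- Preimages of half-lines are discs, so their measure is known from the area formula; differences
  -- of half-lines give the intervals that determine the measure.
  have hIio : ∀ b : ℝ, (Measure.map (fun z : ℂ => Real.pi * ‖z‖ ^ 2) volume) (Set.Iio b) =
      ENNReal.ofReal b := by
    intro b
    rw [Measure.map_apply hm measurableSet_Iio]
    have : (fun z : ℂ => Real.pi * ‖z‖ ^ 2) ⁻¹' Set.Iio b = Metric.ball 0 √(b / Real.pi) := by
      ext z
      rw [Set.mem_preimage, Set.mem_Iio, mem_ball_zero_iff, Real.lt_sqrt (norm_nonneg _),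
        lt_div_iff₀ Real.pi_pos, mul_comm]
    rw [this, Complex.volume_ball, ← ENNReal.ofReal_pow (by positivity)]
    rcases le_or_gt b 0 with hb | hb
    · rw [Real.sqrt_eq_zero_of_nonpos (div_nonpos_of_nonpos_of_nonneg hb Real.pi_pos.le),
        ENNReal.ofReal_of_nonpos hb]
      simp
    · rw [Real.sq_sqrt (by positivity), ← ENNReal.ofReal_coe_nnreal, ← ENNReal.ofReal_mul
        (by positivity), NNReal.coe_real_pi, div_mul_cancel₀ _ Real.pi_ne_zero]
  have hIic : ∀ a : ℝ, (Measure.map (fun z : ℂ => Real.pi * ‖z‖ ^ 2) volume) (Set.Iic a) =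
      ENNReal.ofReal a := by
    intro a
    rw [Measure.map_apply hm measurableSet_Iic]
    rcases le_or_gt 0 a with ha | ha
    · have : (fun z : ℂ => Real.pi * ‖z‖ ^ 2) ⁻¹' Set.Iic a =
          Metric.closedBall 0 √(a / Real.pi) := by
        ext z
        rw [Set.mem_preimage, Set.mem_Iic, mem_closedBall_zero_iff,
          Real.le_sqrt (norm_nonneg _) (by positivity), le_div_iff₀ Real.pi_pos, mul_comm]
      rw [this, Complex.volume_closedBall, ← ENNReal.ofReal_pow (by positivity),
        Real.sq_sqrt (by positivity), ← ENNReal.ofReal_coe_nnreal, ← ENNReal.ofReal_mul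
        (by positivity), NNReal.coe_real_pi, div_mul_cancel₀ _ Real.pi_ne_zero]
    · have : (fun z : ℂ => Real.pi * ‖z‖ ^ 2) ⁻¹' Set.Iic a = ∅ := by
        ext z
        simp only [Set.mem_preimage, Set.mem_Iic, Set.mem_empty_iff_false, iff_false, not_le]
        exact ha.trans_le (by positivity)
      rw [this, measure_empty, ENNReal.ofReal_of_nonpos ha.le]
  have : IsLocallyFiniteMeasure (Measure.map (fun z : ℂ => Real.pi * ‖z‖ ^ 2) volume) := by
    refine ⟨fun x => ⟨Set.Iio (x + 1), Iio_mem_nhds (by linarith), ?_⟩⟩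
    rw [hIio]; exact ENNReal.ofReal_lt_top
  refine Real.measure_ext_Ioo_rat fun a b => ?_
  have h1 : Set.Ioo (a : ℝ) b = Set.Iio (b : ℝ) \ Set.Iic (a : ℝ) := by
    ext; simp
  rcases le_or_gt (b : ℝ) a with hab | hab
  · rw [Set.Ioo_eq_empty (not_lt.2 hab), measure_empty, measure_empty]
  rw [Measure.restrict_apply measurableSet_Ioo, Set.Ioo_inter_Ioi, Real.volume_Ioo]
  rw [h1, measure_sdiff (Set.Iic_subset_Iio.2 hab) measurableSet_Iic.nullMeasurableSet
    (by rw [hIic]; exact ENNReal.ofReal_ne_top), hIio, hIic]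
  rcases le_or_gt (a : ℝ) 0 with ha | ha
  · rw [ENNReal.ofReal_of_nonpos ha]; simp [ha]
  · rw [← ENNReal.ofReal_sub _ ha.le]; simp [ha.le]

end BorderCoordinates

end FreeEntropy

namespace FreeEntropy

open Matrix MeasureTheory

/-! ### The Weyl integration formula, by induction on the size. -/

section Weyl

/-- Invariance of a function on matrices under unitary conjugation. -/
def UnitInv {n : ℕ} (F : Matrix (Fin n) (Fin n) ℂ → ℝ≥0∞) : Prop :=
  ∀ U : Matrix (Fin n) (Fin n) ℂ, U * Uᴴ = 1 → ∀ A, F (U * A * Uᴴ) = F A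

variable {n : ℕ}

theorem UnitInv.bord_vecMul {F : Matrix (Fin (n + 1)) (Fin (n + 1)) ℂ → ℝ≥0∞} (hF : UnitInv F)
    {U : Matrix (Fin n) (Fin n) ℂ} (hU : U * Uᴴ = 1) (d : ℝ) (v : Fin n → ℂ)
    (A : Matrix (Fin n) (Fin n) ℂ) : F (bord d v (U * A * Uᴴ)) = F (bord d (v ᵥ* U) A) := by
  rw [← hF _ (bord_one_zero_mul_conjTranspose hU) (bord d (v ᵥ* U) A), bord_conj, vecMul_vecMul,
    hU, vecMul_one]

theorem UnitInv.bord_norm {F : Matrix (Fin (n + 1)) (Fin (n + 1)) ℂ → ℝ≥0∞} (hF : UnitInv F)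
    (d : ℝ) (v : Fin n → ℂ) (x : Fin n → ℝ) :
    F (bord d v (diagMat x)) = F (bord d (fun i => (‖v i‖ : ℂ)) (diagMat x)) := by
  -- Phases that turn v i into its modulus. The diagonal unitary they form commutes with the
  -- diagonal block.
  set p : Fin n → ℂ := fun i => if v i = 0 then 1 else star (v i) / ‖v i‖ with hp
  have hpp : ∀ i, p i * star (p i) = 1 := by
    intro i
    simp only [hp]
    split_ifs with h
    · simp
    · have h1 : (‖v i‖ : ℂ) ≠ 0 := by simpa using h
      simp only [star_div₀, RCLike.star_def, Complex.conj_ofReal, Complex.conj_conj]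
      have h2 : (starRingEnd ℂ) (v i) * v i = ‖v i‖ ^ 2 := by
        rw [mul_comm, Complex.mul_conj, Complex.normSq_eq_norm_sq]; simp
      rw [div_mul_div_comm, h2]
      field_simp
  have hvp : ∀ i, v i * p i = ‖v i‖ := by
    intro i
    simp only [hp]
    split_ifs with h
    · simp [h]
    · have h1 : (‖v i‖ : ℂ) ≠ 0 := by simpa using h
      have h2 : v i * star (v i) = ‖v i‖ ^ 2 := by
        rw [RCLike.star_def, Complex.mul_conj, Complex.normSq_eq_norm_sq]; simp
      rw [← mul_div_assoc, h2]
      field_simp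
  have hU : diagonal p * (diagonal p)ᴴ = 1 := by
    rw [diagonal_conjTranspose, diagonal_mul_diagonal, ← diagonal_one]
    congr 1
    funext i
    exact hpp i
  have hD : diagonal p * diagMat x * (diagonal p)ᴴ = diagMat x := by
    rw [diagonal_conjTranspose, diagMat, diagonal_mul_diagonal, diagonal_mul_diagonal]
    congr 1
    funext i
    rw [mul_right_comm, Pi.star_apply, hpp, one_mul]
  have h := hF.bord_vecMul hU d v (diagMat x)
  rw [hD] at h
  rw [h]
  congr 2
  funext i
  rw [vecMul_diagonal, hvp]

/-- Integration of a function over the borders of a matrix. -/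
noncomputable def borderInt (F : Matrix (Fin (n + 1)) (Fin (n + 1)) ℂ → ℝ≥0∞)
    (A : Matrix (Fin n) (Fin n) ℂ) : ℝ≥0∞ :=
  ∫⁻ d : ℝ, ∫⁻ v : Fin n → ℂ, F (bord (√2 * d) v A)

/-- The coordinates of a diagonal matrix. -/
noncomputable def diagCoord (x : Fin n → ℝ) : Fin n → Fin n → ℝ :=
  fun i j => if i = j then x i / √2 else 0

theorem hermU_diagCoord (x : Fin n → ℝ) : hermU (diagCoord x) = diagMat x := by
  ext i j
  have h2 : √(2 : ℝ) ≠ 0 := by positivity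
  simp only [hermU, diagCoord, diagMat, of_apply, diagonal_apply]
  by_cases h : i = j
  · subst h; simp only [if_true]; rw [mul_div_cancel₀ _ h2]
  · simp only [if_neg h, if_neg (Ne.symm h)]
    split_ifs <;> simp [Complex.ext_iff]

theorem measurable_diagCoord : Measurable (diagCoord (n := n)) := by
  refine measurable_pi_lambda _ fun i => measurable_pi_lambda _ fun j => ?_
  unfold diagCoord
  split_ifs
  · exact (measurable_pi_apply i).div_const _
  · exact measurable_const

theorem measurable_comp_diagMat {F : Matrix (Fin n) (Fin n) ℂ → ℝ≥0∞}
    (hF : Measurable fun c => F (hermU c)) : Measurable fun x => F (diagMat x) := by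
  have := hF.comp measurable_diagCoord
  simpa only [Function.comp_def, hermU_diagCoord] using this

variable {F : Matrix (Fin (n + 1)) (Fin (n + 1)) ℂ → ℝ≥0∞}

theorem measurable_bord (hF : Measurable fun c => F (hermU c)) :
    Measurable fun p : (ℝ × (Fin n → ℂ)) × (Fin n → Fin n → ℝ) =>
      F (bord (√2 * p.1.1) p.1.2 (hermU p.2)) := by
  have := hF.comp measurePreserving_comb.measurable
  simpa only [Function.comp_def, ← hermU_comb] using this

theorem borderInt_eq (hF : Measurable fun c => F (hermU c)) (c : Fin n → Fin n → ℝ) :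
    borderInt F (hermU c) = ∫⁻ p : ℝ × (Fin n → ℂ), F (bord (√2 * p.1) p.2 (hermU c)) := by
  have hm : Measurable fun p : ℝ × (Fin n → ℂ) => F (bord (√2 * p.1) p.2 (hermU c)) :=
    (measurable_bord hF).comp (measurable_prodMk_right (y := c))
  exact (lintegral_prod _ hm.aemeasurable).symm

theorem measurable_borderInt (hF : Measurable fun c => F (hermU c)) :
    Measurable fun c : Fin n → Fin n → ℝ => borderInt F (hermU c) := by
  simp only [borderInt_eq hF]
  exact (measurable_bord hF).lintegral_prod_left'

theorem lintegral_hermU_succ (hF : Measurable fun c => F (hermU c)) :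
    ∫⁻ c : Fin (n + 1) → Fin (n + 1) → ℝ, F (hermU c) =
      ∫⁻ c : Fin n → Fin n → ℝ, borderInt F (hermU c) := by
  rw [← measurePreserving_comb.lintegral_comp hF]
  simp only [borderInt_eq hF]
  rw [Measure.volume_eq_prod, lintegral_prod_symm' _ (by
    have := hF.comp measurePreserving_comb.measurable
    exact this)]
  refine lintegral_congr fun c => lintegral_congr fun p => ?_
  rw [← hermU_comb]

/-- The unitary is moved from the block to the border vector, where v ↦ vU preserves Lebesgue
measure. -/
theorem UnitInv.borderInt (hF : UnitInv F) : UnitInv (borderInt F) := by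
  intro U hU A
  refine lintegral_congr fun d => ?_
  simp only [hF.bord_vecMul hU]
  have h := measurePreserving_vecMul hU
  have hinj : Function.Injective fun v : Fin n → ℂ => v ᵥ* U := by
    intro u v huv
    have h2 := congrArg (fun w => w ᵥ* Uᴴ) huv
    simpa [vecMul_vecMul, hU] using h2
  have hemb : MeasurableEmbedding fun v : Fin n → ℂ => v ᵥ* U :=
    (vecMulLinear U).continuous_of_finiteDimensional.measurableEmbedding hinj
  exact h.lintegral_comp_emb hemb fun v => F (bord (√2 * d) v A)

/-- Only the moduli of the border entries matter, and t = π|v|² carries the area of the plane to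
length on the half-line. The change of variables `borderMap` then replaces the border by the
spectrum y of the bordered matrix. -/
theorem borderInt_diagMat (hF : Measurable fun c => F (hermU c)) (hFU : UnitInv F)
    {x : Fin n → ℝ} (hx : StrictMono x) :
    borderInt F (diagMat x) = ∫⁻ y in {y | Interlace x y},
      ENNReal.ofReal (Real.pi ^ n / √2 * (vprod y / vprod x)) * F (diagMat y) := by
  set h : ℝ × (Fin n → ℝ) → ℝ≥0∞ := fun p =>
    F (bord (√2 * p.1) (fun i => ((√(p.2 i / Real.pi) : ℝ) : ℂ)) (diagMat x)) with hh
  have hmeas : Measurable h := by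
    have h1 : Measurable fun p : ℝ × (Fin n → ℝ) =>
        (((p.1, fun i => ((√(p.2 i / Real.pi) : ℝ) : ℂ)), diagCoord x) :
          (ℝ × (Fin n → ℂ)) × (Fin n → Fin n → ℝ)) := by fun_prop
    have := (measurable_bord hF).comp h1
    simpa only [Function.comp_def, hermU_diagCoord] using this
  set S : Set (Fin n → ℝ) := Set.univ.pi fun _ => Set.Ioi 0 with hS
  have hSm : MeasurableSet S := MeasurableSet.univ_pi fun _ => measurableSet_Ioi
  have hres : (Measure.pi fun _ : Fin n => (volume : Measure ℝ).restrict (Set.Ioi 0)) =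
      (volume : Measure (Fin n → ℝ)).restrict S := by
    rw [volume_pi, Measure.restrict_pi_pi]
  have hmp := measurePreserving_pi (fun _ : Fin n => (volume : Measure ℂ)) _
    (fun _ : Fin n => measurePreserving_pi_mul_norm_sq)
  rw [hres, ← volume_pi] at hmp
  have e1 : borderInt F (diagMat x) = ∫⁻ d : ℝ, ∫⁻ t in S, h (d, t) := by
    refine lintegral_congr fun d => ?_
    rw [← hmp.lintegral_comp (f := fun t => h (d, t)) (hmeas.comp measurable_prodMk_left)]
    refine lintegral_congr fun v => ?_
    rw [hFU.bord_norm]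
    simp only [hh]
    congr 2
    funext i
    rw [mul_div_cancel_left₀ _ Real.pi_ne_zero, Real.sqrt_sq (norm_nonneg _)]
  set T : Set (Fin (n + 1) → ℝ) := {t | ∀ i : Fin n, 0 < t i.succ} with hT
  have hTm : MeasurableSet T := by
    have : T = ⋂ i : Fin n, {t : Fin (n + 1) → ℝ | 0 < t i.succ} := by ext; simp [hT]
    rw [this]
    exact MeasurableSet.iInter fun i => measurableSet_lt measurable_const (measurable_pi_apply _)
  have hsplit : Measurable fun t : Fin (n + 1) → ℝ => (t 0, fun i : Fin n => t i.succ) := by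
    fun_prop
  have e2 : ∫⁻ d : ℝ, ∫⁻ t in S, h (d, t) =
      ∫⁻ t in T, h (t 0, fun i => t i.succ) := by
    rw [← (measurePreserving_cons (n := n) ℝ).setLIntegral_comp_preimage hTm
      (f := fun t => h (t 0, fun i => t i.succ)) (hmeas.comp hsplit)]
    have hpre : (fun p : ℝ × (Fin n → ℝ) => (Fin.cons p.1 p.2 : Fin (n + 1) → ℝ)) ⁻¹' T =
        Set.univ ×ˢ S := by
      ext p
      simp [hT, hS]
    rw [hpre, Measure.volume_eq_prod, ← Measure.prod_restrict, Measure.restrict_univ,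
      lintegral_prod _ (by simpa using hmeas.aemeasurable)]
    simp
  rw [e1, e2, lintegral_border_eq hx (fun t => h (t 0, fun i => t i.succ))]
  refine setLIntegral_congr_fun (measurableSet_interlace_right x) fun y hy => ?_
  obtain ⟨U, hU, hUy⟩ := exists_unitary_bord hy
  have h2 : √(2 : ℝ) ≠ 0 := by positivity
  have e3 : h (borderMap x y 0, fun i : Fin n => borderMap x y i.succ) = F (diagMat y) := by
    rw [← hFU U hU, ← hUy]
    simp only [hh, borderMap, Fin.cases_zero, Fin.cases_succ, mul_div_cancel₀ _ h2,
      mul_div_cancel_left₀ _ Real.pi_ne_zero]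
  simp only [e3]

/-- The constant in the Weyl integration formula. -/
noncomputable def weylConst : ℕ → ℝ
  | 0 => 1
  | n + 1 => weylConst n * (Real.pi ^ n / √2 / n.factorial)

theorem weylConst_pos (n : ℕ) : 0 < weylConst n := by
  induction n with
  | zero => exact one_pos
  | succ n ih => rw [weylConst]; positivity

theorem measurableSet_interlace : MeasurableSet {p : (Fin n → ℝ) × (Fin (n + 1) → ℝ) |
    Interlace p.1 p.2} := by
  have : {p : (Fin n → ℝ) × (Fin (n + 1) → ℝ) | Interlace p.1 p.2} =
      ⋂ i, ({p | p.2 (Fin.castSucc i) < p.1 i} ∩ {p | p.1 i < p.2 (Fin.succ i)}) := by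
    ext y; simp [Interlace]
  rw [this]
  exact MeasurableSet.iInter fun i => (measurableSet_lt (by fun_prop) (by fun_prop)).inter
    (measurableSet_lt (by fun_prop) (by fun_prop))

theorem measurableSet_strictMono : MeasurableSet {y : Fin n → ℝ | StrictMono y} := by
  have : {y : Fin n → ℝ | StrictMono y} = ⋂ i, ⋂ j, {y | i < j → y i < y j} := by
    ext y; simp [StrictMono]
  rw [this]
  refine MeasurableSet.iInter fun i => MeasurableSet.iInter fun j => ?_
  by_cases hij : i < j
  · simpa [hij] using measurableSet_lt (measurable_pi_apply i) (measurable_pi_apply j)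
  · simp [hij]

theorem measurable_vprod : Measurable (vprod (n := n)) := continuous_vprod.measurable

/-- Integration over interlacing pairs, performed in the two orders. -/
theorem lintegral_interlace {f : (Fin (n + 1) → ℝ) → ℝ≥0∞} (hf : Measurable f) :
    ∫⁻ x in {x : Fin n → ℝ | StrictMono x}, ENNReal.ofReal (vprod x ^ 2) *
        ∫⁻ y in {y | Interlace x y},
          ENNReal.ofReal (Real.pi ^ n / √2 * (vprod y / vprod x)) * f y =
      ENNReal.ofReal (Real.pi ^ n / √2 / n.factorial) *
        ∫⁻ y in {y | StrictMono y}, ENNReal.ofReal (vprod y ^ 2) * f y := by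
  set K : ℝ := Real.pi ^ n / √2 with hK
  have hK0 : 0 < K := by positivity
  set I : Set ((Fin n → ℝ) × (Fin (n + 1) → ℝ)) := {p | Interlace p.1 p.2} with hI
  -- The density on interlacing pairs. One factor `vprod x` has cancelled against the Jacobian; the
  -- other is integrated over the box between the y i and produces a second factor `vprod y`.
  set Ψ : (Fin n → ℝ) × (Fin (n + 1) → ℝ) → ℝ≥0∞ := I.indicator fun p =>
    ENNReal.ofReal (vprod p.1) * (ENNReal.ofReal (K * vprod p.2) * f p.2) with hΨ
  have hΨm : Measurable Ψ := by
    refine Measurable.indicator ?_ measurableSet_interlace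
    have h1 : Measurable fun p : (Fin n → ℝ) × (Fin (n + 1) → ℝ) => vprod p.1 :=
      measurable_vprod.comp measurable_fst
    have h2 : Measurable fun p : (Fin n → ℝ) × (Fin (n + 1) → ℝ) => vprod p.2 :=
      measurable_vprod.comp measurable_snd
    exact h1.ennreal_ofReal.mul (((h2.const_mul K).ennreal_ofReal).mul (hf.comp measurable_snd))
  have e1 : ∀ x : Fin n → ℝ, {x : Fin n → ℝ | StrictMono x}.indicator (fun x =>
      ENNReal.ofReal (vprod x ^ 2) * ∫⁻ y in {y | Interlace x y},
        ENNReal.ofReal (K * (vprod y / vprod x)) * f y) x = ∫⁻ y, Ψ (x, y) := by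
    intro x
    by_cases hx : StrictMono x
    · rw [Set.indicator_of_mem (by exact hx), ← lintegral_const_mul' _ _ ENNReal.ofReal_ne_top,
        ← lintegral_indicator (measurableSet_interlace_right x)]
      refine lintegral_congr fun y => ?_
      by_cases hy : Interlace x y
      · rw [Set.indicator_of_mem (by exact hy), hΨ, Set.indicator_of_mem (by exact hy),
          ← mul_assoc, ← mul_assoc, ← ENNReal.ofReal_mul (sq_nonneg _),
          ← ENNReal.ofReal_mul (vprod_pos hx).le]
        congr 2
        have := (vprod_pos hx).ne'
        field_simp
      · rw [Set.indicator_of_notMem (by exact hy), hΨ, Set.indicator_of_notMem (by exact hy)]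
    · rw [Set.indicator_of_notMem (by exact hx)]
      symm
      rw [← lintegral_zero (α := Fin (n + 1) → ℝ) (μ := volume)]
      refine lintegral_congr fun y => ?_
      rw [hΨ, Set.indicator_of_notMem]
      exact fun h : Interlace x y => hx h.strictMono_left
  have e2 : ∀ y : Fin (n + 1) → ℝ, ∫⁻ x, Ψ (x, y) = {y : Fin (n + 1) → ℝ | StrictMono y}.indicator
      (fun y => ENNReal.ofReal (K / n.factorial) * (ENNReal.ofReal (vprod y ^ 2) * f y)) y := by
    intro y
    by_cases hy : StrictMono y
    · rw [Set.indicator_of_mem (by exact hy)]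
      set B : Set (Fin n → ℝ) := Set.univ.pi fun i : Fin n =>
        Set.Ioo (y i.castSucc) (y i.succ) with hB
      have hBm : MeasurableSet B := MeasurableSet.univ_pi fun _ => measurableSet_Ioo
      have h1 : ∀ x, Ψ (x, y) = B.indicator (fun x => ENNReal.ofReal (vprod x)) x *
          (ENNReal.ofReal (K * vprod y) * f y) := by
        intro x
        have hiff : x ∈ B ↔ Interlace x y := by simp [hB, Interlace]
        by_cases hxy : Interlace x y
        · rw [hΨ, Set.indicator_of_mem (by exact hxy), Set.indicator_of_mem (hiff.2 hxy)]
        · rw [hΨ, Set.indicator_of_notMem (by exact hxy),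
            Set.indicator_of_notMem (fun h => hxy (hiff.1 h)), zero_mul]
      simp only [h1]
      rw [lintegral_mul_const _ (measurable_vprod.ennreal_ofReal.indicator hBm),
        lintegral_indicator hBm, lintegral_box_vprod hy, ← mul_assoc, ← mul_assoc,
        ← ENNReal.ofReal_mul (div_nonneg (vprod_pos hy).le (by positivity)),
        ← ENNReal.ofReal_mul (by positivity)]
      congr 2
      ring
    · rw [Set.indicator_of_notMem (by exact hy)]
      rw [← lintegral_zero (α := Fin n → ℝ) (μ := volume)]
      refine lintegral_congr fun x => ?_
      rw [hΨ, Set.indicator_of_notMem]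
      exact fun h : Interlace x y => hy h.strictMono_right
  rw [← lintegral_indicator measurableSet_strictMono, lintegral_congr e1,
    lintegral_lintegral_swap (f := fun x y => Ψ (x, y)) hΨm.aemeasurable, lintegral_congr e2,
    lintegral_indicator measurableSet_strictMono,
    lintegral_const_mul' _ _ ENNReal.ofReal_ne_top]

/-- The Weyl integration formula for selfadjoint matrices. -/
theorem lintegral_hermU (n : ℕ) (F : Matrix (Fin n) (Fin n) ℂ → ℝ≥0∞)
    (hF : Measurable fun c => F (hermU c)) (hFU : UnitInv F) :
    ∫⁻ c, F (hermU c) = ENNReal.ofReal (weylConst n) *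
      ∫⁻ y in {y | StrictMono y}, ENNReal.ofReal (vprod y ^ 2) * F (diagMat y) := by
  induction n with
  | zero =>
    have h1 : {y : Fin 0 → ℝ | StrictMono y} = Set.univ := by
      ext y; simp [Subsingleton.strictMono]
    have h2 : ∀ A : Matrix (Fin 0) (Fin 0) ℂ, F A = F 0 := fun A => by
      rw [Subsingleton.elim A 0]
    rw [h1, Measure.restrict_univ]
    simp [h2, weylConst, vprod, volume_pi]
  | succ n ih =>
    rw [lintegral_hermU_succ hF, ih _ (measurable_borderInt hF) hFU.borderInt, weylConst,
      ENNReal.ofReal_mul (weylConst_pos n).le, mul_assoc,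
      ← lintegral_interlace (measurable_comp_diagMat hF)]
    congr 1
    refine setLIntegral_congr_fun measurableSet_strictMono fun x hx => ?_
    simp only [borderInt_diagMat hF hFU hx]

end Weyl

end FreeEntropy

namespace FreeEntropy

open Matrix MeasureTheory

/-! ### Growth of the constant in the Weyl formula. -/

section WeylAsymptotics

open Filter Topology Asymptotics

theorem log_weylConst_succ (n : ℕ) : Real.log (weylConst (n + 1)) = Real.log (weylConst n) +
    (n * Real.log Real.pi - Real.log 2 / 2 - Real.log n.factorial) := by
  have h1 := weylConst_pos n
  have h2 : (0 : ℝ) < n.factorial := by exact_mod_cast n.factorial_pos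
  rw [weylConst, Real.log_mul h1.ne' (by positivity), Real.log_div (by positivity) h2.ne',
    Real.log_div (by positivity) (by positivity), Real.log_pow, Real.log_sqrt (by positivity)]

/-- The increment of log `weylConst` j + (j²/2) log j divided by the increment 2j + 1 of j²:
Stirling's formula for the increments, to be summed as in the Stolz–Cesàro theorem. -/
theorem tendsto_weyl_increment : Tendsto (fun j : ℕ =>
    ((j * Real.log Real.pi - Real.log 2 / 2 - Real.log j.factorial) +
      (((j + 1 : ℕ) : ℝ) ^ 2 / 2 * Real.log ((j + 1 : ℕ) : ℝ) - (j : ℝ) ^ 2 / 2 * Real.log j)) /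
        (2 * j + 1)) atTop (𝓝 (Real.log Real.pi / 2 + 3 / 4)) := by
  have hs : Tendsto (fun j : ℕ => Real.log (Stirling.stirlingSeq j)) atTop
      (𝓝 (Real.log √Real.pi)) :=
    Stirling.tendsto_stirlingSeq_sqrt_pi.log (by positivity)
  have hi : Tendsto (fun j : ℕ => ((j : ℝ))⁻¹) atTop (𝓝 0) := tendsto_inv_atTop_nhds_zero_nat
  have hl : Tendsto (fun j : ℕ => (j : ℝ) * Real.log (1 + 1 / (j : ℝ))) atTop (𝓝 1) :=
    (Real.tendsto_mul_log_one_add_div_atTop 1).comp tendsto_natCast_atTop_atTop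
  have hmain : Tendsto (fun j : ℕ => ((Real.log Real.pi + 1) + (j : ℝ)⁻¹ * (- Real.log 2 -
      Real.log (Stirling.stirlingSeq j)) + (1 + (j : ℝ)⁻¹) ^ 2 / 2 *
        ((j : ℝ) * Real.log (1 + 1 / (j : ℝ)))) / (2 + (j : ℝ)⁻¹)) atTop
      (𝓝 (((Real.log Real.pi + 1) + 0 * (- Real.log 2 - Real.log √Real.pi) +
        (1 + 0) ^ 2 / 2 * 1) / (2 + 0))) := by
    refine Tendsto.div ?_ (tendsto_const_nhds.add hi) (by norm_num)
    exact (tendsto_const_nhds.add (hi.mul (tendsto_const_nhds.sub hs))).add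
      ((((tendsto_const_nhds.add hi).pow 2).div_const 2).mul hl)
  have e : (((Real.log Real.pi + 1) + 0 * (- Real.log 2 - Real.log √Real.pi) +
        (1 + 0) ^ 2 / 2 * 1) / (2 + 0)) = Real.log Real.pi / 2 + 3 / 4 := by ring
  rw [e] at hmain
  refine hmain.congr' ?_
  filter_upwards [eventually_gt_atTop 0] with j hj
  have hj' : (0 : ℝ) < j := by exact_mod_cast hj
  have h1 := Stirling.log_stirlingSeq_formula j
  rw [Real.log_mul (by norm_num) hj'.ne', Real.log_div hj'.ne' (Real.exp_pos 1).ne',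
    Real.log_exp] at h1
  have h2 : Real.log (1 + 1 / (j : ℝ)) = Real.log ((j + 1 : ℕ) : ℝ) - Real.log j := by
    rw [← Real.log_div (by positivity) hj'.ne']
    congr 1
    push_cast
    field_simp
  have h3 : Real.log (j.factorial : ℝ) = Real.log (Stirling.stirlingSeq j) +
      1 / 2 * (Real.log 2 + Real.log j) + j * (Real.log j - 1) := by linarith
  rw [h2, h3]
  push_cast
  field_simp
  ring

theorem tendsto_log_weylConst : Tendsto (fun k : ℕ =>
    ((k : ℝ) ^ 2)⁻¹ * (Real.log (weylConst k) + (k : ℝ) ^ 2 / 2 * Real.log k)) atTop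
    (𝓝 (Real.log Real.pi / 2 + 3 / 4)) := by
  set L := Real.log Real.pi / 2 + 3 / 4
  set d : ℕ → ℝ := fun j => (j * Real.log Real.pi - Real.log 2 / 2 - Real.log j.factorial) +
      (((j + 1 : ℕ) : ℝ) ^ 2 / 2 * Real.log ((j + 1 : ℕ) : ℝ) - (j : ℝ) ^ 2 / 2 * Real.log j)
    with hd
  have hsum : ∀ k : ℕ, ∑ j ∈ Finset.range k, d j =
      Real.log (weylConst k) + (k : ℝ) ^ 2 / 2 * Real.log k := by
    intro k
    induction k with
    | zero => simp [weylConst]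
    | succ k ih => rw [Finset.sum_range_succ, ih, log_weylConst_succ, hd]; ring
  have hg : ∀ k : ℕ, ∑ j ∈ Finset.range k, (2 * (j : ℝ) + 1) = (k : ℝ) ^ 2 := by
    intro k
    induction k with
    | zero => simp
    | succ k ih => rw [Finset.sum_range_succ, ih]; push_cast; ring
  have hlo : (fun j : ℕ => d j - L * (2 * (j : ℝ) + 1)) =o[atTop]
      fun j : ℕ => 2 * (j : ℝ) + 1 := by
    refine isLittleO_of_tendsto (fun j hj => absurd hj (by positivity)) ?_
    have := tendsto_weyl_increment.sub_const L
    rw [sub_self] at this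
    refine this.congr fun j => ?_
    have : 2 * (j : ℝ) + 1 ≠ 0 := by positivity
    rw [sub_div, mul_div_cancel_right₀ _ this]
  have hkk : Tendsto (fun k : ℕ => (k : ℝ) ^ 2) atTop atTop :=
    (tendsto_pow_atTop two_ne_zero).comp tendsto_natCast_atTop_atTop
  have h := hlo.sum_range (fun j => by positivity) (by simpa only [hg] using hkk)
  simp only [Finset.sum_sub_distrib, ← Finset.mul_sum, hg, hsum] at h
  have h2 := h.tendsto_div_nhds_zero.add_const L
  rw [zero_add] at h2
  refine h2.congr' ?_
  filter_upwards [eventually_gt_atTop 0] with k hk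
  have : (k : ℝ) ≠ 0 := by exact_mod_cast hk.ne'
  field_simp
  ring

/-- The constant in the integration formula over the spectrum of selfadjoint `k × k` matrices with
normalized Euclidean norm. -/
noncomputable def specConst (k : ℕ) : ℝ := weylConst k * (√((k : ℝ) / 2) ^ (k ^ 2))⁻¹

theorem specConst_pos {k : ℕ} (hk : 0 < k) : 0 < specConst k := by
  have : (0 : ℝ) < k := by exact_mod_cast hk
  exact mul_pos (weylConst_pos k) (by positivity)

/-- The power of √(k/2) in `specConst` turns (log k)/2 into log k. Only the existence of a finite
limit matters later, since its value cancels between two sizes. -/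
theorem tendsto_log_specConst : Tendsto (fun k : ℕ =>
    ((k : ℝ) ^ 2)⁻¹ * Real.log (specConst k) + Real.log k) atTop
    (𝓝 (Real.log Real.pi / 2 + 3 / 4 + Real.log 2 / 2)) := by
  refine (tendsto_log_weylConst.add_const (Real.log 2 / 2)).congr' ?_
  filter_upwards [eventually_gt_atTop 0] with k hk
  have hk' : (0 : ℝ) < k := by exact_mod_cast hk
  rw [specConst, Real.log_mul (weylConst_pos k).ne' (by positivity), Real.log_inv, Real.log_pow,
    Real.log_sqrt (by positivity), Real.log_div hk'.ne' (by norm_num)]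
  push_cast
  field_simp
  ring

end WeylAsymptotics

/-! ### One-variable microstate volumes as integrals over spectra. -/

section Spectrum

variable {M : Type*} [CStarAlgebra M] {φ : M →ₗ[ℂ] ℂ} {a : M} {k : ℕ}

theorem vprod_smul (s : ℝ) (l : Fin k → ℝ) :
    vprod (s • l) = s ^ (k * (k - 1) / 2) * vprod l := by
  have h : ∑ i : Fin k, (Finset.Ioi i).card = k * (k - 1) / 2 := by
    simp only [Fin.card_Ioi]
    rw [← Finset.sum_range_id_mul_two, Nat.mul_div_cancel _ two_pos,
      ← Finset.sum_range_reflect, ← Fin.sum_univ_eq_sum_range]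
  simp only [vprod, Pi.smul_apply, smul_eq_mul, ← mul_sub, Finset.prod_mul_distrib,
    Finset.prod_const, Finset.prod_pow_eq_pow_sum]
  rw [h]

theorem strictMono_smul_iff {s : ℝ} (hs : 0 < s) {l : Fin k → ℝ} :
    StrictMono (s • l) ↔ StrictMono l :=
  ⟨fun h _ _ hij => lt_of_mul_lt_mul_left (h hij) hs.le,
    fun h _ _ hij => mul_lt_mul_of_pos_left (h hij) hs⟩

/-- The increasing families of reals with moments close to those of `a`. -/
def specSet (φ : M →ₗ[ℂ] ℂ) (a : M) (m k : ℕ) (γ : ℝ) : Set (Fin k → ℝ) :=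
  {l | StrictMono l ∧ MomentsNear (moment φ a) m γ l}

theorem measurableSet_specSet (m : ℕ) (γ : ℝ) : MeasurableSet (specSet φ a m k γ) := by
  have : specSet φ a m k γ = {l : Fin k → ℝ | StrictMono l} ∩
      ⋂ p : ℕ, ⋂ (_ : 1 ≤ p), ⋂ (_ : p ≤ m), {l | |empMoment l p - moment φ a p| < γ} := by
    ext l; simp [specSet, MomentsNear]
  rw [this]
  refine measurableSet_strictMono.inter (MeasurableSet.iInter fun p =>
    MeasurableSet.iInter fun _ => MeasurableSet.iInter fun _ =>
    measurableSet_lt ?_ measurable_const)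
  unfold empMoment
  fun_prop

/-- The volume of a microstate space of one element as an integral over spectra. -/
theorem vol_microstates_single_eq (hφ : IsTracialState φ) (ha : IsSelfAdjoint a) (m : ℕ) (γ : ℝ)
    (hk : 0 < k) : vol (microstates φ (single a) m k γ) = ENNReal.ofReal (specConst k) *
      ∫⁻ l in specSet φ a m k γ, ENNReal.ofReal (vprod l ^ 2) := by
  have hk' : (0 : ℝ) < k := by exact_mod_cast hk
  set s := √((k : ℝ) / 2) with hs
  have hs0 : 0 < s := by positivity
  set S : Set (Matrix (Fin k) (Fin k) ℂ) :=
    {A | (fun _ : Unit => s • A) ∈ microstates φ (single a) m k γ} with hS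
  set F : Matrix (Fin k) (Fin k) ℂ → ℝ≥0∞ := S.indicator 1 with hF
  have hFU : ∀ c : Fin k → Fin k → ℝ, F (hermU c) = (singleCoord φ a m k γ).indicator 1 c := by
    intro c
    have : hermU c ∈ S ↔ c ∈ singleCoord φ a m k γ := by
      rw [hS, singleCoord, Set.mem_ofPred_eq, Set.mem_ofPred_eq, hermOfCoord_eq_smul]
    by_cases h : c ∈ singleCoord φ a m k γ
    · rw [hF, Set.indicator_of_mem h, Set.indicator_of_mem (this.2 h)]; rfl
    · rw [hF, Set.indicator_of_notMem h, Set.indicator_of_notMem (mt this.1 h)]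
  have hmeas := measurableSet_singleCoord (φ := φ) (a := a) (k := k) m γ
  have hinv : UnitInv F := by
    intro U hU A
    have : U * A * Uᴴ ∈ S ↔ A ∈ S := by
      have h := conj_mem_microstates_iff (φ := φ) (x := single a) (m := m) (γ := γ)
        (A := fun _ : Unit => s • A) hU
      simp only [Matrix.mul_smul, Matrix.smul_mul] at h
      exact h
    by_cases h : A ∈ S
    · rw [hF, Set.indicator_of_mem h, Set.indicator_of_mem (this.2 h)]; rfl
    · rw [hF, Set.indicator_of_notMem h, Set.indicator_of_notMem (mt this.1 h)]
  have hm : Measurable fun c : Fin k → Fin k → ℝ => F (hermU c) := by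
    simp only [hFU]
    exact measurable_one.indicator hmeas
  have hdiag : ∀ y : Fin k → ℝ, diagMat y ∈ S ↔ MomentsNear (moment φ a) m γ (s • y) := by
    intro y
    rw [← diagMat_mem_microstates_single hφ ha, hS, Set.mem_ofPred_eq]
    have : s • diagMat y = diagMat (s • y) := by
      ext i j
      by_cases h : i = j <;> simp [diagMat, h]
    rw [this]
  have hW := lintegral_hermU k F hm hinv
  simp only [hFU] at hW
  rw [lintegral_indicator_one hmeas, ← vol_microstates_single] at hW
  rw [hW]
  have hspec := measurableSet_specSet (φ := φ) (a := a) (k := k) m γ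
  set g : (Fin k → ℝ) → ℝ≥0∞ := (specSet φ a m k γ).indicator
    fun l => ENNReal.ofReal (vprod (s⁻¹ • l) ^ 2) with hg
  have e1 : ∀ y : Fin k → ℝ, {y : Fin k → ℝ | StrictMono y}.indicator
      (fun y => ENNReal.ofReal (vprod y ^ 2) * F (diagMat y)) y = g (s • y) := by
    intro y
    by_cases h1 : StrictMono y
    · rw [Set.indicator_of_mem (by exact h1)]
      by_cases h2 : diagMat y ∈ S
      · rw [hg, Set.indicator_of_mem (by exact ⟨(strictMono_smul_iff hs0).2 h1, (hdiag y).1 h2⟩),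
          hF, Set.indicator_of_mem h2, inv_smul_smul₀ hs0.ne']
        simp
      · rw [hg, Set.indicator_of_notMem (by exact fun h => h2 ((hdiag y).2 h.2)),
          hF, Set.indicator_of_notMem h2, mul_zero]
    · rw [Set.indicator_of_notMem (by exact h1), hg,
        Set.indicator_of_notMem (by exact fun h => h1 ((strictMono_smul_iff hs0).1 h.1))]
  have e2 : ∫⁻ y : Fin k → ℝ, g (s • y) = ENNReal.ofReal ((s ^ k)⁻¹) * ∫⁻ y, g y := by
    have h1 := (MeasurableEquiv.smul (Units.mk0 s hs0.ne')).measurableEmbedding.lintegral_map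
      (μ := (volume : Measure (Fin k → ℝ))) g
    have h2 := Measure.map_addHaar_smul (volume : Measure (Fin k → ℝ)) hs0.ne'
    have h3 : ⇑(MeasurableEquiv.smul (Units.mk0 s hs0.ne') : (Fin k → ℝ) ≃ᵐ (Fin k → ℝ)) =
      fun y => s • y := rfl
    simp only [h3] at h1
    rw [h2, lintegral_smul_measure, Module.finrank_fintype_fun_eq_card, Fintype.card_fin,
      abs_of_pos (by positivity)] at h1
    exact h1.symm
  have e3 : ∫⁻ y, g y = ENNReal.ofReal (((s ^ (k * (k - 1) / 2))⁻¹) ^ 2) *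
      ∫⁻ l in specSet φ a m k γ, ENNReal.ofReal (vprod l ^ 2) := by
    rw [hg, lintegral_indicator hspec, ← lintegral_const_mul' _ _ ENNReal.ofReal_ne_top]
    refine lintegral_congr fun l => ?_
    rw [vprod_smul, ← ENNReal.ofReal_mul (by positivity), mul_pow, inv_pow]
  rw [← lintegral_indicator measurableSet_strictMono, lintegral_congr e1, e2, e3, ← mul_assoc,
    ← mul_assoc, ← ENNReal.ofReal_mul (weylConst_pos k).le, ← ENNReal.ofReal_mul
      (mul_nonneg (weylConst_pos k).le (by positivity))]
  -- The scale s enters with exponent k from the substitution and k(k-1) from the squared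
  -- Vandermonde product, in total k².
  congr 2
  rw [specConst, mul_assoc]
  congr 1
  rw [inv_pow, ← pow_mul, ← mul_inv, ← pow_add]
  congr 2
  have := Nat.div_mul_cancel (Nat.even_mul_pred_self k).two_dvd
  rw [this]
  obtain ⟨j, rfl⟩ := Nat.exists_eq_succ_of_ne_zero hk.ne'
  simp
  ring

end Spectrum

end FreeEntropy

namespace FreeEntropy

/-! ### Averages over permutations: sampling without replacement. -/

section PermAverage

theorem exists_perm_apply_eq_and {α : Type*} [DecidableEq α] {a b a' b' : α} (h : a ≠ b) (h' : a' ≠ b') :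
    ∃ ρ : Equiv.Perm α, ρ a = a' ∧ ρ b = b' := by
  refine ⟨Equiv.swap (Equiv.swap a a' b) b' * Equiv.swap a a', ?_, ?_⟩
  · rw [Equiv.Perm.mul_apply, Equiv.swap_apply_left, Equiv.swap_apply_of_ne_of_ne _ h']
    intro h2
    apply h
    rw [← Equiv.swap_apply_left a a'] at h2
    exact (Equiv.swap a a').injective (by rw [Equiv.swap_apply_left] at h2 ⊢; exact h2)
  · rw [Equiv.Perm.mul_apply, Equiv.swap_apply_left]

variable {α : Type*} [Fintype α] [DecidableEq α]

theorem card_mul_sum_perm_apply (f : α → ℝ) (a : α) :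
    (Fintype.card α : ℝ) * ∑ τ : Equiv.Perm α, f (τ a) =
      (Fintype.card (Equiv.Perm α) : ℝ) * ∑ x, f x := by
  have h : ∀ b, ∑ τ : Equiv.Perm α, f (τ b) = ∑ τ : Equiv.Perm α, f (τ a) := by
    intro b
    rw [← Equiv.sum_comp (Equiv.mulRight (Equiv.swap a b)) fun τ : Equiv.Perm α => f (τ b)]
    simp
  calc (Fintype.card α : ℝ) * ∑ τ : Equiv.Perm α, f (τ a)
      = ∑ b : α, ∑ τ : Equiv.Perm α, f (τ b) := by simp [h]
    _ = ∑ τ : Equiv.Perm α, ∑ x, f x := by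
      rw [Finset.sum_comm]
      exact Finset.sum_congr rfl fun τ _ => Equiv.sum_comp τ f
    _ = _ := by simp

/-- By double transitivity a random permutation sends a fixed pair to every ordered pair of distinct
points equally often; the diagonal contributes nothing. -/
theorem card_mul_sum_perm_apply_apply (g : α → α → ℝ) (hg : ∀ x, g x x = 0) {a b : α}
    (hab : a ≠ b) :
    (Fintype.card α : ℝ) * (Fintype.card α - 1) * ∑ τ : Equiv.Perm α, g (τ a) (τ b) =
      (Fintype.card (Equiv.Perm α) : ℝ) * ∑ x, ∑ y, g x y := by
  have h : ∀ c d, c ≠ d → ∑ τ : Equiv.Perm α, g (τ c) (τ d) =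
      ∑ τ : Equiv.Perm α, g (τ a) (τ b) := by
    intro c d hcd
    obtain ⟨ρ, h1, h2⟩ := exists_perm_apply_eq_and hcd hab
    rw [← Equiv.sum_comp (Equiv.mulRight ρ) fun τ : Equiv.Perm α => g (τ c) (τ d)]
    simp [h1, h2]
  have h' : ∀ c d, ∑ τ : Equiv.Perm α, g (τ c) (τ d) =
      (1 - if c = d then 1 else 0) * ∑ τ : Equiv.Perm α, g (τ a) (τ b) := by
    intro c d
    split_ifs with hcd
    · simp [hcd, hg]
    · rw [h c d hcd]; ring
  calc (Fintype.card α : ℝ) * (Fintype.card α - 1) * ∑ τ : Equiv.Perm α, g (τ a) (τ b)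
      = ∑ c : α, ∑ d : α, ∑ τ : Equiv.Perm α, g (τ c) (τ d) := by
        rw [Finset.sum_congr rfl fun c _ => Finset.sum_congr rfl fun d _ => h' c d]
        simp only [← Finset.sum_mul, Finset.sum_sub_distrib]
        congr 1
        simp
        ring
    _ = ∑ τ : Equiv.Perm α, ∑ x, ∑ y, g x y := by
      refine (Finset.sum_congr rfl fun c _ => Finset.sum_comm).trans ?_
      rw [Finset.sum_comm]
      refine Finset.sum_congr rfl fun τ _ => ?_
      rw [← Equiv.sum_comp τ fun x => ∑ y, g x y]
      exact Finset.sum_congr rfl fun x _ => Equiv.sum_comp τ (g (τ x))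
    _ = _ := by simp

/-- For centred h the covariances between distinct samples are nonpositive, so the variance is at
most that of independent sampling. -/
theorem sum_perm_sq_sum_le {k : ℕ} (ι : Fin k ↪ α) {h : α → ℝ} (hh : ∑ x, h x = 0) :
    (Fintype.card α : ℝ) * ∑ τ : Equiv.Perm α, (∑ i, h (τ (ι i))) ^ 2 ≤
      (Fintype.card (Equiv.Perm α) : ℝ) * (k * ∑ x, h x ^ 2) := by
  have hcross : ∀ i j : Fin k, (Fintype.card α : ℝ) *
      ∑ τ : Equiv.Perm α, h (τ (ι i)) * h (τ (ι j)) ≤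
      if i = j then (Fintype.card (Equiv.Perm α) : ℝ) * ∑ x, h x ^ 2 else 0 := by
    intro i j
    split_ifs with hij
    · subst hij
      rw [← card_mul_sum_perm_apply (fun x => h x ^ 2) (ι i)]
      simp only [sq, le_refl]
    · have hne : ι i ≠ ι j := fun h => hij (ι.injective h)
      have hcard : 1 < Fintype.card α := Fintype.one_lt_card_iff.2 ⟨_, _, hne⟩
      have hcard' : (0 : ℝ) < (Fintype.card α : ℝ) - 1 := by
        have : (1 : ℝ) < Fintype.card α := by exact_mod_cast hcard
        linarith
      have h1 := card_mul_sum_perm_apply_apply (fun x y => if x = y then 0 else h x * h y)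
        (by simp) hne
      have h2 : ∑ x, ∑ y, (if x = y then 0 else h x * h y) = - ∑ x, h x ^ 2 := by
        have : ∀ x y, (if x = y then 0 else h x * h y) =
            h x * h y - if x = y then h x * h y else 0 := by
          intro x y; split_ifs <;> simp
        simp only [this, Finset.sum_sub_distrib, ← Finset.mul_sum, hh]
        simp [sq]
      have h3 : ∀ τ : Equiv.Perm α, (if τ (ι i) = τ (ι j) then 0 else h (τ (ι i)) * h (τ (ι j))) =
          h (τ (ι i)) * h (τ (ι j)) := fun τ => if_neg fun h => hne (τ.injective h)
      simp only [h3, h2] at h1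
      have h4 : (Fintype.card α : ℝ) * (Fintype.card α - 1) *
          ∑ τ : Equiv.Perm α, h (τ (ι i)) * h (τ (ι j)) ≤ 0 := by
        rw [h1]
        have : 0 ≤ ∑ x, h x ^ 2 := Finset.sum_nonneg fun _ _ => sq_nonneg _
        have : 0 ≤ (Fintype.card (Equiv.Perm α) : ℝ) * ∑ x, h x ^ 2 := by positivity
        linarith
      by_contra! h5
      nlinarith [mul_pos hcard' h5]
  calc (Fintype.card α : ℝ) * ∑ τ : Equiv.Perm α, (∑ i, h (τ (ι i))) ^ 2
      = ∑ i, ∑ j, (Fintype.card α : ℝ) * ∑ τ : Equiv.Perm α, h (τ (ι i)) * h (τ (ι j)) := by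
        have : ∀ τ : Equiv.Perm α, (∑ i, h (τ (ι i))) ^ 2 =
            ∑ i, ∑ j, h (τ (ι i)) * h (τ (ι j)) := fun τ => by rw [sq, Finset.sum_mul_sum]
        simp only [this, Finset.mul_sum]
        rw [Finset.sum_comm]
        exact Finset.sum_congr rfl fun i _ => Finset.sum_comm
    _ ≤ ∑ i : Fin k, ∑ j : Fin k,
        if i = j then (Fintype.card (Equiv.Perm α) : ℝ) * ∑ x, h x ^ 2 else 0 :=
        Finset.sum_le_sum fun i _ => Finset.sum_le_sum fun j _ => hcross i j
    _ = _ := by simp; ring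

end PermAverage

/-! ### Logarithmic energy of random subfamilies. -/

section Energy

/-- The logarithmic energy `∑_{i ≠ j} log |z i - z j|`. -/
noncomputable def logE {k : ℕ} (z : Fin k → ℝ) : ℝ := ∑ i, ∑ j, Real.log |z i - z j|

theorem logE_comp_perm {k : ℕ} (z : Fin k → ℝ) (σ : Equiv.Perm (Fin k)) :
    logE (z ∘ σ) = logE z := by
  unfold logE
  rw [← Equiv.sum_comp σ fun i => ∑ j, Real.log |z i - z j|]
  exact Finset.sum_congr rfl fun i _ => Equiv.sum_comp σ fun j => Real.log |z (σ i) - z j|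

theorem empMoment_comp_perm {k : ℕ} (z : Fin k → ℝ) (σ : Equiv.Perm (Fin k)) (p : ℕ) :
    empMoment (z ∘ σ) p = empMoment z p := by
  unfold empMoment
  congr 1
  exact Equiv.sum_comp σ fun i => z i ^ p

/-- Each pair is counted twice, and the diagonal terms vanish because `Real.log 0 = 0`. -/
theorem logE_eq_two_mul_log_vprod {k : ℕ} {z : Fin k → ℝ} (hz : StrictMono z) :
    logE z = 2 * Real.log (vprod z) := by
  have h1 : ∀ i, ∑ j, Real.log |z i - z j| = ∑ j ∈ Finset.Iio i, Real.log |z i - z j| +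
      ∑ j ∈ Finset.Ioi i, Real.log |z i - z j| := by
    intro i
    rw [← Finset.sum_union, ← univ_erase_eq, ← Finset.add_sum_erase _ _ (Finset.mem_univ i)]
    · simp
    · exact Finset.disjoint_left.2 fun j h1 h2 =>
        lt_asymm (Finset.mem_Iio.1 h1) (Finset.mem_Ioi.1 h2)
  have h2 : ∑ i, ∑ j ∈ Finset.Iio i, Real.log |z i - z j| =
      ∑ i, ∑ j ∈ Finset.Ioi i, Real.log |z i - z j| := by
    rw [Finset.sum_comm' (t' := Finset.univ) (s' := fun j => Finset.Ioi j) (by simp)]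
    exact Finset.sum_congr rfl fun i _ => Finset.sum_congr rfl fun j _ => by rw [abs_sub_comm]
  have h3 : Real.log (vprod z) = ∑ i, ∑ j ∈ Finset.Ioi i, Real.log |z i - z j| := by
    rw [vprod, Real.log_prod fun i _ => (Finset.prod_pos fun j hj =>
      sub_pos.2 (hz (Finset.mem_Ioi.1 hj))).ne']
    refine Finset.sum_congr rfl fun i _ => ?_
    rw [Real.log_prod fun j hj => (sub_pos.2 (hz (Finset.mem_Ioi.1 hj))).ne']
    exact Finset.sum_congr rfl fun j _ => by rw [Real.log_abs, ← Real.log_neg_eq_log, neg_sub]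
  simp only [logE, h1, Finset.sum_add_distrib, h2, h3]
  ring

theorem log_abs_sub_le (x y : ℝ) : Real.log |x - y| ≤ (x ^ 2 + y ^ 2) / 2 := by
  rcases eq_or_ne (x - y) 0 with h | h
  · rw [h]; simp; positivity
  · have h1 := Real.log_le_sub_one_of_pos (abs_pos.2 h)
    have h2 := sq_abs (x - y)
    nlinarith [sq_nonneg (|x - y| - 2), sq_nonneg (x + y)]

theorem logE_le {k : ℕ} (z : Fin k → ℝ) : logE z ≤ k * (k - 1) * empMoment z 2 := by
  rcases Nat.eq_zero_or_pos k with rfl | hk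
  · simp [logE]
  have hk' : (k : ℝ) ≠ 0 := by exact_mod_cast hk.ne'
  have h1 : logE z ≤ ∑ i, ∑ j, ((z i ^ 2 + z j ^ 2) / 2 - if i = j then z i ^ 2 else 0) := by
    refine Finset.sum_le_sum fun i _ => Finset.sum_le_sum fun j _ => ?_
    split_ifs with h
    · subst h; simp
    · rw [sub_zero]; exact log_abs_sub_le _ _
  refine h1.trans_eq ?_
  simp only [Finset.sum_sub_distrib, ← Finset.sum_div, Finset.sum_add_distrib, empMoment]
  simp
  field_simp
  rw [← Finset.mul_sum]
  ring

/-- The mean energy per ordered pair of a random subfamily equals that of the whole family. -/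
theorem sum_perm_logE {k K : ℕ} (ι : Fin k ↪ Fin K) (l : Fin K → ℝ) :
    (K : ℝ) * (K - 1) * ∑ τ : Equiv.Perm (Fin K), logE (fun i => l (τ (ι i))) =
      (Fintype.card (Equiv.Perm (Fin K)) : ℝ) * (k * (k - 1) * logE l) := by
  have h : ∀ i j : Fin k, (K : ℝ) * (K - 1) *
      ∑ τ : Equiv.Perm (Fin K), Real.log |l (τ (ι i)) - l (τ (ι j))| =
      (1 - if i = j then 1 else 0) * ((Fintype.card (Equiv.Perm (Fin K)) : ℝ) * logE l) := by
    intro i j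
    split_ifs with hij
    · simp [hij]
    · have h1 := card_mul_sum_perm_apply_apply (fun x y => Real.log |l x - l y|) (by simp)
        (a := ι i) (b := ι j) fun h => hij (ι.injective h)
      rw [Fintype.card_fin] at h1
      rw [h1, logE]; ring
  calc (K : ℝ) * (K - 1) * ∑ τ : Equiv.Perm (Fin K), logE (fun i => l (τ (ι i)))
      = ∑ i, ∑ j, (K : ℝ) * (K - 1) *
        ∑ τ : Equiv.Perm (Fin K), Real.log |l (τ (ι i)) - l (τ (ι j))| := by
        simp only [logE, ← Finset.mul_sum]
        congr 1
        rw [Finset.sum_comm]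
        exact Finset.sum_congr rfl fun i _ => Finset.sum_comm
    _ = _ := by
        simp only [h, ← Finset.sum_mul, Finset.sum_sub_distrib]
        simp
        ring

theorem sum_perm_empMoment_sub_sq_le {k K : ℕ} (hk : 0 < k) (ι : Fin k ↪ Fin K) (l : Fin K → ℝ)
    (p : ℕ) : ∑ τ : Equiv.Perm (Fin K),
      (empMoment (fun i => l (τ (ι i))) p - empMoment l p) ^ 2 ≤
      (Fintype.card (Equiv.Perm (Fin K)) : ℝ) * ((k : ℝ)⁻¹ * empMoment l (2 * p)) := by
  have hK : 0 < K := (Nat.zero_le _).trans_lt (ι ⟨0, hk⟩).2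
  have hK' : (0 : ℝ) < K := by exact_mod_cast hK
  have hk' : (0 : ℝ) < k := by exact_mod_cast hk
  set c := empMoment l p with hc
  have hcs : ∑ x, l x ^ p = K * c := by
    rw [hc, empMoment, mul_inv_cancel_left₀ hK'.ne']
  have h0 : ∑ x, (l x ^ p - c) = 0 := by
    rw [Finset.sum_sub_distrib, hcs]; simp
  have h1 := sum_perm_sq_sum_le ι h0
  have h2 : ∑ x, (l x ^ p - c) ^ 2 ≤ K * empMoment l (2 * p) := by
    have : ∀ x, (l x ^ p - c) ^ 2 = l x ^ (2 * p) - 2 * c * l x ^ p + c ^ 2 := by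
      intro x; rw [mul_comm 2 p, pow_mul]; ring
    simp only [this, Finset.sum_add_distrib, Finset.sum_sub_distrib, ← Finset.mul_sum, hcs,
      empMoment]
    rw [mul_inv_cancel_left₀ hK'.ne']
    simp
    nlinarith [mul_nonneg hK'.le (sq_nonneg c)]
  have h3 : ∀ τ : Equiv.Perm (Fin K), (empMoment (fun i => l (τ (ι i))) p - c) ^ 2 =
      ((k : ℝ)⁻¹) ^ 2 * (∑ i, (l (τ (ι i)) ^ p - c)) ^ 2 := by
    intro τ
    rw [← mul_pow, Finset.sum_sub_distrib, mul_sub]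
    simp [empMoment, hk'.ne']
  rw [Fintype.card_fin] at h1
  simp only [h3, ← Finset.mul_sum]
  set S := ∑ τ : Equiv.Perm (Fin K), (∑ i, (l (τ (ι i)) ^ p - c)) ^ 2
  set N : ℝ := (Fintype.card (Equiv.Perm (Fin K)) : ℝ)
  have h4 : (K : ℝ) * S ≤ K * (N * (k * empMoment l (2 * p))) := by
    refine h1.trans ?_
    have : N * (k * ∑ x, (l x ^ p - c) ^ 2) ≤ N * (k * (K * empMoment l (2 * p))) := by
      gcongr
    linarith
  have h5 := le_of_mul_le_mul_left h4 hK'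
  calc ((k : ℝ)⁻¹) ^ 2 * S ≤ ((k : ℝ)⁻¹) ^ 2 * (N * (k * empMoment l (2 * p))) := by gcongr
    _ = _ := by field_simp

/-- A family of reals has a subfamily of given size which has almost the same normalized energy
and almost the same moments. -/
theorem exists_embedding_energy {k K : ℕ} (hk : 2 ≤ k) (hkK : k ≤ K) (l : Fin K → ℝ) (m : ℕ)
    {T : ℝ} (hT : 0 ≤ T) : ∃ ι : Fin k ↪ Fin K,
      logE l / (K * (K - 1)) - T / k * ∑ p ∈ Finset.Icc 1 m, empMoment l (2 * p) ≤
      logE (l ∘ ι) / (k * (k - 1)) -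
        T * ∑ p ∈ Finset.Icc 1 m, (empMoment (l ∘ ι) p - empMoment l p) ^ 2 := by
  have hk0 : (1 : ℝ) < k := by exact_mod_cast hk
  have hK0 : (1 : ℝ) < K := by exact_mod_cast hk.trans hkK
  set ι₀ := Fin.castLEEmb hkK
  -- Energy and moment deviations are combined into one functional, so that a single permutation, at
  -- least as good as the average, serves both.
  obtain ⟨τ, -, hτ⟩ := Finset.exists_le_of_sum_le (s := (Finset.univ : Finset (Equiv.Perm (Fin K))))
    (f := fun _ => logE l / (K * (K - 1)) - T / k * ∑ p ∈ Finset.Icc 1 m, empMoment l (2 * p))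
    (g := fun τ => logE (fun i => l (τ (ι₀ i))) / (k * (k - 1)) -
        T * ∑ p ∈ Finset.Icc 1 m, (empMoment (fun i => l (τ (ι₀ i))) p - empMoment l p) ^ 2)
    Finset.univ_nonempty (by
      have h1 := sum_perm_logE ι₀ l
      have h2 : ∑ p ∈ Finset.Icc 1 m, ∑ τ : Equiv.Perm (Fin K),
          (empMoment (fun i => l (τ (ι₀ i))) p - empMoment l p) ^ 2 ≤
          ∑ p ∈ Finset.Icc 1 m,
          (Fintype.card (Equiv.Perm (Fin K)) : ℝ) * ((k : ℝ)⁻¹ * empMoment l (2 * p)) :=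
        Finset.sum_le_sum fun p _ => sum_perm_empMoment_sub_sq_le (by omega) ι₀ l p
      rw [Finset.sum_comm, ← Finset.mul_sum, ← Finset.mul_sum] at h2
      rw [Finset.sum_const, Finset.card_univ, nsmul_eq_mul, Finset.sum_sub_distrib,
        ← Finset.sum_div, ← Finset.mul_sum]
      set S := ∑ τ : Equiv.Perm (Fin K), logE fun i => l (τ (ι₀ i))
      set N : ℝ := (Fintype.card (Equiv.Perm (Fin K)) : ℝ)
      have h3 : S / (k * (k - 1)) = N * (logE l / (K * (K - 1))) := by
        have : (k : ℝ) - 1 ≠ 0 := by linarith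
        have : (K : ℝ) - 1 ≠ 0 := by linarith
        have : (k : ℝ) ≠ 0 := by linarith
        have : (K : ℝ) ≠ 0 := by linarith
        field_simp
        linarith
      have h4 := mul_le_mul_of_nonneg_left h2 hT
      rw [h3]
      calc _ = N * (logE l / (K * (K - 1))) -
            T * (N * ((k : ℝ)⁻¹ * ∑ p ∈ Finset.Icc 1 m, empMoment l (2 * p))) := by ring
        _ ≤ _ := by linarith)
  exact ⟨ι₀.trans τ.toEmbedding, hτ⟩

/-- Subfamilies with almost the same moments and no less energy. -/
theorem exists_strictMono_subfamily (e C : ℝ) {η : ℝ} (hη : 0 < η) {m : ℕ} (hm : 2 ≤ m) :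
    ∃ (k₀ : ℕ) (C' : ℝ), ∀ k K : ℕ, k₀ ≤ k → k ≤ K → ∀ l : Fin K → ℝ, Function.Injective l →
      (∀ p, 1 ≤ p → p ≤ m → empMoment l (2 * p) ≤ C) → e * (K * (K - 1)) ≤ logE l →
      ∃ z : Fin k → ℝ, StrictMono z ∧
        (∀ p, 1 ≤ p → p ≤ m → |empMoment z p - empMoment l p| < η) ∧
        k * (k - 1) * (e - C' / k) ≤ logE z := by
  set A : ℝ := |C| + 3 + |e| with hA
  have hA0 : 0 < A := by positivity
  -- The normalized energy of the subfamily is at most its second moment, hence at most |C| + 1 + D.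
  -- Large energy thus forces (T - 1)D < A, that is D < η².
  set T : ℝ := 1 + A / η ^ 2 with hT
  have hT0 : 0 < T := by positivity
  set B : ℝ := T * (m * |C|) with hB
  have hB0 : 0 ≤ B := by positivity
  obtain ⟨k₀, hk₀⟩ := exists_nat_ge B
  refine ⟨max 2 k₀, B, fun k K hk hkK l hl hC he => ?_⟩
  have hk2 : 2 ≤ k := (le_max_left _ _).trans hk
  have hkB : B ≤ k := hk₀.trans (by exact_mod_cast (le_max_right _ _).trans hk)
  have hk1 : (1 : ℝ) < k := by exact_mod_cast hk2
  have hK1 : (1 : ℝ) < K := by exact_mod_cast hk2.trans hkK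
  obtain ⟨ι, hι⟩ := exists_embedding_energy hk2 hkK l m hT0.le
  set y := l ∘ ι with hy
  set D := ∑ p ∈ Finset.Icc 1 m, (empMoment y p - empMoment l p) ^ 2 with hD
  have hD0 : 0 ≤ D := Finset.sum_nonneg fun _ _ => sq_nonneg _
  have hDp : ∀ p, 1 ≤ p → p ≤ m → (empMoment y p - empMoment l p) ^ 2 ≤ D := fun p h1 h2 =>
    Finset.single_le_sum (f := fun p => (empMoment y p - empMoment l p) ^ 2)
      (fun _ _ => sq_nonneg _) (Finset.mem_Icc.2 ⟨h1, h2⟩)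
  have hsum : T / k * ∑ p ∈ Finset.Icc 1 m, empMoment l (2 * p) ≤ B / k := by
    have h1 : ∑ p ∈ Finset.Icc 1 m, empMoment l (2 * p) ≤ m * |C| := by
      refine (Finset.sum_le_card_nsmul _ _ |C| fun p hp => ?_).trans_eq (by simp)
      rw [Finset.mem_Icc] at hp
      exact (hC p hp.1 hp.2).trans (le_abs_self _)
    rw [hB, div_mul_eq_mul_div]
    gcongr
  have hel : e ≤ logE l / (K * (K - 1)) := by
    rw [le_div_iff₀ (mul_pos (by linarith) (by linarith))]; exact he
  have hkk : 0 < (k : ℝ) * (k - 1) := mul_pos (by linarith) (by linarith)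
  have hub : logE y / (k * (k - 1)) ≤ empMoment y 2 := by
    rw [div_le_iff₀ hkk, mul_comm]; exact logE_le y
  have hdev2 : empMoment y 2 ≤ |C| + 1 + D := by
    have h1 := hDp 2 (by norm_num) hm
    have h2 := (hC 1 le_rfl (by omega)).trans (le_abs_self _)
    rw [mul_one] at h2
    nlinarith [sq_nonneg (empMoment y 2 - empMoment l 2 - 1)]
  have hBk : B / k ≤ 1 := by rw [div_le_one (by linarith)]; exact hkB
  have hDlt : D < η ^ 2 := by
    have h1 : (T - 1) * D ≤ |C| + 2 + |e| := by
      have := neg_abs_le e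
      nlinarith
    have h2 : (T - 1) * D = A * D / η ^ 2 := by rw [hT]; ring
    rw [h2, div_le_iff₀ (by positivity)] at h1
    have h3 : (|C| + 2 + |e|) * η ^ 2 < A * η ^ 2 := by
      apply mul_lt_mul_of_pos_right _ (by positivity)
      rw [hA]; linarith
    exact lt_of_mul_lt_mul_left (h1.trans_lt h3) hA0.le
  refine ⟨y ∘ Tuple.sort y, (Tuple.monotone_sort y).strictMono_of_injective
    ((hl.comp ι.injective).comp (Tuple.sort y).injective), fun p h1 h2 => ?_, ?_⟩
  · rw [empMoment_comp_perm]
    exact abs_lt_of_sq_lt_sq ((hDp p h1 h2).trans_lt hDlt) hη.le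
  · rw [logE_comp_perm, mul_comm, ← le_div_iff₀ hkk]
    have : 0 ≤ T * D := by positivity
    linarith

end Energy

end FreeEntropy

namespace FreeEntropy

open Matrix MeasureTheory Filter Topology

/-! ### Translating entropy inequalities into volume inequalities. -/

section Log

theorem mul_log_add_lt_coe_iff {a c u : ℝ} (ha : 0 < a) {V : ℝ≥0∞} :
    (a : EReal) * ENNReal.log V + (c : EReal) < (u : EReal) ↔
      V < ENNReal.ofReal (Real.exp ((u - c) / a)) := by
  rcases eq_or_ne V 0 with rfl | h0
  · simp [EReal.coe_mul_bot_of_pos ha, Real.exp_pos]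
  rcases eq_or_ne V ⊤ with rfl | ht
  · simp [EReal.coe_mul_top_of_pos ha]
  have hv : 0 < V.toReal := ENNReal.toReal_pos h0 ht
  rw [ENNReal.log_pos_real h0 ht, ← ENNReal.ofReal_toReal ht, ENNReal.toReal_ofReal hv.le,
    ENNReal.ofReal_lt_ofReal_iff (Real.exp_pos _), ← Real.log_lt_iff_lt_exp hv,
    ← EReal.coe_mul, ← EReal.coe_add, EReal.coe_lt_coe_iff, lt_div_iff₀ ha]
  constructor <;> intro h <;> linarith

theorem coe_lt_mul_log_add_iff {a c u : ℝ} (ha : 0 < a) {V : ℝ≥0∞} :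
    (u : EReal) < (a : EReal) * ENNReal.log V + (c : EReal) ↔
      ENNReal.ofReal (Real.exp ((u - c) / a)) < V := by
  rcases eq_or_ne V 0 with rfl | h0
  · simp [EReal.coe_mul_bot_of_pos ha]
  rcases eq_or_ne V ⊤ with rfl | ht
  · simp [EReal.coe_mul_top_of_pos ha]
  have hv : 0 < V.toReal := ENNReal.toReal_pos h0 ht
  rw [ENNReal.log_pos_real h0 ht, ← ENNReal.ofReal_toReal ht, ENNReal.toReal_ofReal hv.le,
    ENNReal.ofReal_lt_ofReal_iff hv, ← Real.lt_log_iff_exp_lt hv,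
    ← EReal.coe_mul, ← EReal.coe_add, EReal.coe_lt_coe_iff, div_lt_iff₀ ha]
  constructor <;> intro h <;> linarith

end Log

/-! ### Boxes around a family on which gaps do not shrink. -/

section Thickening

variable {k : ℕ}

theorem vprod_le_vprod {z y : Fin k → ℝ} (hz : StrictMono z)
    (h : ∀ i j, i < j → z j - z i ≤ y j - y i) : vprod z ≤ vprod y :=
  Finset.prod_le_prod (fun _ _ => Finset.prod_nonneg fun _ hj =>
    (sub_pos.2 (hz (Finset.mem_Ioi.1 hj))).le) fun _ _ =>
    Finset.prod_le_prod (fun _ hj => (sub_pos.2 (hz (Finset.mem_Ioi.1 hj))).le)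
      fun _ hj => h _ _ (Finset.mem_Ioi.1 hj)

/-- A box of families of reals in which the gaps are larger than those of `z`. -/
def gapBox (z : Fin k → ℝ) (δ : ℝ) : Set (Fin k → ℝ) :=
  Set.univ.pi fun i => Set.Ioc (z i + i * (δ / k)) (z i + (i + 1) * (δ / k))

theorem volume_gapBox (z : Fin k → ℝ) {δ : ℝ} (hδ : 0 ≤ δ) :
    volume (gapBox z δ) = ENNReal.ofReal ((δ / k) ^ k) := by
  rw [gapBox, volume_pi_pi]
  simp only [Real.volume_Ioc]
  rw [ENNReal.ofReal_pow (by positivity)]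
  have : ∀ i : Fin k, z i + ((i : ℝ) + 1) * (δ / k) - (z i + i * (δ / k)) = δ / k :=
    fun i => by ring
  simp [this]

theorem sub_le_sub_of_mem_gapBox {z y : Fin k → ℝ} {δ : ℝ} (hδ : 0 ≤ δ) (hy : y ∈ gapBox z δ)
    {i j : Fin k} (hij : i < j) : z j - z i ≤ y j - y i := by
  have h1 := (hy i trivial).2
  have h2 := (hy j trivial).1
  have h3 : ((i : ℝ) + 1) * (δ / k) ≤ j * (δ / k) := by
    apply mul_le_mul_of_nonneg_right _ (by positivity)
    exact_mod_cast Nat.succ_le_of_lt hij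
  linarith

theorem abs_sub_le_of_mem_gapBox {z y : Fin k → ℝ} {δ : ℝ} (hδ : 0 ≤ δ) (hy : y ∈ gapBox z δ)
    (i : Fin k) : |y i - z i| ≤ δ := by
  have h1 := (hy i trivial).1
  have h2 := (hy i trivial).2
  have hk : (0 : ℝ) < k := by exact_mod_cast (Nat.zero_le _).trans_lt i.2
  have h3 : 0 ≤ (i : ℝ) * (δ / k) := by positivity
  have h4 : ((i : ℝ) + 1) * (δ / k) ≤ k * (δ / k) := by
    apply mul_le_mul_of_nonneg_right _ (by positivity)
    exact_mod_cast Nat.succ_le_of_lt i.2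
  rw [mul_div_cancel₀ _ hk.ne'] at h4
  rw [abs_le]; constructor <;> linarith

/-- The bound is linear in x^(2p), so that averaging it needs only the 2p-th moment and no bound on
the individual points. -/
theorem abs_pow_sub_pow_le_of_abs_sub_le {x y δ : ℝ} (hδ1 : δ ≤ 1) (h : |y - x| ≤ δ)
    (p : ℕ) : |y ^ p - x ^ p| ≤ δ * (p * 4 ^ p) * (1 + x ^ (2 * p)) := by
  have hδ : 0 ≤ δ := (abs_nonneg _).trans h
  set c := max |x| 1 with hc
  have hc1 : 1 ≤ c := le_max_right _ _
  have hy : |y| ≤ 2 * c := by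
    have h1 := abs_sub_abs_le_abs_sub y x
    have h2 : |x| ≤ c := le_max_left _ _
    linarith
  have hx : |x| ≤ 2 * c := by
    have h2 : |x| ≤ c := le_max_left _ _
    linarith
  have h1 := abs_pow_sub_pow_le y x p
  have h2 : max |y| |x| ^ (p - 1) ≤ 4 ^ p * (1 + x ^ (2 * p)) := by
    calc max |y| |x| ^ (p - 1) ≤ (2 * c) ^ (p - 1) :=
          pow_le_pow_left₀ (by positivity) (max_le hy hx) _
      _ ≤ (2 * c) ^ (2 * p) := pow_le_pow_right₀ (by linarith) (by omega)
      _ = 4 ^ p * c ^ (2 * p) := by rw [mul_pow, pow_mul 2]; norm_num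
      _ ≤ 4 ^ p * (1 + x ^ (2 * p)) := by
        gcongr
        have hx0 : 0 ≤ x ^ (2 * p) := by rw [pow_mul]; positivity
        rcases max_cases |x| 1 with ⟨h, -⟩ | ⟨h, -⟩
        · rw [hc, h, pow_mul, sq_abs, ← pow_mul]; linarith
        · rw [hc, h, one_pow]; linarith
  calc |y ^ p - x ^ p| ≤ |y - x| * p * max |y| |x| ^ (p - 1) := h1
    _ ≤ δ * p * (4 ^ p * (1 + x ^ (2 * p))) := by
      gcongr
    _ = _ := by ring

theorem abs_empMoment_sub_le (hk : 0 < k) {z y : Fin k → ℝ} {δ : ℝ} (hδ1 : δ ≤ 1)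
    (h : ∀ i, |y i - z i| ≤ δ) (p : ℕ) :
    |empMoment y p - empMoment z p| ≤ δ * (p * 4 ^ p) * (1 + empMoment z (2 * p)) := by
  rw [empMoment, empMoment, ← mul_sub, ← Finset.sum_sub_distrib, abs_mul,
    abs_of_nonneg (by positivity : (0 : ℝ) ≤ (k : ℝ)⁻¹)]
  calc (k : ℝ)⁻¹ * |∑ i, (y i ^ p - z i ^ p)|
      ≤ (k : ℝ)⁻¹ * ∑ i, δ * (p * 4 ^ p) * (1 + z i ^ (2 * p)) := by
        gcongr
        exact (Finset.abs_sum_le_sum_abs _ _).trans (Finset.sum_le_sum fun i _ =>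
          abs_pow_sub_pow_le_of_abs_sub_le hδ1 (h i) p)
    _ = _ := by rw [avg_const_mul, avg_add, avg_const hk, empMoment]

end Thickening

/-! ### The one-variable limit superior is attained as a limit inferior. -/

section Regularity

variable {M : Type*} [CStarAlgebra M] {φ : M →ₗ[ℂ] ℂ} {a : M} {k : ℕ}

/-- A large microstate space contains a matrix whose spectrum has large energy. -/
theorem exists_mem_specSet_logE (hφ : IsTracialState φ) (ha : IsSelfAdjoint a) {m : ℕ}
    (hm : 2 ≤ m) {γ C : ℝ} (hC : moment φ a 2 + γ ≤ C) (hC0 : 0 < C) (hk : 0 < k) {V : ℝ}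
    (hV : 0 < V) (h : ENNReal.ofReal V < vol (microstates φ (single a) m k γ)) :
    ∃ l ∈ specSet φ a m k γ,
      Real.log V - Real.log (specConst k) - k * Real.log (2 * √(k * C)) ≤ logE l := by
  have hk' : (0 : ℝ) < k := by exact_mod_cast hk
  have hκ := specConst_pos hk
  by_contra! hcon
  set ρ := √(k * C) with hρ
  have hρ0 : 0 < ρ := by positivity
  -- The second moment confines all points to a box whose volume has logarithm of order k log k,
  -- negligible on the scale k². The integrand must therefore be large at some point.
  have hbox : specSet φ a m k γ ⊆ Set.univ.pi fun _ : Fin k => Set.Icc (-ρ) ρ := by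
    intro l hl i _
    have h1 := (abs_lt.1 (hl.2 2 (by norm_num) hm)).2
    have h2 : ∑ j, l j ^ 2 = k * empMoment l 2 := by
      rw [empMoment, mul_inv_cancel_left₀ hk'.ne']
    have h3 : l i ^ 2 ≤ ∑ j, l j ^ 2 :=
      Finset.single_le_sum (f := fun j => l j ^ 2) (fun _ _ => sq_nonneg _) (Finset.mem_univ i)
    rw [Set.mem_Icc, ← abs_le]
    apply Real.abs_le_sqrt
    rw [h2] at h3
    refine h3.trans ?_
    gcongr
    linarith
  have hvb : volume (specSet φ a m k γ) ≤ ENNReal.ofReal ((2 * ρ) ^ k) := by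
    refine (measure_mono hbox).trans_eq ?_
    rw [volume_pi_pi]
    simp only [Real.volume_Icc]
    rw [ENNReal.ofReal_pow (by positivity), show ρ - -ρ = 2 * ρ by ring]
    simp
  have hint : ∫⁻ l in specSet φ a m k γ, ENNReal.ofReal (vprod l ^ 2) ≤
      ENNReal.ofReal (V / (specConst k * (2 * ρ) ^ k)) * ENNReal.ofReal ((2 * ρ) ^ k) := by
    refine le_trans ?_ (mul_le_mul_right hvb _)
    rw [← setLIntegral_const]
    refine setLIntegral_mono' (measurableSet_specSet m γ) fun l hl => ?_
    apply ENNReal.ofReal_le_ofReal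
    have h1 := hcon l hl
    have hp := vprod_pos hl.1
    rw [logE_eq_two_mul_log_vprod hl.1] at h1
    rw [← Real.log_le_log_iff (by positivity) (by positivity), Real.log_pow,
      Real.log_div hV.ne' (by positivity), Real.log_mul hκ.ne' (by positivity), Real.log_pow]
    push_cast
    linarith
  rw [vol_microstates_single_eq hφ ha m γ hk] at h
  refine absurd (h.trans_le (mul_le_mul_right hint _)) (not_lt.2 ?_)
  rw [← ENNReal.ofReal_mul (by positivity), ← ENNReal.ofReal_mul hκ.le]
  apply ENNReal.ofReal_le_ofReal
  apply le_of_eq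
  field_simp

/-- A family of reals with large energy gives a large microstate space. -/
theorem exists_le_vol_microstates_single (hφ : IsTracialState φ) (ha : IsSelfAdjoint a) {m : ℕ}
    {γ : ℝ} (hγ : 0 < γ) (C : ℝ) : ∃ δ : ℝ, 0 < δ ∧ ∀ k : ℕ, 0 < k → ∀ z : Fin k → ℝ,
      StrictMono z → MomentsNear (moment φ a) m (γ / 2) z →
      (∀ p, 1 ≤ p → p ≤ m → empMoment z (2 * p) ≤ C) →
      ENNReal.ofReal (Real.exp (Real.log (specConst k) + logE z + k * Real.log (δ / k))) ≤
        vol (microstates φ (single a) m k γ) := by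
  set D : ℝ := m * 4 ^ m * (1 + |C|) + 1 with hD
  have hD0 : 0 < D := by positivity
  set δ : ℝ := min 1 (γ / 2 / D) with hδ
  have hδ0 : 0 < δ := lt_min one_pos (by positivity)
  have hδ1 : δ ≤ 1 := min_le_left _ _
  have hδD : δ * D ≤ γ / 2 := by
    rw [← le_div_iff₀ hD0]; exact min_le_right _ _
  refine ⟨δ, hδ0, fun k hk z hz hzm hzC => ?_⟩
  have hk' : (0 : ℝ) < k := by exact_mod_cast hk
  have hκ := specConst_pos hk
  -- The box has side δ/k, so passing from the point z to a set of positive volume costs only the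
  -- term k log(δ/k).
  have hsub : gapBox z δ ⊆ specSet φ a m k γ := by
    intro y hy
    refine ⟨fun i j hij => ?_, fun p h1 h2 => ?_⟩
    · have := sub_le_sub_of_mem_gapBox hδ0.le hy hij
      have := hz hij
      linarith
    · have h3 := abs_empMoment_sub_le hk hδ1 (abs_sub_le_of_mem_gapBox hδ0.le hy) p
      have h4 := hzm p h1 h2
      have h5 : δ * (p * 4 ^ p) * (1 + empMoment z (2 * p)) ≤
          δ * (m * 4 ^ m) * (1 + |C|) := by
        have h6 : (p : ℝ) ≤ m := by exact_mod_cast h2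
        have h7 : (4 : ℝ) ^ p ≤ 4 ^ m := pow_le_pow_right₀ (by norm_num) h2
        have h8 := (hzC p h1 h2).trans (le_abs_self C)
        have h9 : 0 ≤ empMoment z (2 * p) := by
          rw [empMoment]
          refine mul_nonneg (by positivity) (Finset.sum_nonneg fun i _ => ?_)
          rw [pow_mul]; positivity
        gcongr
      have h6 : δ * (m * 4 ^ m) * (1 + |C|) ≤ γ / 2 := by
        refine le_trans ?_ hδD
        rw [hD]
        nlinarith
      have h7 := abs_sub_le (empMoment y p) (empMoment z p) (moment φ a p)
      linarith
  rw [vol_microstates_single_eq hφ ha m γ hk]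
  calc ENNReal.ofReal (Real.exp (Real.log (specConst k) + logE z + k * Real.log (δ / k)))
      = ENNReal.ofReal (specConst k) * (ENNReal.ofReal (vprod z ^ 2) *
          ENNReal.ofReal ((δ / k) ^ k)) := by
        have hp := vprod_pos hz
        rw [← ENNReal.ofReal_mul (by positivity), ← ENNReal.ofReal_mul hκ.le]
        congr 1
        rw [logE_eq_two_mul_log_vprod hz, Real.exp_add, Real.exp_add, Real.exp_log hκ,
          Real.exp_nat_mul, Real.exp_log (by positivity), two_mul, Real.exp_add, Real.exp_log hp]
        ring
    _ = ENNReal.ofReal (specConst k) *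
          ∫⁻ l in gapBox z δ, ENNReal.ofReal (vprod z ^ 2) := by
        rw [setLIntegral_const, volume_gapBox z hδ0.le]
    _ ≤ ENNReal.ofReal (specConst k) *
          ∫⁻ l in gapBox z δ, ENNReal.ofReal (vprod l ^ 2) := by
        refine mul_le_mul_right (setLIntegral_mono' ?_ fun l hl => ?_) _
        · exact MeasurableSet.univ_pi fun _ => measurableSet_Ioc
        · apply ENNReal.ofReal_le_ofReal
          exact pow_le_pow_left₀ (vprod_pos hz).le (vprod_le_vprod hz fun i j hij =>
            sub_le_sub_of_mem_gapBox hδ0.le hl hij) 2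
    _ ≤ _ := by gcongr

theorem tendsto_log_const_mul_div {c : ℝ} (hc : 0 < c) :
    Tendsto (fun k : ℕ => (k : ℝ)⁻¹ * Real.log (c * k)) atTop (𝓝 0) := by
  have h1 : Tendsto (fun k : ℕ => Real.log (k : ℝ) / (k : ℝ)) atTop (𝓝 0) :=
    (Real.isLittleO_log_id_atTop.tendsto_div_nhds_zero).comp tendsto_natCast_atTop_atTop
  have h2 : Tendsto (fun k : ℕ => (k : ℝ)⁻¹) atTop (𝓝 0) := tendsto_inv_atTop_nhds_zero_nat
  have h3 := (h2.mul_const (Real.log c)).add h1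
  rw [zero_mul, add_zero] at h3
  refine h3.congr' ?_
  filter_upwards [eventually_gt_atTop 0] with k hk
  have hk' : (0 : ℝ) < k := by exact_mod_cast hk
  rw [Real.log_mul hc.ne' hk'.ne']
  ring

/-- For a single selfadjoint element the limit superior in the definition of the free entropy may
be replaced by a limit inferior. -/
theorem eventually_le_vol_microstates_single (hφ : IsTracialState φ) (ha : IsSelfAdjoint a)
    {r : ℝ} (hr : (r : EReal) < chi φ (single a)) (m₀ : ℕ) {γ : ℝ} (hγ : 0 < γ) :
    ∀ᶠ k : ℕ in atTop, ENNReal.ofReal (Real.exp ((k : ℝ) ^ 2 * (r - Real.log k))) ≤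
      vol (microstates φ (single a) m₀ k γ) := by
  obtain ⟨r', hrr', hr'⟩ := EReal.lt_iff_exists_real_btwn.1 hr
  rw [EReal.coe_lt_coe_iff] at hrr'
  set m := max m₀ 2 with hm
  have hm2 : 2 ≤ m := le_max_right _ _
  set γ₁ := min (γ / 4) 1 with hγ₁
  have hγ₁0 : 0 < γ₁ := lt_min (by positivity) one_pos
  set c := Real.log Real.pi / 2 + 3 / 4 + Real.log 2 / 2 with hc
  -- The midpoint leaves room on both sides: r' - r₁ absorbs the errors at size K, and r₁ - r those
  -- at size k.
  set r₁ := (r + r') / 2 with hr₁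
  set e := r₁ - c with he
  set ρ := ‖a‖ + 1 with hρ
  have hρ1 : 1 ≤ ρ := by have := norm_nonneg a; linarith
  set C := ρ ^ (4 * m) + 2 with hC
  have hC0 : 0 < C := by positivity
  have hmom : ∀ N, N ≤ 2 * m → moment φ a (2 * N) ≤ C - 2 := by
    intro N hN
    refine (hφ.moment_le ha N).trans ?_
    rw [hC, add_sub_cancel_right]
    calc ‖a‖ ^ (2 * N) ≤ ρ ^ (2 * N) := by gcongr; linarith
      _ ≤ ρ ^ (4 * m) := pow_le_pow_right₀ hρ1 (by omega)
  obtain ⟨δ, hδ, Hδ⟩ := exists_le_vol_microstates_single hφ ha (m := m) hγ C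
  -- Fattening needs moments of order up to 2m of the subfamily, and sampling these needs moments of
  -- order up to 4m of the large family.
  obtain ⟨k₀, C', Hk⟩ := exists_strictMono_subfamily e C hγ₁0 (m := 2 * m) (by omega)
  have hfreq : ∃ᶠ K : ℕ in atTop, 0 < K ∧ ENNReal.ofReal (Real.exp ((K : ℝ) ^ 2 *
      (r' - Real.log K))) < vol (microstates φ (single a) (4 * m) K γ₁) := by
    have h1 : (r' : EReal) < chiAux φ (single a) (4 * m) γ₁ :=
      hr'.trans_le (iInf_le_of_le (4 * m) (iInf_le_of_le γ₁ (iInf_le _ hγ₁0)))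
    refine ((frequently_lt_of_lt_limsup (by isBoundedDefault) h1).and_eventually
      (eventually_gt_atTop 0)).mono fun K ⟨hK, hK0⟩ => ⟨hK0, ?_⟩
    have hK' : (0 : ℝ) < K := by exact_mod_cast hK0
    rw [coe_lt_mul_log_add_iff (by positivity)] at hK
    rw [div_inv_eq_mul] at hK
    simpa [mul_comm] using hK
  have hκ := tendsto_log_specConst
  have hinv : Tendsto (fun k : ℕ => (k : ℝ)⁻¹) atTop (𝓝 0) := tendsto_inv_atTop_nhds_zero_nat
  have hlargeK : ∀ᶠ K : ℕ in atTop, e * (K * (K - 1)) ≤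
      (K : ℝ) ^ 2 * (r' - Real.log K) - Real.log (specConst K) -
        K * Real.log (2 * √(K * C)) := by
    have h1 : Tendsto (fun K : ℕ => r' - (((K : ℝ) ^ 2)⁻¹ * Real.log (specConst K) + Real.log K) -
        (K : ℝ)⁻¹ * Real.log (4 * C * K) / 2 - e * (1 - (K : ℝ)⁻¹)) atTop
        (𝓝 (r' - c - 0 / 2 - e * (1 - 0))) :=
      (((tendsto_const_nhds.sub hκ).sub ((tendsto_log_const_mul_div (by positivity)).div_const 2)).sub
        ((tendsto_const_nhds.sub hinv).const_mul e))
    have h2 : 0 < r' - c - 0 / 2 - e * (1 - 0) := by rw [he, hr₁]; linarith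
    filter_upwards [h1.eventually_const_lt h2, eventually_gt_atTop 0] with K hK hK0
    have hK' : (0 : ℝ) < K := by exact_mod_cast hK0
    have h3 : Real.log (2 * √(K * C)) = Real.log (4 * C * K) / 2 := by
      rw [← Real.log_sqrt (by positivity)]
      congr 1
      rw [show 4 * C * K = 2 ^ 2 * (K * C) by ring, Real.sqrt_mul (by positivity) (K * C),
        Real.sqrt_sq (by norm_num)]
    have h4 := mul_pos hK (by positivity : (0 : ℝ) < (K : ℝ) ^ 2)
    rw [h3]
    have h5 : (r' - (((K : ℝ) ^ 2)⁻¹ * Real.log (specConst K) + Real.log K) -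
        (K : ℝ)⁻¹ * Real.log (4 * C * K) / 2 - e * (1 - (K : ℝ)⁻¹)) * (K : ℝ) ^ 2 =
        (K : ℝ) ^ 2 * (r' - Real.log K) - Real.log (specConst K) -
        K * (Real.log (4 * C * K) / 2) - e * (K * (K - 1)) := by
      field_simp
      ring
    linarith
  have hlargek : ∀ᶠ k : ℕ in atTop, (k : ℝ) ^ 2 * (r - Real.log k) ≤
      Real.log (specConst k) + k * (k - 1) * (e - C' / k) + k * Real.log (δ / k) := by
    have h1 : Tendsto (fun k : ℕ => (((k : ℝ) ^ 2)⁻¹ * Real.log (specConst k) + Real.log k) +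
        (1 - (k : ℝ)⁻¹) * (e - C' * (k : ℝ)⁻¹) - (k : ℝ)⁻¹ * Real.log (δ⁻¹ * k)) atTop
        (𝓝 (c + (1 - 0) * (e - C' * 0) - 0)) :=
      (hκ.add ((tendsto_const_nhds.sub hinv).mul (tendsto_const_nhds.sub
        (hinv.const_mul C')))).sub (tendsto_log_const_mul_div (by positivity))
    have h2 : r < c + (1 - 0) * (e - C' * 0) - 0 := by rw [he, hr₁]; linarith
    filter_upwards [h1.eventually_const_lt h2, eventually_gt_atTop 0] with k hk hk0
    have hk' : (0 : ℝ) < k := by exact_mod_cast hk0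
    have h3 : Real.log (δ⁻¹ * k) = - Real.log (δ / k) := by
      rw [← Real.log_inv, inv_div, div_eq_inv_mul]
    have h4 := mul_lt_mul_of_pos_right hk (by positivity : (0 : ℝ) < (k : ℝ) ^ 2)
    rw [h3] at h4
    have h5 : ((((k : ℝ) ^ 2)⁻¹ * Real.log (specConst k) + Real.log k) +
        (1 - (k : ℝ)⁻¹) * (e - C' * (k : ℝ)⁻¹) - (k : ℝ)⁻¹ * - Real.log (δ / k)) * (k : ℝ) ^ 2 =
        Real.log (specConst k) + k * (k - 1) * (e - C' / k) + k * Real.log (δ / k) +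
          (k : ℝ) ^ 2 * Real.log k := by
      field_simp
      ring
    linarith
  filter_upwards [hlargek, eventually_ge_atTop k₀, eventually_gt_atTop 0] with k hk hkk₀ hk0
  -- For each given large k, some K ≥ k is taken from the infinitely many sizes at which the volume
  -- is large.
  obtain ⟨K, ⟨hK0, hK⟩, hKe, hkK⟩ :=
    (hfreq.and_eventually (hlargeK.and (eventually_ge_atTop k))).exists
  obtain ⟨l, hl, hlE⟩ := exists_mem_specSet_logE hφ ha (by omega) (C := C)
    (by have h1 := hmom 1 (by omega); have h2 : γ₁ ≤ 1 := min_le_right _ _; rw [mul_one] at h1; linarith)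
    hC0 hK0 (Real.exp_pos _) hK
  rw [Real.log_exp] at hlE
  have hle : ∀ p, 1 ≤ p → p ≤ 2 * m → empMoment l (2 * p) ≤ C := by
    intro p h1 h2
    have h3 := (abs_lt.1 (hl.2 (2 * p) (by omega) (by omega))).2
    have h4 := hmom p h2
    have h5 : γ₁ ≤ 1 := min_le_right _ _
    linarith
  obtain ⟨z, hz, hzm, hzE⟩ := Hk k K hkk₀ hkK l hl.1.injective hle (hKe.trans hlE)
  refine le_trans ?_ ((Hδ k hk0 z hz (fun p h1 h2 => ?_) fun p h1 h2 => ?_).trans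
    (measure_mono fun A hA => microstates_mono (le_max_left _ _) le_rfl hA))
  · apply ENNReal.ofReal_le_ofReal
    apply Real.exp_le_exp.2
    linarith
  · have h3 := hzm p h1 (by omega)
    have h4 := hl.2 p h1 (by omega)
    have h5 : γ₁ ≤ γ / 4 := min_le_left _ _
    have h6 := abs_sub_le (empMoment z p) (empMoment l p) (moment φ a p)
    linarith
  · have h3 := (abs_lt.1 (hzm (2 * p) (by omega) (by omega))).2
    have h4 := (abs_lt.1 (hl.2 (2 * p) (by omega) (by omega))).2
    have h5 : γ₁ ≤ 1 := min_le_right _ _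
    have h6 := hmom p (by omega)
    linarith

end Regularity

end FreeEntropy

namespace FreeEntropy

open Matrix MeasureTheory Filter Topology

/-! ### Gaussian upper bounds and finiteness from above. -/

section Gaussian

variable {ι : Type*} [Fintype ι] {k : ℕ}

theorem integral_gaussian_coord {b : ℝ} : ∫ c : ι → Fin k → Fin k → ℝ,
    ∏ i, ∏ j, ∏ l, Real.exp (-b * c i j l ^ 2) =
      √(Real.pi / b) ^ (k ^ 2 * Fintype.card ι) := by
  rw [integral_fintype_prod_volume_eq_pow (fun c : Fin k → Fin k → ℝ =>
      ∏ j, ∏ l, Real.exp (-b * c j l ^ 2)),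
    integral_fintype_prod_volume_eq_pow (fun c : Fin k → ℝ => ∏ l, Real.exp (-b * c l ^ 2)),
    integral_fintype_prod_volume_eq_pow (fun c : ℝ => Real.exp (-b * c ^ 2)),
    integral_gaussian, Fintype.card_fin, ← pow_mul, ← pow_mul, sq, mul_assoc]

/-- Markov's inequality: the function exp(b(R - |c|²)) is at least 1 on the ball, and its integral
is explicit. -/
theorem volume_sum_sq_le {b : ℝ} (hb : 0 < b) (R : ℝ) :
    volume {c : ι → Fin k → Fin k → ℝ | ∑ i, ∑ j, ∑ l, c i j l ^ 2 ≤ R} ≤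
      ENNReal.ofReal (Real.exp (b * R) * √(Real.pi / b) ^ (k ^ 2 * Fintype.card ι)) := by
  have hint := integral_gaussian_coord (ι := ι) (k := k) (b := b)
  have hpos : 0 < √(Real.pi / b) ^ (k ^ 2 * Fintype.card ι) := by positivity
  have hI := (Integrable.of_integral_ne_zero (hint ▸ hpos.ne')).const_mul (Real.exp (b * R))
  rw [← hint, ← integral_const_mul, ofReal_integral_eq_lintegral_ofReal hI
    (ae_of_all _ fun c => by positivity)]
  refine meas_le_lintegral₀ hI.aemeasurable.ennreal_ofReal fun c hc => ?_
  rw [← ENNReal.ofReal_one]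
  apply ENNReal.ofReal_le_ofReal
  simp only [← Real.exp_sum, ← Finset.mul_sum, ← Real.exp_add]
  rw [Real.one_le_exp_iff]
  have := mul_le_mul_of_nonneg_left (show ∑ i, ∑ j, ∑ l, c i j l ^ 2 ≤ R from hc) hb.le
  linarith

variable {M : Type*} [CStarAlgebra M]

/-- The Gaussian upper bound for the volume of microstate spaces. -/
theorem vol_microstates_le (φ : M →ₗ[ℂ] ℂ) (x : ι → M) {m : ℕ} (hm : 2 ≤ m) {γ : ℝ} (hγ : γ ≤ 1)
    (hk : 0 < k) : vol (microstates φ x m k γ) ≤ ENNReal.ofReal (Real.exp ((k : ℝ) ^ 2 *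
      (∑ i, (‖φ (x i ^ 2)‖ + 1) + Fintype.card ι * (Real.log Real.pi / 2 - Real.log k)))) := by
  have hk' : (0 : ℝ) < k := by exact_mod_cast hk
  set R := ∑ i, (‖φ (x i ^ 2)‖ + 1) with hR
  refine (measure_mono fun c hc => ?_).trans
    ((volume_sum_sq_le (ι := ι) (b := (k : ℝ) ^ 2) (by positivity) R).trans_eq ?_)
  · change ∑ i, ∑ j, ∑ l, c i j l ^ 2 ≤ R
    refine Finset.sum_le_sum fun i _ => ?_
    have h1 := hc.2 2 (by norm_num) hm fun _ => i
    have e1 : monomial (fun i => hermOfCoord (c i)) (fun _ : Fin 2 => i) =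
        hermOfCoord (c i) * hermOfCoord (c i) := by simp [monomial]
    have e2 : monomial x (fun _ : Fin 2 => i) = x i ^ 2 := by simp [monomial, sq]
    rw [e1, e2, ntr_hermOfCoord_sq] at h1
    have h2 := norm_sub_norm_le ((∑ j, ∑ l, c i j l ^ 2 : ℝ) : ℂ) (φ (x i ^ 2))
    rw [Complex.norm_real] at h2
    have h3 := Real.le_norm_self (∑ j, ∑ l, c i j l ^ 2)
    linarith
  · congr 1
    have h1 : √(Real.pi / (k : ℝ) ^ 2) = Real.exp (Real.log Real.pi / 2 - Real.log k) := by
      rw [Real.exp_sub, Real.exp_log hk', ← Real.log_sqrt Real.pi_pos.le,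
        Real.exp_log (by positivity), Real.sqrt_div Real.pi_pos.le, Real.sqrt_sq hk'.le]
    rw [h1, ← Real.exp_nat_mul, ← Real.exp_add]
    congr 1
    push_cast
    ring

theorem chi_lt_top (φ : M →ₗ[ℂ] ℂ) (x : ι → M) : chi φ x < ⊤ := by
  set u : ℝ := ∑ i, (‖φ (x i ^ 2)‖ + 1) + Fintype.card ι * (Real.log Real.pi / 2) with hu
  refine lt_of_le_of_lt (b := (u : EReal)) ?_ (EReal.coe_lt_top u)
  refine iInf_le_of_le 2 (iInf_le_of_le 1 (iInf_le_of_le one_pos ?_))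
  refine limsup_le_of_le (by isBoundedDefault) ?_
  filter_upwards [eventually_gt_atTop 0] with k hk
  have hk' : (0 : ℝ) < k := by exact_mod_cast hk
  rw [← not_lt, coe_lt_mul_log_add_iff (by positivity), not_lt]
  refine (vol_microstates_le φ x le_rfl le_rfl hk).trans_eq ?_
  congr 2
  rw [div_inv_eq_mul]
  ring

end Gaussian

/-! ### From volumes to entropies. -/

section Subadditivity

variable {M : Type*} [CStarAlgebra M] {φ : M →ₗ[ℂ] ℂ} {a : M}
  {ι κ : Type*} [Fintype ι] [Fintype κ]

theorem eventually_vol_lt_of_chi_lt {x : ι → M} {u : ℝ} (h : chi φ x < u) :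
    ∃ (m : ℕ) (γ : ℝ), 0 < γ ∧ ∀ m' γ', m ≤ m' → γ' ≤ γ → ∀ᶠ k : ℕ in atTop,
      vol (microstates φ x m' k γ') <
        ENNReal.ofReal (Real.exp ((k : ℝ) ^ 2 * (u - Fintype.card ι * Real.log k))) := by
  simp only [chi, iInf_lt_iff] at h
  obtain ⟨m, γ, hγ, h⟩ := h
  refine ⟨m, γ, hγ, fun m' γ' hm hγ' => ?_⟩
  filter_upwards [eventually_lt_of_limsup_lt h (by isBoundedDefault), eventually_gt_atTop 0]
    with k hk hk0
  have hk' : (0 : ℝ) < k := by exact_mod_cast hk0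
  rw [mul_log_add_lt_coe_iff (by positivity), div_inv_eq_mul, mul_comm] at hk
  exact lt_of_le_of_lt (measure_mono fun A hA => microstates_mono hm hγ' hA) hk

/-- The volume inequality is divided by vol Γ(a), which is bounded below for all large k. The log k
terms balance: a is counted once in each factor on the right and once in the divisor, which leaves
it once. -/
theorem chi_elim_le_of_lt (hφ : IsTracialState φ) (ha : IsSelfAdjoint a) (x : ι → M) (y : κ → M)
    {u v r : ℝ} (hu : chi φ (Sum.elim x (single a)) < u) (hv : chi φ (Sum.elim y (single a)) < v)
    (hr : r < chi φ (single a)) :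
    chi φ (Sum.elim (Sum.elim x y) (single a)) ≤ ((u + v - r : ℝ) : EReal) := by
  obtain ⟨m₁, γ₁, hγ₁, H₁⟩ := eventually_vol_lt_of_chi_lt hu
  obtain ⟨m₂, γ₂, hγ₂, H₂⟩ := eventually_vol_lt_of_chi_lt hv
  obtain ⟨m, γ, hγ, hm2, hγ1, H⟩ := exists_vol_mul_vol_le hφ ha x y (max m₁ m₂) (lt_min hγ₁ hγ₂)
  refine iInf_le_of_le m (iInf_le_of_le γ (iInf_le_of_le hγ ?_))
  refine limsup_le_of_le (by isBoundedDefault) ?_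
  filter_upwards [H₁ _ _ (le_max_left _ _) (min_le_left _ _),
    H₂ _ _ (le_max_right _ _) (min_le_right _ _),
    eventually_le_vol_microstates_single hφ ha hr m hγ, eventually_gt_atTop 0] with k h₁ h₂ h₃ hk
  have hk' : (0 : ℝ) < k := by exact_mod_cast hk
  have hpos : 0 < ENNReal.ofReal (Real.exp ((k : ℝ) ^ 2 * (r - Real.log k))) := by
    simp [Real.exp_pos]
  have hmul := H k hk (hpos.trans_le h₃).ne'
    ((vol_microstates_le φ (single a) hm2 hγ1 hk).trans_lt ENNReal.ofReal_lt_top).ne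
  rw [← not_lt, coe_lt_mul_log_add_iff (by positivity), not_lt, div_inv_eq_mul]
  have h4 := (mul_le_mul_left h₃ _).trans (hmul.trans (mul_le_mul' h₁.le h₂.le))
  rw [← ENNReal.ofReal_mul (Real.exp_pos _).le, ← Real.exp_add] at h4
  rw [← ENNReal.mul_le_mul_iff_right hpos.ne' ENNReal.ofReal_ne_top]
  refine h4.trans_eq ?_
  rw [← ENNReal.ofReal_mul (Real.exp_pos _).le, ← Real.exp_add]
  congr 2
  simp only [Fintype.card_sum, Fintype.card_unit]
  push_cast
  ring

/-- Subadditivity of free entropy relative to a selfadjoint element of finite free entropy. -/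
theorem chi_elim_le (hφ : IsTracialState φ) (ha : IsSelfAdjoint a) (x : ι → M) (y : κ → M)
    (hchi : ⊥ < chi φ (single a)) :
    chi φ (Sum.elim (Sum.elim x y) (single a)) ≤ chi φ (Sum.elim x (single a)) +
      chi φ (Sum.elim y (single a)) - chi φ (single a) := by
  have H := fun u v r : ℝ => chi_elim_le_of_lt (u := u) (v := v) (r := r) hφ ha x y
  have hX := chi_lt_top φ (Sum.elim x (single a))
  have hY := chi_lt_top φ (Sum.elim y (single a))
  have hA := chi_lt_top φ (single a)
  generalize chi φ (Sum.elim (Sum.elim x y) (single a)) = c at H ⊢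
  generalize chi φ (Sum.elim x (single a)) = X at H hX ⊢
  generalize chi φ (Sum.elim y (single a)) = Y at H hY ⊢
  generalize chi φ (single a) = α at H hA hchi ⊢
  lift α to ℝ using ⟨hA.ne, hchi.ne'⟩
  refine EReal.le_of_forall_lt_iff_le.1 fun d hd => ?_
  suffices h : ∃ u v r : ℝ, X < u ∧ Y < v ∧ r < α ∧ u + v - r ≤ d by
    obtain ⟨u, v, r, h1, h2, h3, h4⟩ := h
    exact (H u v r h1 h2 (by exact_mod_cast h3)).trans (by exact_mod_cast h4)
  -- If one entropy on the right is -∞, its real upper bound can be taken low enough to compensate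
  -- for the other terms.
  rcases eq_or_ne X ⊥ with rfl | hX'
  · obtain ⟨v, hv, -⟩ := EReal.lt_iff_exists_real_btwn.1 hY
    exact ⟨d - v + (α - 1), v, α - 1, EReal.bot_lt_coe _, hv, by linarith, by linarith⟩
  rcases eq_or_ne Y ⊥ with rfl | hY'
  · obtain ⟨u, hu, -⟩ := EReal.lt_iff_exists_real_btwn.1 hX
    exact ⟨u, d - u + (α - 1), α - 1, hu, EReal.bot_lt_coe _, by linarith, by linarith⟩
  lift X to ℝ using ⟨hX.ne, hX'⟩
  lift Y to ℝ using ⟨hY.ne, hY'⟩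
  have hd' : X + Y - α < d := by exact_mod_cast hd
  set ε := (d - (X + Y - α)) / 3 with hε
  have hε0 : 0 < ε := by rw [hε]; linarith
  refine ⟨X + ε, Y + ε, α - ε, ?_, ?_, by linarith, by rw [hε]; linarith⟩
  · exact_mod_cast (by linarith : X < X + ε)
  · exact_mod_cast (by linarith : Y < Y + ε)

end Subadditivity

end FreeEntropy

theorem corollary2p4 {M : Type*} [CStarAlgebra M] [WStarAlgebra M]
    (φ : M →ₗ[ℂ] ℂ) (hφ : FreeEntropy.IsTracialState φ)
    (p q : ℕ) (F : Fin p → M) (G : Fin q → M) (a : M)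
    (hF : ∀ i, IsSelfAdjoint (F i)) (hG : ∀ j, IsSelfAdjoint (G j)) (ha : IsSelfAdjoint a)
    (hchi : ⊥ < FreeEntropy.chi φ (FreeEntropy.single a)) :
    FreeEntropy.chi φ (Sum.elim (Sum.elim F G) (FreeEntropy.single a)) ≤
      FreeEntropy.chi φ (Sum.elim F (FreeEntropy.single a)) +
        FreeEntropy.chi φ (Sum.elim G (FreeEntropy.single a)) -
          FreeEntropy.chi φ (FreeEntropy.single a) :=
  FreeEntropy.chi_elim_le hφ ha F G hchi
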